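/- **Setting.** There are $K<\infty$ cluster types. A cluster of type $k$ has $M_k$ units, binary treatment vector $A\in\mathcal A(M_k)=\{0,1\}^{M_k}$, covariates $X$ in a standard Borel space $\mathcal X(k)$ (e.g. a Borel subset of a Euclidean space), and potential outcomes $Y(a)\in\mathbb R^{M_k}$, $a\in\mathcal A(M_k)$. The observed outcome is $Y=Y(A)$ (consistency), $O=(Y,A,X)$, and $L$ is the cluster type. Let $p_k^*=\mathrm{pr}(L=k)>0$, let $P_k$ be the law of $X$ given $L=k$, and write $e^*(a\mid x,k)=\mathrm{pr}(A=a\mid X=x,L=k)$, $g^*(a,x,k)=E(Y\mid A=a,X=x,L=k)$, $\Sigma^*(a,x,k)=\mathrm{var}(Y\mid A=a,X=x,L=k)$. Assume, for all $k$, all $a\in\mathcal A(M_k)$ and $P_k$-almost every $x$: $Y(a)\perp A\mid X$ within type $k$; $c<e^*(a\mid x,k)<1-c$ for some constant $c>0$; $g^*$ and $\Sigma^*$ exist, $E\{g^*(a,X,k)\mid L=k\}$ and $E\{\Sigma^*(a,X,k)\mid L=k\}$ exist and are finite, and $\Sigma^*(a,x,k)$ is positive definite. **Estimand.** For bounded measurable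 weights $w_k(a,x)\in\mathbb R^{M_k}$ and functions $v_k$ continuously differentiable on $(0,\infty)$, let $\theta_k^*=\sum_{a\in\mathcal A(M_k)}E\{w_k(a,X)^{\mathsf T}Y(a)\mid L=k\}$ and $\tau^*=\sum_{k=1}^K v_k(p_k^*)\theta_k^*$. Put $$\phi_k(O,e,g)=\mathbb 1(L=k)\Big[\frac{w_k(A,X)^{\mathsf T}\{Y-g(A,X,k)\}}{e(A\mid X,k)}+\sum_{a\in\mathcal A(M_k)}w_k(a,X)^{\mathsf T}g(a,X,k)\Big],$$ $$\varphi(\tau^*)=\sum_{k=1}^K v_k(p_k^*)\frac{\mathbb 1(L=k)\{\phi_k(O,e^*,g^*)-\theta_k^*\}}{p_k^*}+\sum_{k=1}^K\{\mathbb 1(L=k)-p_k^*\}v_k'(p_k^*)\theta_k^* .$$ **Cross-fitting.** Observe $(O_i,L_i)$, $i=1,\dots,N$, independent with the law of $(O,L)$. The sample is split at random (depending only on $L_1,\dots,L_N$ and on randomness independent of the data) into $\mathcal I_1,\mathcal I_2$ such that for every $k$ the difference between the proportions of type $k$ in $\mathcal I_1$ and in $\mathcal I_2$ tends to $0$ in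 probability. For $\ell=1,2$ the estimates $\widetilde g_{(-\ell)}$ and $\widetilde e_{(-\ell)}$ are jointly measurable functions of their arguments, of the data in $\mathcal I_{3-\ell}$, and possibly of the external randomness. With $N_k$ the number of sampled clusters of type $k$ and $\widehat p_k=N_k/N$, let $\widetilde\theta_k=N_k^{-1}\sum_{\ell=1}^2\sum_{i\in\mathcal I_\ell}\phi_k(O_i,\widetilde e_{(-\ell)},\widetilde g_{(-\ell)})$, $\widetilde\tau=\sum_{k=1}^K v_k(\widehat p_k)\widetilde\theta_k$ and $$\widetilde\sigma^2=\frac1N\sum_{\ell=1}^2\sum_{i\in\mathcal I_\ell}\Big[\sum_{k=1}^K\Big[\frac{\mathbb 1(L_i=k)v_k(\widehat p_k)}{\widehat p_k}\{\phi_k(O_i,\widetilde e_{(-\ell)},\widetilde g_{(-\ell)})-\widetilde\theta_k\}+\{\mathbb 1(L_i=k)-\widehat p_k\}v_k'(\widehat p_k)\widetilde\theta_k\Big]\Big]^2 .$$ **Conditions.** For all $\ell\in\{1,2\}$, $k$ and $a\in\mathcal A(M_k)$: (a) there are constants $\widetilde C\in(0,\infty)$ and $\widetilde c\in(0,1)$,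 not depending on $N$, with $\|g^*(a,x,k)\|_2\le\widetilde C$, $\|\widetilde g_{(-\ell)}(a,x,k)\|_2\le\widetilde C$, $\|\Sigma^*(a,x,k)\|_2\le\widetilde C$ and $\widetilde e_{(-\ell)}(a\mid x,k)\in[\widetilde c,1-\widetilde c]$, for $P_k$-almost every $x$ (and, for the estimates, almost surely); (b) $\int\|g^*(a,x,k)-\widetilde g_{(-\ell)}(a,x,k)\|_2^2\,dP_k(x)=O_P(r_{g,N}^2)$ and $\int|e^*(a\mid x,k)-\widetilde e_{(-\ell)}(a\mid x,k)|^2\,dP_k(x)=O_P(r_{e,N}^2)$, where $r_{g,N}=o(1)$, $r_{e,N}=o(1)$ and $r_{g,N}r_{e,N}=o(N^{-1/2})$ as $N\to\infty$. **Conclusion.** $\varphi(\tau^*)$ is square integrable, and $N^{1/2}(\widetilde\tau-\tau^*)$ converges weakly to $N(0,\mathrm{var}\{\varphi(\tau^*)\})$ as $N\to\infty$. Here $\mathrm{var}\{\varphi(\tau^*)\}$ is the global efficiency bound: $\tau^*$ is the value at the law $P$ of $(O,L)$ of the functional $\tau(\cdot)=\sum_k v_k(p_k)\sum_a E\{w_k(a,X)^{\mathsf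 T}g(a,X,k)\mid L=k\}$, this functional is differentiable along all regular one-dimensional submodels $t\mapsto P_t$ through $P_0=P$ of the nonparametric model of all laws of $(O,L)$, and $\mathrm{var}\{\varphi(\tau^*)\}$ is the supremum of the Cramér–Rao bounds $\{d\tau(P_t)/dt|_{t=0}\}^2/E_P(s^2)$ over such submodels with score $s$, $E_P(s^2)>0$. (Regular: for $t$ near $0$, $|dP_t/dP-1|\le C|t|$ for a constant $C$, and $t\mapsto dP_t/dP$ has derivative $s$ at $t=0$, $P$-almost surely; the scores are the bounded mean-zero functions.) Moreover $\widetilde\sigma^2\to\mathrm{var}\{\varphi(\tau^*)\}$ in probability. -/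

import Mathlib

open MeasureTheory ProbabilityTheory Filter Topology Asymptotics
open scoped ENNReal NNReal

noncomputable section

namespace PartialInterference

/-! ### Data of one cluster -/

/-- Treatment vectors of a cluster with `m` units. -/
abbrev Trt (m : ℕ) : Type := Fin m → Bool

/-- Outcome vectors of a cluster with `m` units, with the Euclidean norm. -/
abbrev Outc (m : ℕ) : Type := EuclideanSpace ℝ (Fin m)

/-- Full data `((Y(a))_a, A, X)` of a cluster with `m` units and covariates in `S`. -/
abbrev FullData (m : ℕ) (S : Type*) := (Trt m → Outc m) × Trt m × S

/-- Observed data `O = (Y, A, X)` of a cluster with `m` units and covariates in `S`. -/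
abbrev ObsData (m : ℕ) (S : Type*) := Outc m × Trt m × S

variable {K : ℕ}

/-- Full data of a cluster together with its type `L` (the first component). -/
abbrev FullCluster (M : Fin K → ℕ) (S : Fin K → Type*) := Σ k, FullData (M k) (S k)

/-- Observed data of a cluster together with its type `L` (the first component). -/
abbrev ObsCluster (M : Fin K → ℕ) (S : Fin K → Type*) := Σ k, ObsData (M k) (S k)

/-- Consistency: the observed outcome is the potential outcome at the received treatment. -/
def observe {M : Fin K → ℕ} {S : Fin K → Type*} (z : FullCluster M S) : ObsCluster M S :=
  ⟨z.1, z.2.1 z.2.2.1, z.2.2⟩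

/-! ### Type probabilities and conditional laws given the type -/

section TypeLaw

variable {D : Fin K → Type*} [∀ k, MeasurableSpace (D k)]

/-- `p_k = pr(L = k)`. -/
def typeProb (Q : Measure (Σ k, D k)) (k : Fin K) : ℝ := Q.real (Sigma.fst ⁻¹' {k})

/-- The conditional law of the data given `L = k` (as a law on the data space of type `k`). -/
def typeLaw (Q : Measure (Σ k, D k)) (k : Fin K) : Measure (D k) :=
  (Q (Sigma.fst ⁻¹' {k})).toNNReal⁻¹ • Q.comap (Sigma.mk k)

instance (Q : Measure (Σ k, D k)) [IsFiniteMeasure Q] (k : Fin K) :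
    IsFiniteMeasure (typeLaw Q k) := by
  unfold typeLaw; infer_instance

end TypeLaw

variable {M : Fin K → ℕ} {S : Fin K → Type*} [∀ k, MeasurableSpace (S k)]

/-! ### Nuisance functions of an observed-data law `Q` -/

/-- The law `P_k` of `X` given `L = k`. -/
def covLaw (Q : Measure (ObsCluster M S)) (k : Fin K) : Measure (S k) :=
  (typeLaw Q k).map fun o => o.2.2

/-- The propensity score `e(a | x, k) = pr(A = a | X = x, L = k)`. -/
def propensity (Q : Measure (ObsCluster M S)) [IsFiniteMeasure Q]
    (k : Fin K) (a : Trt (M k)) (x : S k) : ℝ :=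
  (condDistrib (fun o : ObsData (M k) (S k) => o.2.1) (fun o => o.2.2) (typeLaw Q k) x).real {a}

/-- The conditional law of `Y` given `A = a`, `X = x`, `L = k`. -/
def outcomeLaw (Q : Measure (ObsCluster M S)) [IsFiniteMeasure Q]
    (k : Fin K) (a : Trt (M k)) (x : S k) : Measure (Outc (M k)) :=
  condDistrib (fun o : ObsData (M k) (S k) => o.1) (fun o => o.2) (typeLaw Q k) (a, x)

/-- The outcome regression `g(a, x, k) = E(Y | A = a, X = x, L = k)`. -/
def outcomeReg (Q : Measure (ObsCluster M S)) [IsFiniteMeasure Q]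
    (k : Fin K) (a : Trt (M k)) (x : S k) : Outc (M k) :=
  ∫ y, y ∂(outcomeLaw Q k a x)

/-- The conditional covariance `Σ(a, x, k) = var(Y | A = a, X = x, L = k)`. -/
def outcomeCov (Q : Measure (ObsCluster M S)) [IsFiniteMeasure Q]
    (k : Fin K) (a : Trt (M k)) (x : S k) : Matrix (Fin (M k)) (Fin (M k)) ℝ :=
  fun i j => covariance (fun y : Outc (M k) => y i) (fun y => y j) (outcomeLaw Q k a x)

/-! ### Identifying assumptions on the full-data law `F` (consistency is built into `observe`) -/

/-- The law of the observed data `(O, L)` of a cluster. -/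
def obsLaw (F : Measure (FullCluster M S)) : Measure (ObsCluster M S) := F.map observe

lemma measurable_observe : Measurable (observe (M := M) (S := S)) := by
  have key : ∀ k, Measurable fun d : FullData (M k) (S k) =>
      ((d.1 d.2.1, d.2) : ObsData (M k) (S k)) := by
    intro k
    refine Measurable.prodMk ?_ measurable_snd
    have h : Measurable fun q : (Trt (M k) → Outc (M k)) × Trt (M k) => q.1 q.2 :=
      measurable_from_prod_countable_left fun a => measurable_pi_apply a
    exact h.comp (measurable_fst.prodMk (measurable_fst.comp measurable_snd))
  intro t ht
  refine MeasurableSpace.measurableSet_iInf.2 fun k => ?_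
  have ht' := MeasurableSpace.measurableSet_iInf.1 ht k
  exact key k ht'

instance (F : Measure (FullCluster M S)) [IsProbabilityMeasure F] :
    IsProbabilityMeasure (obsLaw F) :=
  Measure.isProbabilityMeasure_map measurable_observe.aemeasurable

/-- Conditional ignorability, overlap and moment assumptions. The pointwise conditions in `x`
are imposed for almost every `x` under the law of `X` given `L = k`. -/
structure IdentifyingAssumptions [∀ k, StandardBorelSpace (S k)]
    (F : Measure (FullCluster M S)) [IsProbabilityMeasure F] : Prop where
  /-- `Y(a)` and `A` are conditionally independent given `X`, within type `k`. -/
  ignorability : ∀ k (a : Trt (M k)),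
    CondIndepFun (MeasurableSpace.comap (fun d : FullData (M k) (S k) => d.2.2) inferInstance)
      (measurable_snd.comp measurable_snd).comap_le
      (fun d => d.1 a) (fun d => d.2.1) (typeLaw F k)
  /-- Positivity / overlap. -/
  overlap : ∃ c : ℝ, 0 < c ∧ ∀ k (a : Trt (M k)), ∀ᵐ x ∂(covLaw (obsLaw F) k),
    c < propensity (obsLaw F) k a x ∧ propensity (obsLaw F) k a x < 1 - c
  /-- The conditional mean and covariance of the outcome exist, -/
  moments : ∀ k (a : Trt (M k)), ∀ᵐ x ∂(covLaw (obsLaw F) k),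
    MemLp (fun y => y) 2 (outcomeLaw (obsLaw F) k a x)
  /-- have finite expectations given `L = k`, -/
  integrable_reg : ∀ k (a : Trt (M k)),
    Integrable (fun x => outcomeReg (obsLaw F) k a x) (covLaw (obsLaw F) k)
  integrable_cov : ∀ k (a : Trt (M k)) (i j : Fin (M k)),
    Integrable (fun x => outcomeCov (obsLaw F) k a x i j) (covLaw (obsLaw F) k)
  /-- and the conditional covariance is positive definite. -/
  posDef : ∀ k (a : Trt (M k)), ∀ᵐ x ∂(covLaw (obsLaw F) k),
    (outcomeCov (obsLaw F) k a x).PosDef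

/-! ### The estimand -/

/-- `θ_k = ∑_a E{ w_k(a, X)ᵀ Y(a) | L = k }`. -/
def theta (w : ∀ k, Trt (M k) → S k → Outc (M k)) (F : Measure (FullCluster M S))
    (k : Fin K) : ℝ :=
  ∑ a : Trt (M k), ∫ d, inner ℝ (w k a d.2.2) (d.1 a) ∂(typeLaw F k)

/-- `τ = ∑_k v_k(p_k) θ_k`. -/
def tau (w : ∀ k, Trt (M k) → S k → Outc (M k)) (v : Fin K → ℝ → ℝ)
    (F : Measure (FullCluster M S)) : ℝ :=
  ∑ k, v k (typeProb F k) * theta w F k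

/-- The observed-data functional
`Q ↦ ∑_k v_k(p_k) ∑_a E{ w_k(a, X)ᵀ g(a, X, k) | L = k }` that identifies `τ`. -/
def tauObs (w : ∀ k, Trt (M k) → S k → Outc (M k)) (v : Fin K → ℝ → ℝ)
    (Q : ProbabilityMeasure (ObsCluster M S)) : ℝ :=
  ∑ k, v k (typeProb (Q : Measure (ObsCluster M S)) k) *
    ∑ a : Trt (M k), ∫ x, inner ℝ (w k a x) (outcomeReg (Q : Measure (ObsCluster M S)) k a x)
      ∂(covLaw (Q : Measure (ObsCluster M S)) k)

/-! ### The influence function -/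

/-- `φ_k(O, e, g)`: equal to
`1(L = k) [ w_k(A,X)ᵀ {Y - g(A,X,k)} / e(A|X,k) + ∑_a w_k(a,X)ᵀ g(a,X,k) ]`. -/
def phi (w : ∀ k, Trt (M k) → S k → Outc (M k)) (e : ∀ k, Trt (M k) → S k → ℝ)
    (g : ∀ k, Trt (M k) → S k → Outc (M k)) (k : Fin K) : ObsCluster M S → ℝ
  | ⟨l, y, a, x⟩ =>
    if l = k then
      inner ℝ (w l a x) (y - g l a x) / e l a x + ∑ b : Trt (M l), inner ℝ (w l b x) (g l b x)
    else 0

/-- `1(L = k)`. -/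
def typeInd (k : Fin K) (z : ObsCluster M S) : ℝ := if z.1 = k then 1 else 0

/-- The function `φ(τ*)`. -/
def influence (w : ∀ k, Trt (M k) → S k → Outc (M k)) (v : Fin K → ℝ → ℝ)
    (F : Measure (FullCluster M S)) [IsProbabilityMeasure F] (z : ObsCluster M S) : ℝ :=
  ∑ k, v k (typeProb F k) *
      (typeInd k z * (phi w (propensity (obsLaw F)) (outcomeReg (obsLaw F)) k z - theta w F k)
        / typeProb F k)
    + ∑ k, (typeInd k z - typeProb F k) * deriv (v k) (typeProb F k) * theta w F k

/-! ### The semiparametric efficiency bound in the nonparametric model -/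

section Efficiency

variable {Z : Type*} [MeasurableSpace Z]

/-- `Q` is a regular one-dimensional submodel of the model of all probability laws on `Z`, through
`P` at `t = 0` and with score `s`: near `t = 0` the likelihood ratios `dQ_t/dP = r t` satisfy
`|r t - 1| ≤ C |t|`, and their derivative at `t = 0` is `s`. The scores of such submodels are
exactly the bounded mean-zero functions (up to null sets), which are dense in the tangent space
of all square integrable mean-zero functions. -/
def IsRegularSubmodel (P : ProbabilityMeasure Z) (Q : ℝ → ProbabilityMeasure Z) (s : Z → ℝ) :
    Prop :=
  Measurable s ∧ ∃ (r : ℝ → Z → ℝ) (C : ℝ),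
    (∀ t, Measurable (r t)) ∧
    (∀ᶠ t in 𝓝 (0 : ℝ), (∀ z, 0 ≤ r t z ∧ |r t z - 1| ≤ C * |t|) ∧
      (Q t : Measure Z) = (P : Measure Z).withDensity fun z => ENNReal.ofReal (r t z)) ∧
    ∀ᵐ z ∂(P : Measure Z), HasDerivAt (fun t => r t z) (s z) 0

/-- `B` is the semiparametric efficiency bound at `P` of the functional `ψ` in the nonparametric
model: `ψ` is differentiable along every regular submodel through `P`, and `B` is the supremum of
the Cramér–Rao bounds `(dψ(Q_t)/dt)² / E(s²)` of these submodels. -/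
def IsEfficiencyBound (P : ProbabilityMeasure Z) (ψ : ProbabilityMeasure Z → ℝ) (B : ℝ) : Prop :=
  (∀ Q s, IsRegularSubmodel P Q s → DifferentiableAt ℝ (fun t => ψ (Q t)) 0) ∧
  IsLUB {b : ℝ | ∃ Q s, IsRegularSubmodel P Q s ∧ 0 < ∫ z, s z ^ 2 ∂(P : Measure Z) ∧
    b = deriv (fun t => ψ (Q t)) 0 ^ 2 / ∫ z, s z ^ 2 ∂(P : Measure Z)} B

end Efficiency

/-! ### Two-fold cross-fitting, for a sample `z` of `N` clusters split into folds by `f` -/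

section CrossFit

variable {N : ℕ}

/-- `N_k`, the number of sampled clusters of type `k`. -/
def typeCount (z : Fin N → ObsCluster M S) (k : Fin K) : ℕ :=
  (Finset.univ.filter fun i => (z i).1 = k).card

/-- `p̂_k = N_k / N`. -/
def pHat (z : Fin N → ObsCluster M S) (k : Fin K) : ℝ := (typeCount z k : ℝ) / N

/-- The proportion of type `k` among the clusters in fold `ℓ`. -/
def foldProp (f : Fin N → Fin 2) (z : Fin N → ObsCluster M S) (ℓ : Fin 2) (k : Fin K) : ℝ :=
  ((Finset.univ.filter fun i => f i = ℓ ∧ (z i).1 = k).card : ℝ) /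
    ((Finset.univ.filter fun i => f i = ℓ).card : ℝ)

/-- The data that remain for training when fold `ℓ` is held out: the clusters of fold `ℓ` are
replaced by the dummy `Sum.inl ()`. -/
def trainData (f : Fin N → Fin 2) (z : Fin N → ObsCluster M S) (ℓ : Fin 2) :
    Fin N → Unit ⊕ ObsCluster M S :=
  fun i => if f i = ℓ then Sum.inl () else Sum.inr (z i)

variable (w : ∀ k, Trt (M k) → S k → Outc (M k)) (v : Fin K → ℝ → ℝ)
  (e : Fin 2 → ∀ k, Trt (M k) → S k → ℝ) (g : Fin 2 → ∀ k, Trt (M k) → S k → Outc (M k))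
  (f : Fin N → Fin 2) (z : Fin N → ObsCluster M S)

/-- `θ̃_k = ∑_ℓ ∑_{i ∈ I_ℓ} φ_k(O_i, ẽ_(-ℓ), g̃_(-ℓ)) / N_k`, where `e ℓ`, `g ℓ` are the nuisance
functions that are used on fold `ℓ`. -/
def thetaTilde (k : Fin K) : ℝ :=
  (∑ ℓ : Fin 2, ∑ i with f i = ℓ, phi w (e ℓ) (g ℓ) k (z i)) / (typeCount z k : ℝ)

/-- `τ̃ = ∑_k v_k(p̂_k) θ̃_k`. -/
def tauTilde : ℝ := ∑ k, v k (pHat z k) * thetaTilde w e g f z k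

/-- The variance estimator `σ̃²`. -/
def sigmaTildeSq : ℝ :=
  (1 / (N : ℝ)) * ∑ ℓ : Fin 2, ∑ i with f i = ℓ,
    (∑ k, (typeInd k (z i) * v k (pHat z k) / pHat z k
          * (phi w (e ℓ) (g ℓ) k (z i) - thetaTilde w e g f z k)
        + (typeInd k (z i) - pHat z k) * deriv (v k) (pHat z k) * thetaTilde w e g f z k)) ^ 2

end CrossFit

/-! ### Stochastic order -/

/-- `X_N = O_P(a_N)`. -/
def IsBigOP {Ω : Type*} [MeasurableSpace Ω] (μ : Measure Ω) (X : ℕ → Ω → ℝ) (a : ℕ → ℝ) : Prop :=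
  ∀ ε : ℝ, 0 < ε → ∃ B : ℝ, ∀ᶠ N in atTop, μ.real {ω | B * |a N| < |X N ω|} ≤ ε

end PartialInterference

end

noncomputable section

namespace PartialInterference

/-! ### Laws on a disjoint union of finitely many data spaces -/

section SigmaLaw

variable {K : ℕ} {D : Fin K → Type*} [∀ k, MeasurableSpace (D k)]

/-! A law on clusters is the mixture of its conditional laws given the type, so nearly everything is
proved for one type and then summed. The engine is double robustness (`integral_phiOf`): the mean of
the score at nuisance functions `(e, g)` differs from its target by `∑_a E[w · (g - g*)(1 - e*/e)]`,
a product of two errors. It is used in three ways. At the true nuisance functions it gives the mean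
`θ_k`. At estimated ones Cauchy–Schwarz bounds the bias by a product of two mean square errors
(`abs_integral_phiOf_sub_le`), which is `o_P(N^{-1/2})`. At a perturbed law, combined with the
perturbed propensity score and the unperturbed regression, it gives the perturbed `θ_k` exactly.

Identification: ignorability and overlap make the conditional law of `Y(a)` given `X` equal to that
of `Y` given `A = a` and `X` (`map_cov_potential`), so the causal and the observed-data functionals
agree.

Efficiency: if the likelihood ratio is within `δ` of one, `θ_k` differs from a ratio of two
integrals with fixed integrands by `O(δ^2)` (`exists_abs_theta_sub_integral_phiOf_le`). Its
derivative along a submodel is therefore that of the ratio, and the chain rule identifies `inflObs`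
as the gradient (`IsRegularLaw.hasDerivAt_tauObs`). Cauchy–Schwarz bounds each Cramér–Rao bound by
the variance of the gradient, and truncations of the gradient, being bounded scores, approach it
(`isEfficiencyBound_of_gradient`).

Asymptotic normality: the folds depend only on the types and on external randomness. Replacing a
held-out cluster by a fresh one of the same type therefore changes neither the folds nor the fit,
and it preserves the joint law (`map_resample`). This exchange plays the role of conditioning on the
training data. Score differences centred at their mean given the fit are uncorrelated across
held-out clusters, so `N^{-1/2}` times their sum has second moment at most the expected mean square
error of the fitted score, which vanishes; the centring itself is the negligible bias. Thus the
fitted scores may be replaced by the true ones (`IsCrossFit.isLittleOP_sum_phiDiff`). An exact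
delta-method expansion in the estimated type probabilities (`sqrt_mul_tauTilde_sub_eq`) reduces the
estimator to the sample mean of `inflObs`, and the central limit theorem and Slutsky's lemma
conclude. The variance estimator is consistent because the estimated influence values are close to
the true ones in empirical mean square. -/

lemma measurableSet_sigma {s : Set (Σ k, D k)} :
    MeasurableSet s ↔ ∀ k, MeasurableSet (Sigma.mk k ⁻¹' s) :=
  MeasurableSpace.measurableSet_iInf

lemma measurable_sigmaMk (k : Fin K) : Measurable (Sigma.mk k : D k → Σ k, D k) :=
  fun _ hs => measurableSet_sigma.1 hs k

lemma measurable_sigma {β : Type*} [MeasurableSpace β] {f : (Σ k, D k) → β}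
    (hf : ∀ k, Measurable fun d : D k => f ⟨k, d⟩) : Measurable f :=
  fun _ hs => measurableSet_sigma.2 fun k => hf k hs

lemma measurableEmbedding_sigmaMk (k : Fin K) :
    MeasurableEmbedding (Sigma.mk k : D k → Σ k, D k) where
  injective := sigma_mk_injective
  measurable := measurable_sigmaMk k
  measurableSet_image' := by
    intro s hs
    refine measurableSet_sigma.2 fun l => ?_
    by_cases h : l = k
    · subst h
      rwa [Set.preimage_image_eq _ sigma_mk_injective]
    · rw [Set.preimage_image_sigmaMk_of_ne h]
      exact MeasurableSet.empty

lemma measurable_sigmaFst : Measurable (Sigma.fst : (Σ k, D k) → Fin K) :=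
  measurable_sigma fun _ => measurable_const

/-- Products need not commute with the final σ-algebra of a disjoint union in general. Here they do,
because there are finitely many types and each `T × D k` embeds measurably. -/
lemma measurable_prod_sigma {T β : Type*} [MeasurableSpace T] [MeasurableSpace β]
    {f : T × (Σ k, D k) → β}
    (hf : ∀ k, Measurable fun q : T × D k => f (q.1, ⟨k, q.2⟩)) : Measurable f := by
  intro s hs
  have : f ⁻¹' s = ⋃ k, (Prod.map id (Sigma.mk k)) ''
      ((fun q : T × D k => f (q.1, ⟨k, q.2⟩)) ⁻¹' s) := by
    ext ⟨t, k, d⟩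
    simp only [Set.mem_preimage, Set.mem_iUnion, Set.mem_image, Prod.exists, Prod.map_apply, id,
      Prod.mk.injEq]
    constructor
    · intro h
      exact ⟨k, t, d, h, rfl, rfl⟩
    · rintro ⟨k', t', d', h, rfl, h2⟩
      rwa [← h2]
  rw [this]
  exact MeasurableSet.iUnion fun k =>
    (MeasurableEmbedding.id.prodMap (measurableEmbedding_sigmaMk k)).measurableSet_image.2
      (hf k hs)

lemma typeProb_nonneg (Q : Measure (Σ k, D k)) (k : Fin K) : 0 ≤ typeProb Q k := measureReal_nonneg

variable (Q : Measure (Σ k, D k)) [IsFiniteMeasure Q]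

/-- The product form needs no positivity: if type `k` has probability zero, both sides are the zero
measure. -/
lemma smul_typeLaw (k : Fin K) :
    ENNReal.ofReal (typeProb Q k) • typeLaw Q k = Q.comap (Sigma.mk k) := by
  unfold typeLaw typeProb
  rw [ofReal_measureReal]
  set q := Q (Sigma.fst ⁻¹' {k}) with hq
  have hqt : q ≠ ∞ := measure_ne_top _ _
  by_cases h0 : q = 0
  · simp only [h0, zero_smul]
    symm
    rw [← Measure.measure_univ_eq_zero, (measurableEmbedding_sigmaMk k).comap_apply]
    refine measure_mono_null ?_ (hq ▸ h0)
    rintro _ ⟨d, -, rfl⟩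
    rfl
  · have : (q.toNNReal : ℝ≥0∞) = q := ENNReal.coe_toNNReal hqt
    ext s -
    simp only [Measure.smul_apply, smul_eq_mul, Measure.nnreal_smul_coe_apply]
    rw [← mul_assoc, ENNReal.coe_inv (by simpa [ENNReal.toNNReal_eq_zero_iff, hqt] using h0), this,
      ENNReal.mul_inv_cancel h0 hqt, one_mul]

lemma isProbabilityMeasure_typeLaw {k : Fin K} (hk : 0 < typeProb Q k) :
    IsProbabilityMeasure (typeLaw Q k) := by
  constructor
  have h := congrArg (fun m : Measure (D k) => m Set.univ) (smul_typeLaw Q k)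
  simp only [Measure.smul_apply, smul_eq_mul, (measurableEmbedding_sigmaMk k).comap_apply] at h
  have h2 : Q (Sigma.mk k '' Set.univ) = ENNReal.ofReal (typeProb Q k) := by
    rw [typeProb, ofReal_measureReal]
    congr 1
    ext ⟨l, d⟩
    simp only [Set.image_univ, Set.mem_range, Set.mem_preimage, Set.mem_singleton_iff]
    constructor
    · rintro ⟨y, hy⟩
      exact (congrArg Sigma.fst hy).symm
    · rintro rfl
      exact ⟨d, rfl⟩
  rw [h2] at h
  have hne : ENNReal.ofReal (typeProb Q k) ≠ 0 := by simpa using hk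
  calc typeLaw Q k Set.univ = (ENNReal.ofReal (typeProb Q k))⁻¹ *
        (ENNReal.ofReal (typeProb Q k) * typeLaw Q k Set.univ) := by
        rw [← mul_assoc, ENNReal.inv_mul_cancel hne ENNReal.ofReal_ne_top, one_mul]
    _ = 1 := by rw [h, ENNReal.inv_mul_cancel hne ENNReal.ofReal_ne_top]

/-- The law of total probability over the type. It is the source of the integral formulas on the
disjoint union; types of probability zero drop out through their weight. -/
lemma sum_smul_map_typeLaw :
    ∑ k, ENNReal.ofReal (typeProb Q k) • (typeLaw Q k).map (Sigma.mk k) = Q := by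
  ext s hs
  simp only [← Measure.map_smul, smul_typeLaw, Measure.coe_finsetSum, Finset.sum_apply]
  have : s = ⋃ k, Sigma.mk k '' (Sigma.mk k ⁻¹' s) := by
    ext ⟨k, d⟩
    simp only [Set.mem_iUnion, Set.mem_image, Set.mem_preimage]
    constructor
    · intro h
      exact ⟨k, d, h, rfl⟩
    · rintro ⟨_, _, h, h2⟩
      rwa [← h2]
  conv_rhs => rw [this]
  rw [measure_iUnion, tsum_fintype]
  · refine Finset.sum_congr rfl fun k _ => ?_
    rw [Measure.map_apply (measurable_sigmaMk k) hs, (measurableEmbedding_sigmaMk k).comap_apply]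
  · intro k l hkl
    rw [Function.onFun, Set.disjoint_left]
    rintro _ ⟨d, -, rfl⟩ ⟨d', -, h⟩
    exact hkl (congrArg Sigma.fst h).symm
  · exact fun k => (measurableEmbedding_sigmaMk k).measurableSet_image.2 (measurable_sigmaMk k hs)

lemma lintegral_sigma {f : (Σ k, D k) → ℝ≥0∞} (hf : Measurable f) :
    ∫⁻ z, f z ∂Q = ∑ k, ENNReal.ofReal (typeProb Q k) * ∫⁻ d, f ⟨k, d⟩ ∂typeLaw Q k := by
  conv_lhs => rw [← sum_smul_map_typeLaw Q]
  rw [lintegral_finsetSum_measure]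
  refine Finset.sum_congr rfl fun k _ => ?_
  rw [lintegral_smul_measure, lintegral_map hf (measurable_sigmaMk k), smul_eq_mul]

lemma integrable_sigma_iff {E : Type*} [NormedAddCommGroup E] {f : (Σ k, D k) → E} :
    Integrable f Q ↔
      ∀ k, 0 < typeProb Q k → Integrable (fun d => f ⟨k, d⟩) (typeLaw Q k) := by
  conv_lhs => rw [← sum_smul_map_typeLaw Q]
  rw [integrable_finsetSum_measure]
  simp only [Finset.mem_univ, true_imp_iff]
  refine forall_congr' fun k => ?_
  rcases (typeProb_nonneg Q k).eq_or_lt with h | h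
  · simp [← h]
  · rw [integrable_smul_measure (by simpa using h) ENNReal.ofReal_ne_top,
      (measurableEmbedding_sigmaMk k).integrable_map_iff]
    simp [h, Function.comp_def]

lemma integral_sigma {E : Type*} [NormedAddCommGroup E] [NormedSpace ℝ E]
    {f : (Σ k, D k) → E} (hf : Integrable f Q) :
    ∫ z, f z ∂Q = ∑ k, typeProb Q k • ∫ d, f ⟨k, d⟩ ∂typeLaw Q k := by
  have h := hf
  rw [← sum_smul_map_typeLaw Q, integrable_finsetSum_measure] at h
  conv_lhs => rw [← sum_smul_map_typeLaw Q]
  rw [integral_finsetSum_measure h]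
  refine Finset.sum_congr rfl fun k _ => ?_
  rw [integral_smul_measure, (measurableEmbedding_sigmaMk k).integral_map,
    ENNReal.toReal_ofReal (typeProb_nonneg Q k)]

end SigmaLaw

/-! ### Nuisance functions for a single cluster type -/

section SingleType

variable {m : ℕ} {S : Type*} [MeasurableSpace S]

/-- The propensity score of a law of `(Y, A, X)`. -/
def propOf (ρ : Measure (ObsData m S)) [IsFiniteMeasure ρ] (a : Trt m) (x : S) : ℝ :=
  (condDistrib (fun o : ObsData m S => o.2.1) (fun o => o.2.2) ρ x).real {a}

/-- The conditional law of `Y` given `(A, X)`. -/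
def outLawOf (ρ : Measure (ObsData m S)) [IsFiniteMeasure ρ] (a : Trt m) (x : S) :
    Measure (Outc m) :=
  condDistrib (fun o : ObsData m S => o.1) (fun o => o.2) ρ (a, x)

/-- The outcome regression of a law of `(Y, A, X)`. -/
def regOf (ρ : Measure (ObsData m S)) [IsFiniteMeasure ρ] (a : Trt m) (x : S) : Outc m :=
  ∫ y, y ∂(outLawOf ρ a x)

/-- The law of the covariates. -/
def covLawOf (ρ : Measure (ObsData m S)) : Measure S := ρ.map fun o => o.2.2

/-- The augmented inverse probability weighted score of a single cluster type. -/
def phiOf (w : Trt m → S → Outc m) (e : Trt m → S → ℝ) (g : Trt m → S → Outc m)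
    (o : ObsData m S) : ℝ :=
  inner ℝ (w o.2.1 o.2.2) (o.1 - g o.2.1 o.2.2) / e o.2.1 o.2.2
    + ∑ b : Trt m, inner ℝ (w b o.2.2) (g b o.2.2)

lemma measurable_uncurry_trt {β : Type*} [MeasurableSpace β] {f : Trt m → S → β}
    (hf : ∀ a, Measurable (f a)) : Measurable fun q : Trt m × S => f q.1 q.2 :=
  measurable_from_prod_countable_right hf

lemma measurable_cov : Measurable fun o : ObsData m S => o.2.2 :=
  measurable_snd.comp measurable_snd

lemma measurable_comp_trt {β : Type*} [MeasurableSpace β] {f : Trt m → S → β}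
    (hf : ∀ a, Measurable (f a)) : Measurable fun o : ObsData m S => f o.2.1 o.2.2 :=
  (measurable_uncurry_trt hf).comp measurable_snd

lemma ae_trt {ρ : Measure (ObsData m S)} {p : Trt m → S → Prop}
    (h : ∀ a, ∀ᵐ x ∂covLawOf ρ, p a x) : ∀ᵐ o ∂ρ, ∀ a, p a o.2.2 :=
  ae_all_iff.2 fun a => ae_of_ae_map measurable_cov.aemeasurable (h a)

variable (ρ : Measure (ObsData m S)) [IsProbabilityMeasure ρ]

instance : IsProbabilityMeasure (covLawOf ρ) :=
  Measure.isProbabilityMeasure_map measurable_cov.aemeasurable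

instance (a : Trt m) (x : S) : IsProbabilityMeasure (outLawOf ρ a x) := by
  unfold outLawOf; infer_instance

lemma measurable_propOf (a : Trt m) : Measurable (propOf ρ a) :=
  (Kernel.measurable_coe _ (measurableSet_singleton a)).ennreal_toReal

lemma propOf_nonneg (a : Trt m) (x : S) : 0 ≤ propOf ρ a x := measureReal_nonneg

lemma propOf_le_one (a : Trt m) (x : S) : propOf ρ a x ≤ 1 := measureReal_le_one

lemma measurable_regOf (a : Trt m) : Measurable (regOf ρ a) := by
  have h : StronglyMeasurable fun q : Trt m × S =>
      ∫ y, y ∂(condDistrib (fun o : ObsData m S => o.1) (fun o => o.2) ρ q) :=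
    StronglyMeasurable.integral_kernel_prod_right (f := fun _ y => y)
      (by exact measurable_snd.stronglyMeasurable)
  exact h.measurable.comp measurable_prodMk_left

variable {ρ}

/-- Integrating out the treatment given the covariates. -/
lemma integral_trt {h : Trt m → S → ℝ} (hm : ∀ a, Measurable (h a))
    (hi : Integrable (fun o : ObsData m S => h o.2.1 o.2.2) ρ) :
    ∫ o, h o.2.1 o.2.2 ∂ρ = ∫ x, ∑ a, propOf ρ a x * h a x ∂covLawOf ρ := by
  have hX : AEMeasurable (fun o : ObsData m S => o.2.2) ρ := measurable_cov.aemeasurable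
  have hA : AEMeasurable (fun o : ObsData m S => o.2.1) ρ :=
    (measurable_fst.comp measurable_snd).aemeasurable
  have hmeas : Measurable fun q : S × Trt m => h q.2 q.1 :=
    (measurable_uncurry_trt hm).comp measurable_swap
  have key := compProd_map_condDistrib (mβ := inferInstance) (μ := ρ)
    (X := fun o : ObsData m S => o.2.2) hA
  have h1 : ∫ o, h o.2.1 o.2.2 ∂ρ =
      ∫ q, h q.2 q.1 ∂(ρ.map fun o : ObsData m S => (o.2.2, o.2.1)) :=
    (integral_map (hX.prodMk hA) hmeas.aestronglyMeasurable).symm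
  have h2 : Integrable (fun q : S × Trt m => h q.2 q.1)
      (ρ.map fun o : ObsData m S => (o.2.2, o.2.1)) :=
    (integrable_map_measure hmeas.aestronglyMeasurable (hX.prodMk hA)).2 hi
  rw [h1]
  rw [← key] at h2 ⊢
  rw [Measure.integral_compProd h2]
  refine integral_congr_ae (ae_of_all _ fun x => ?_)
  simp [integral_fintype, propOf]

/-- Integrating out the outcome given treatment and covariates. -/
lemma integral_inner_outcome {h : Trt m → S → Outc m} (hm : ∀ a, Measurable (h a))
    (hY : Integrable (fun o : ObsData m S => o.1) ρ) {C : ℝ}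
    (hb : ∀ᵐ o ∂ρ, ‖h o.2.1 o.2.2‖ ≤ C) :
    Integrable (fun o : ObsData m S => inner ℝ (h o.2.1 o.2.2) o.1) ρ ∧
    Integrable (fun o : ObsData m S => regOf ρ o.2.1 o.2.2) ρ ∧
    Integrable (fun o : ObsData m S => inner ℝ (h o.2.1 o.2.2) (regOf ρ o.2.1 o.2.2)) ρ ∧
    ∫ o, inner ℝ (h o.2.1 o.2.2) o.1 ∂ρ =
      ∫ o, inner ℝ (h o.2.1 o.2.2) (regOf ρ o.2.1 o.2.2) ∂ρ := by
  have hi_of : ∀ f : ObsData m S → Outc m, Measurable f → Integrable f ρ →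
      Integrable (fun o : ObsData m S => inner ℝ (h o.2.1 o.2.2) (f o)) ρ := by
    intro f hf hfi
    refine (hfi.norm.const_mul C).mono'
      ((measurable_comp_trt hm).inner hf).aestronglyMeasurable ?_
    filter_upwards [hb] with o ho
    exact (norm_inner_le_norm _ _).trans (by gcongr)
  have hi := hi_of _ measurable_fst hY
  have hAX : AEMeasurable (fun o : ObsData m S => o.2) ρ := measurable_snd.aemeasurable
  have hYm : AEMeasurable (fun o : ObsData m S => o.1) ρ := measurable_fst.aemeasurable
  have key := compProd_map_condDistrib (mβ := inferInstance) (μ := ρ)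
    (X := fun o : ObsData m S => o.2) hYm
  have hYi : Integrable (fun q : (Trt m × S) × Outc m => q.2)
      (ρ.map fun o : ObsData m S => (o.2, o.1)) :=
    (integrable_map_measure measurable_snd.aestronglyMeasurable (hAX.prodMk hYm)).2 hY
  have hYi' := hYi
  rw [← key] at hYi'
  -- The regression is a conditional mean of the integrable outcome, hence integrable itself; no
  -- bound on it is needed.
  have hreg : Integrable (fun o : ObsData m S => regOf ρ o.2.1 o.2.2) ρ := by
    have h : Integrable (fun q : Trt m × S => regOf ρ q.1 q.2)
        (ρ.map fun o : ObsData m S => o.2) := hYi'.integral_compProd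
    exact (integrable_map_measure
      (measurable_uncurry_trt (measurable_regOf ρ)).aestronglyMeasurable hAX).1 h
  refine ⟨hi, hreg, hi_of _ (measurable_comp_trt (measurable_regOf ρ)) hreg, ?_⟩
  have hmeas : Measurable fun q : (Trt m × S) × Outc m => (inner ℝ (h q.1.1 q.1.2) q.2 : ℝ) :=
    ((measurable_uncurry_trt hm).comp measurable_fst).inner measurable_snd
  have h1 : ∫ o, (inner ℝ (h o.2.1 o.2.2) o.1 : ℝ) ∂ρ =
      ∫ q, (inner ℝ (h q.1.1 q.1.2) q.2 : ℝ) ∂(ρ.map fun o : ObsData m S => (o.2, o.1)) :=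
    (integral_map (hAX.prodMk hYm) hmeas.aestronglyMeasurable).symm
  have h2 : Integrable (fun q : (Trt m × S) × Outc m => (inner ℝ (h q.1.1 q.1.2) q.2 : ℝ))
      (ρ.map fun o : ObsData m S => (o.2, o.1)) :=
    (integrable_map_measure hmeas.aestronglyMeasurable (hAX.prodMk hYm)).2 hi
  rw [h1]
  rw [← key] at h2 ⊢
  rw [Measure.integral_compProd h2]
  have h3 : ∫ o, (inner ℝ (h o.2.1 o.2.2) (regOf ρ o.2.1 o.2.2) : ℝ) ∂ρ =
      ∫ q, (inner ℝ (h q.1 q.2) (regOf ρ q.1 q.2) : ℝ) ∂(ρ.map fun o : ObsData m S => o.2) :=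
    (integral_map hAX ((measurable_uncurry_trt hm).inner
      (measurable_uncurry_trt (measurable_regOf ρ))).aestronglyMeasurable).symm
  rw [h3]
  have h4 : ∀ᵐ q ∂(ρ.map fun o : ObsData m S => o.2), Integrable (fun y => y)
      (condDistrib (fun o : ObsData m S => o.1) (fun o => o.2) ρ q) := by
    have := (Measure.integrable_compProd_iff hYi'.1).1 hYi'
    exact this.1
  refine integral_congr_ae ?_
  filter_upwards [h4] with q hq
  exact integral_inner hq _

end SingleType

/-! ### Second moments of the outcome -/

section Moments

/-- The mean square deviation is the trace of the covariance matrix. -/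
lemma lintegral_enorm_sub_mean_sq_le {m : ℕ} (η : Measure (Outc m)) [IsProbabilityMeasure η]
    (h : MemLp (fun y : Outc m => y) 2 η) {C : ℝ}
    (hC : ‖Matrix.toEuclideanCLM (n := Fin m) (𝕜 := ℝ)
      (fun i j => covariance (fun y : Outc m => y i) (fun y => y j) η)‖ ≤ C) :
    ∫⁻ y, ‖y - ∫ y', y' ∂η‖ₑ ^ 2 ∂η ≤ ENNReal.ofReal (m * C) := by
  set A : Matrix (Fin m) (Fin m) ℝ :=
    fun i j => covariance (fun y : Outc m => y i) (fun y => y j) η with hA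
  have hint : Integrable (fun y : Outc m => y) η := h.integrable one_le_two
  have hc : MemLp (fun y : Outc m => y - ∫ y', y' ∂η) 2 η := h.sub (memLp_const _)
  have hcoord : ∀ i, MemLp (fun y : Outc m => (y - ∫ y', y' ∂η) i) 2 η := fun i =>
    (EuclideanSpace.proj i : Outc m →L[ℝ] ℝ).comp_memLp' hc
  have hmean : ∀ i, (∫ y', y' ∂η) i = ∫ y' : Outc m, y' i ∂η := fun i =>
    ((EuclideanSpace.proj i : Outc m →L[ℝ] ℝ).integral_comp_comm hint).symm
  -- A diagonal entry is the quadratic form of the matrix at a unit coordinate vector, so the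
  -- operator norm bounds it. The factor `m` in the conclusion counts the diagonal entries.
  have hdiag : ∀ i, A i i ≤ C := by
    intro i
    have h1 : A i i = inner ℝ (EuclideanSpace.single i (1 : ℝ))
        (Matrix.toEuclideanCLM (n := Fin m) (𝕜 := ℝ) A (EuclideanSpace.single i (1 : ℝ))) := by
      rw [EuclideanSpace.inner_single_left]
      simp [Matrix.ofLp_toEuclideanCLM]
    rw [h1]
    refine (real_inner_le_norm _ _).trans ?_
    have h2 := (Matrix.toEuclideanCLM (n := Fin m) (𝕜 := ℝ) A).le_opNorm
      (EuclideanSpace.single i (1 : ℝ))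
    simp only [PiLp.norm_single, norm_one, mul_one, one_mul] at h2 ⊢
    exact h2.trans hC
  have hsq : ∫ y, ‖y - ∫ y', y' ∂η‖ ^ 2 ∂η = ∑ i, A i i := by
    simp_rw [EuclideanSpace.norm_sq_eq]
    rw [integral_finsetSum _ fun i _ => (hcoord i).integrable_norm_pow two_ne_zero]
    refine Finset.sum_congr rfl fun i _ => ?_
    rw [hA]
    simp only [covariance]
    refine integral_congr_ae (ae_of_all _ fun y => ?_)
    simp only [PiLp.sub_apply, hmean, Real.norm_eq_abs, sq_abs]
    ring
  have h3 : ∫⁻ y, ‖y - ∫ y', y' ∂η‖ₑ ^ 2 ∂η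
      = ENNReal.ofReal (∫ y, ‖y - ∫ y', y' ∂η‖ ^ 2 ∂η) := by
    rw [ofReal_integral_eq_lintegral_ofReal (hc.integrable_norm_pow two_ne_zero)
      (ae_of_all _ fun _ => by positivity)]
    refine lintegral_congr fun y => ?_
    rw [ENNReal.ofReal_pow (norm_nonneg _), ofReal_norm]
  rw [h3, hsq]
  refine ENNReal.ofReal_le_ofReal ?_
  calc ∑ i, A i i ≤ ∑ _i : Fin m, C := Finset.sum_le_sum fun i _ => hdiag i
    _ = m * C := by simp

variable {m : ℕ} {S : Type*} [MeasurableSpace S]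
variable {ρ : Measure (ObsData m S)} [IsProbabilityMeasure ρ]

/-- Given `(A, X)` the weight `f` is constant and the squared residual has conditional mean at most
`V`. The weight is arbitrary because the squared propensity error will take its place: the outcome
is unbounded, so that error cannot be separated from the residual by a supremum bound. -/
lemma lintegral_residual_sq_le {V : ℝ≥0∞}
    (hV : ∀ a, ∀ᵐ x ∂covLawOf ρ, ∫⁻ y, ‖y - regOf ρ a x‖ₑ ^ 2 ∂outLawOf ρ a x ≤ V)
    {f : Trt m → S → ℝ≥0∞} (hf : ∀ a, Measurable (f a)) :
    ∫⁻ o, f o.2.1 o.2.2 * ‖o.1 - regOf ρ o.2.1 o.2.2‖ₑ ^ 2 ∂ρ ≤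
      V * ∫⁻ o, f o.2.1 o.2.2 ∂ρ := by
  have hAX : AEMeasurable (fun o : ObsData m S => o.2) ρ := measurable_snd.aemeasurable
  have hYm : AEMeasurable (fun o : ObsData m S => o.1) ρ := measurable_fst.aemeasurable
  have key := compProd_map_condDistrib (mβ := inferInstance) (μ := ρ)
    (X := fun o : ObsData m S => o.2) hYm
  have hfm := measurable_uncurry_trt hf
  have hrm := measurable_uncurry_trt (measurable_regOf ρ)
  have hm2 : Measurable fun q : (Trt m × S) × Outc m =>
      f q.1.1 q.1.2 * ‖q.2 - regOf ρ q.1.1 q.1.2‖ₑ ^ 2 :=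
    (hfm.comp measurable_fst).mul
      ((measurable_snd.sub (hrm.comp measurable_fst)).enorm.pow_const 2)
  have h1 : ∫⁻ o, f o.2.1 o.2.2 * ‖o.1 - regOf ρ o.2.1 o.2.2‖ₑ ^ 2 ∂ρ =
      ∫⁻ q, f q.1.1 q.1.2 * ‖q.2 - regOf ρ q.1.1 q.1.2‖ₑ ^ 2
        ∂(ρ.map fun o : ObsData m S => (o.2, o.1)) :=
    (lintegral_map' hm2.aemeasurable (hAX.prodMk hYm)).symm
  have h2 : ∫⁻ o, f o.2.1 o.2.2 ∂ρ =
      ∫⁻ q, f q.1 q.2 ∂(ρ.map fun o : ObsData m S => o.2) :=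
    (lintegral_map' hfm.aemeasurable hAX).symm
  rw [h1, h2, ← key, Measure.lintegral_compProd hm2, ← lintegral_const_mul _ hfm]
  have hV' : ∀ᵐ q ∂(ρ.map fun o : ObsData m S => o.2),
      ∫⁻ y, ‖y - regOf ρ q.1 q.2‖ₑ ^ 2 ∂outLawOf ρ q.1 q.2 ≤ V := by
    have hms : MeasurableSet {q : Trt m × S |
        ∫⁻ y, ‖y - regOf ρ q.1 q.2‖ₑ ^ 2 ∂outLawOf ρ q.1 q.2 ≤ V} := by
      have : Measurable fun q : Trt m × S =>
          ∫⁻ y, ‖y - regOf ρ q.1 q.2‖ₑ ^ 2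
            ∂(condDistrib (fun o : ObsData m S => o.1) (fun o => o.2) ρ q) :=
        Measurable.lintegral_kernel_prod_right
          (f := fun (q : Trt m × S) y => ‖y - regOf ρ q.1 q.2‖ₑ ^ 2)
          ((measurable_snd.sub (hrm.comp measurable_fst)).enorm.pow_const 2)
      exact measurableSet_le this measurable_const
    rw [ae_map_iff hAX hms]
    filter_upwards [ae_trt hV] with o ho using ho _
  refine lintegral_mono_ae ?_
  filter_upwards [hV'] with q hq
  rw [lintegral_const_mul _ (by fun_prop), mul_comm]
  exact mul_le_mul_left hq _

lemma memLp_residual {V : ℝ≥0∞} (hVt : V ≠ ∞)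
    (hV : ∀ a, ∀ᵐ x ∂covLawOf ρ, ∫⁻ y, ‖y - regOf ρ a x‖ₑ ^ 2 ∂outLawOf ρ a x ≤ V) :
    MemLp (fun o : ObsData m S => o.1 - regOf ρ o.2.1 o.2.2) 2 ρ := by
  refine ⟨(measurable_fst.sub (measurable_comp_trt (measurable_regOf ρ))).aestronglyMeasurable, ?_⟩
  rw [eLpNorm_lt_top_iff_lintegral_rpow_enorm_lt_top two_ne_zero ENNReal.ofNat_ne_top]
  have := lintegral_residual_sq_le hV (f := fun _ _ => 1) fun _ => measurable_const
  simp only [one_mul, lintegral_const, measure_univ, mul_one] at this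
  simpa using this.trans_lt hVt.lt_top

lemma memLp_outcome {V : ℝ≥0∞} (hVt : V ≠ ∞)
    (hV : ∀ a, ∀ᵐ x ∂covLawOf ρ, ∫⁻ y, ‖y - regOf ρ a x‖ₑ ^ 2 ∂outLawOf ρ a x ≤ V)
    {C : ℝ} (hg : ∀ a, ∀ᵐ x ∂covLawOf ρ, ‖regOf ρ a x‖ ≤ C) :
    MemLp (fun o : ObsData m S => o.1) 2 ρ := by
  have h : MemLp (fun o : ObsData m S => regOf ρ o.2.1 o.2.2) 2 ρ := by
    refine MemLp.of_bound (measurable_comp_trt (measurable_regOf ρ)).aestronglyMeasurable C ?_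
    filter_upwards [ae_trt hg] with o ho using ho _
  refine ((memLp_residual hVt hV).add h).congr_norm measurable_fst.aestronglyMeasurable ?_
  exact ae_of_all _ fun o => by simp

end Moments

/-! ### The augmented inverse probability weighted score of one type -/

section Score

variable {m : ℕ} {S : Type*} [MeasurableSpace S]

/-- Measurable nuisance functions, bounded and bounded away from zero, respectively, almost
everywhere with respect to a law of the covariates. -/
structure IsNuisance (π : Measure S) (e : Trt m → S → ℝ) (g : Trt m → S → Outc m)
    (c C : ℝ) : Prop where
  meas_e : ∀ a, Measurable (e a)
  meas_g : ∀ a, Measurable (g a)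
  le_e : ∀ a, ∀ᵐ x ∂π, c ≤ e a x
  norm_e_le : ∀ a, ∀ᵐ x ∂π, ‖e a x‖ ≤ 1
  norm_g_le : ∀ a, ∀ᵐ x ∂π, ‖g a x‖ ≤ C

/-- Bounded measurable weights. -/
structure IsWeight (w : Trt m → S → Outc m) (C : ℝ) : Prop where
  meas : ∀ a, Measurable (w a)
  norm_le : ∀ a x, ‖w a x‖ ≤ C

lemma IsWeight.nonneg_bound {w : Trt m → S → Outc m} {C : ℝ} (hw : IsWeight w C) (x : S) :
    0 ≤ C := (norm_nonneg _).trans (hw.norm_le (fun _ => false) x)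

variable {w : Trt m → S → Outc m} {e : Trt m → S → ℝ} {g : Trt m → S → Outc m} {c C Cw : ℝ}

/-- The parameter will be the external randomness together with the sample on which the nuisance
functions are fitted, so measurability must be joint in fit and cluster. -/
lemma measurable_phiOf_param {T : Type*} [MeasurableSpace T] (hw : ∀ a, Measurable (w a))
    {e : T → Trt m → S → ℝ} {g : T → Trt m → S → Outc m}
    (he : ∀ a, Measurable fun q : T × S => e q.1 a q.2)
    (hg : ∀ a, Measurable fun q : T × S => g q.1 a q.2) :
    Measurable fun q : T × ObsData m S => phiOf w (e q.1) (g q.1) q.2 := by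
  have key : ∀ {β : Type} [MeasurableSpace β] {f : T → Trt m → S → β},
      (∀ a, Measurable fun q : T × S => f q.1 a q.2) →
      Measurable fun q : T × ObsData m S => f q.1 q.2.2.1 q.2.2.2 := by
    intro β _ f hf
    have h : Measurable fun q : Trt m × (T × S) => f q.2.1 q.1 q.2.2 :=
      measurable_from_prod_countable_right hf
    exact h.comp (by fun_prop : Measurable fun q : T × ObsData m S => (q.2.2.1, (q.1, q.2.2.2)))
  have key2 : ∀ {β : Type} [MeasurableSpace β] {f : T → Trt m → S → β},
      (∀ a, Measurable fun q : T × S => f q.1 a q.2) → ∀ a,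
      Measurable fun q : T × ObsData m S => f q.1 a q.2.2.2 := by
    intro β _ f hf a
    exact (hf a).comp (by fun_prop : Measurable fun q : T × ObsData m S => (q.1, q.2.2.2))
  have hw' : ∀ a, Measurable fun q : T × S => w a q.2 := fun a => (hw a).comp measurable_snd
  unfold phiOf
  refine Measurable.add (Measurable.div (Measurable.inner (key (f := fun _ => w) hw') ?_) (key he))
    (Finset.measurable_fun_sum _ fun a _ =>
      Measurable.inner (key2 (f := fun _ => w) hw' a) (key2 hg a))
  exact (measurable_fst.comp measurable_snd).sub (key hg)

lemma measurable_phiOf (hw : ∀ a, Measurable (w a)) (he : ∀ a, Measurable (e a))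
    (hg : ∀ a, Measurable (g a)) : Measurable (phiOf w e g) := by
  unfold phiOf
  refine Measurable.add (Measurable.div (Measurable.inner (measurable_comp_trt hw) ?_)
    (measurable_comp_trt he)) (Finset.measurable_fun_sum _ fun a _ =>
      Measurable.inner ((hw a).comp measurable_cov) ((hg a).comp measurable_cov))
  exact measurable_fst.sub (measurable_comp_trt hg)

variable {ρ : Measure (ObsData m S)} [IsProbabilityMeasure ρ]

/-- The score is dominated by an affine function of `‖Y‖`. The exponent is left free: two is needed
for variances, one suffices under perturbed laws. -/
lemma memLp_phiOf {p : ℝ≥0∞} (hY : MemLp (fun o : ObsData m S => o.1) p ρ) (hw : IsWeight w Cw)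
    (hc : 0 < c) (hn : IsNuisance (covLawOf ρ) e g c C) : MemLp (phiOf w e g) p ρ := by
  have hb : MemLp (fun o : ObsData m S =>
      Cw / c * (‖o.1‖ + C) + ∑ _b : Trt m, Cw * C) p ρ :=
    ((hY.norm.add (memLp_const C)).const_mul (Cw / c)).add (memLp_const _)
  refine hb.mono' (measurable_phiOf hw.meas hn.meas_e hn.meas_g).aestronglyMeasurable ?_
  filter_upwards [ae_trt hn.le_e, ae_trt hn.norm_g_le] with o h1 h2
  have hCw := hw.nonneg_bound o.2.2
  refine (norm_add_le _ _).trans (add_le_add ?_ ?_)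
  · rw [norm_div, div_mul_eq_mul_div]
    refine div_le_div₀ (by have := (norm_nonneg _).trans (h2 o.2.1); positivity) ?_ hc
      ((h1 o.2.1).trans (le_abs_self _))
    refine (norm_inner_le_norm _ _).trans ?_
    gcongr
    · exact hw.norm_le _ _
    · exact (norm_sub_le _ _).trans (add_le_add le_rfl (h2 _))
  · refine (norm_sum_le _ _).trans (Finset.sum_le_sum fun b _ => ?_)
    refine (norm_inner_le_norm _ _).trans ?_
    gcongr
    · exact hw.norm_le _ _
    · exact h2 b

/-- The double robustness identity. -/
lemma integral_phiOf (hY : Integrable (fun o : ObsData m S => o.1) ρ) (hw : IsWeight w Cw)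
    (hc : 0 < c) (hn : IsNuisance (covLawOf ρ) e g c C) {c' : ℝ} (hc' : 0 < c')
    (hover : ∀ a, ∀ᵐ x ∂covLawOf ρ, c' ≤ propOf ρ a x) :
    (∀ a, Integrable (regOf ρ a) (covLawOf ρ)) ∧
    ∫ o, phiOf w e g o ∂ρ = ∑ a, ∫ x, inner ℝ (w a x) (regOf ρ a x) ∂covLawOf ρ +
      ∑ a, ∫ x, inner ℝ (w a x) (g a x - regOf ρ a x) * (1 - propOf ρ a x / e a x)
        ∂covLawOf ρ := by
  have hme : ∀ a, Measurable fun x => propOf ρ a x / e a x := fun a =>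
    (measurable_propOf ρ a).div (hn.meas_e a)
  have hratio : ∀ a, ∀ᵐ x ∂covLawOf ρ, ‖propOf ρ a x / e a x‖ ≤ 1 / c := by
    intro a
    filter_upwards [hn.le_e a] with x hx
    rw [norm_div, Real.norm_of_nonneg (propOf_nonneg ρ a x)]
    exact div_le_div₀ zero_le_one (propOf_le_one ρ a x) hc (hx.trans (le_abs_self _))
  have hregAX := (integral_inner_outcome (h := fun _ _ => 0) (fun _ => measurable_const) hY
    (C := 0) (by simp)).2.1
  -- integrability of the regression with respect to the covariate law
  have hreg : ∀ a, Integrable (regOf ρ a) (covLawOf ρ) := by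
    intro a
    have h1 : Integrable (fun o : ObsData m S =>
        ({a} : Set (Trt m)).indicator (fun b => ‖regOf ρ b o.2.2‖) o.2.1) ρ := by
      refine hregAX.norm.mono' ?_ (ae_of_all _ fun o => ?_)
      · exact (measurable_comp_trt (f := fun b x => ({a} : Set (Trt m)).indicator
          (fun b => ‖regOf ρ b x‖) b) fun b => by
            by_cases hb : b = a
            · simpa [Set.indicator, hb] using (measurable_regOf ρ a).norm
            · simp [Set.indicator, hb]).aestronglyMeasurable
      · by_cases hb : o.2.1 = a <;> simp [Set.indicator, hb]
    -- Integrating out the treatment turns the indicator of `a` into the factor `propOf ρ a x`.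
    -- Overlap then allows dividing by this factor.
    have h2 : Integrable (fun x => propOf ρ a x * ‖regOf ρ a x‖) (covLawOf ρ) := by
      have hX : AEMeasurable (fun o : ObsData m S => o.2.2) ρ := measurable_cov.aemeasurable
      have hA : AEMeasurable (fun o : ObsData m S => o.2.1) ρ :=
        (measurable_fst.comp measurable_snd).aemeasurable
      have hmeas : Measurable fun q : S × Trt m =>
          ({a} : Set (Trt m)).indicator (fun b => ‖regOf ρ b q.1‖) q.2 :=
        (measurable_uncurry_trt (f := fun b x => ({a} : Set (Trt m)).indicator
          (fun b => ‖regOf ρ b x‖) b) fun b => by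
            by_cases hb : b = a
            · simpa [Set.indicator, hb] using (measurable_regOf ρ a).norm
            · simp [Set.indicator, hb]).comp measurable_swap
      have h3 : Integrable (fun q : S × Trt m =>
          ({a} : Set (Trt m)).indicator (fun b => ‖regOf ρ b q.1‖) q.2)
          (ρ.map fun o : ObsData m S => (o.2.2, o.2.1)) :=
        (integrable_map_measure hmeas.aestronglyMeasurable (hX.prodMk hA)).2 h1
      rw [← compProd_map_condDistrib (mβ := inferInstance) (μ := ρ)
        (X := fun o : ObsData m S => o.2.2) hA] at h3
      refine h3.integral_compProd.congr (ae_of_all _ fun x => ?_)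
      simp [integral_fintype, propOf, Set.indicator, mul_comm]
    refine (h2.const_mul (1 / c')).mono' (measurable_regOf ρ a).aestronglyMeasurable ?_
    filter_upwards [hover a] with x hx
    rw [← mul_assoc, one_div, inv_mul_eq_div]
    exact le_mul_of_one_le_left (norm_nonneg _) ((one_le_div hc').2 hx)
  have hwg : ∀ a, Integrable (fun x => (inner ℝ (w a x) (g a x) : ℝ)) (covLawOf ρ) := by
    intro a
    refine Integrable.of_bound ((hw.meas a).inner (hn.meas_g a)).aestronglyMeasurable (Cw * C) ?_
    filter_upwards [hn.norm_g_le a] with x hx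
    have hCw := hw.nonneg_bound x
    refine (norm_inner_le_norm _ _).trans ?_
    gcongr
    exact hw.norm_le _ _
  have hwr : ∀ a, Integrable (fun x => (inner ℝ (w a x) (regOf ρ a x) : ℝ)) (covLawOf ρ) := by
    intro a
    refine ((hreg a).norm.const_mul Cw).mono'
      ((hw.meas a).inner (measurable_regOf ρ a)).aestronglyMeasurable (ae_of_all _ fun x => ?_)
    refine (norm_inner_le_norm _ _).trans ?_
    gcongr
    exact hw.norm_le _ _
  have hwd : ∀ a, Integrable (fun x => (inner ℝ (w a x) (g a x - regOf ρ a x) : ℝ))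
      (covLawOf ρ) := fun a => ((hwg a).sub (hwr a)).congr
        (ae_of_all _ fun x => by simp [inner_sub_right])
  have hwdr : ∀ a, Integrable (fun x => (inner ℝ (w a x) (g a x - regOf ρ a x) : ℝ) *
      (propOf ρ a x / e a x)) (covLawOf ρ) := fun a =>
    (hwd a).mul_bdd (hme a).aestronglyMeasurable (hratio a)
  refine ⟨hreg, ?_⟩
  -- the weighted residual
  set h : Trt m → S → Outc m := fun a x => (e a x)⁻¹ • w a x with hh
  have hm : ∀ a, Measurable (h a) := fun a => (hn.meas_e a).inv.smul (hw.meas a)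
  have hb : ∀ᵐ o ∂ρ, ‖h o.2.1 o.2.2‖ ≤ c⁻¹ * Cw := by
    filter_upwards [ae_trt hn.le_e] with o ho
    rw [hh, norm_smul, norm_inv]
    gcongr
    · exact (ho _).trans (le_abs_self _)
    · exact hw.norm_le _ _
  obtain ⟨hi1, -, hi2, heq⟩ := integral_inner_outcome hm hY hb
  have hgAX : Integrable (fun o : ObsData m S => (inner ℝ (h o.2.1 o.2.2) (g o.2.1 o.2.2) : ℝ))
      ρ := by
    refine Integrable.of_bound ((measurable_comp_trt hm).inner
      (measurable_comp_trt hn.meas_g)).aestronglyMeasurable (c⁻¹ * Cw * C) ?_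
    filter_upwards [hb, ae_trt hn.norm_g_le] with o h1 h2
    refine (norm_inner_le_norm _ _).trans ?_
    gcongr
    · exact (norm_nonneg _).trans h1
    · exact h2 _
  have hsum : ∫ o : ObsData m S, ∑ b, (inner ℝ (w b o.2.2) (g b o.2.2) : ℝ) ∂ρ =
      ∑ b, ∫ x, inner ℝ (w b x) (g b x) ∂covLawOf ρ := by
    rw [← integral_finsetSum _ fun b _ => hwg b, covLawOf, integral_map
      measurable_cov.aemeasurable]
    exact (Finset.measurable_fun_sum _ fun b _ =>
      (hw.meas b).inner (hn.meas_g b)).aestronglyMeasurable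
  have hsumi : Integrable (fun o : ObsData m S => ∑ b, (inner ℝ (w b o.2.2) (g b o.2.2) : ℝ)) ρ :=
    integrable_finsetSum _ fun b _ => (integrable_map_measure
      ((hw.meas b).inner (hn.meas_g b)).aestronglyMeasurable measurable_cov.aemeasurable).1 (hwg b)
  have hphi : ∀ o : ObsData m S, phiOf w e g o = inner ℝ (h o.2.1 o.2.2) o.1 -
      inner ℝ (h o.2.1 o.2.2) (g o.2.1 o.2.2) + ∑ b, inner ℝ (w b o.2.2) (g b o.2.2) := by
    intro o
    simp only [phiOf, hh, real_inner_smul_left, inner_sub_right]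
    ring
  have hsub : Integrable (fun o : ObsData m S => (inner ℝ (h o.2.1 o.2.2) o.1 : ℝ) -
      inner ℝ (h o.2.1 o.2.2) (g o.2.1 o.2.2)) ρ := hi1.sub hgAX
  simp_rw [hphi]
  rw [integral_add hsub hsumi, integral_sub hi1 hgAX, heq, ← integral_sub hi2 hgAX, hsum]
  have h5 : ∫ o : ObsData m S, ((inner ℝ (h o.2.1 o.2.2) (regOf ρ o.2.1 o.2.2) : ℝ) -
      inner ℝ (h o.2.1 o.2.2) (g o.2.1 o.2.2)) ∂ρ =
      ∫ x, ∑ a, propOf ρ a x * (inner ℝ (h a x) (regOf ρ a x) - inner ℝ (h a x) (g a x))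
        ∂covLawOf ρ :=
    integral_trt (h := fun a x => (inner ℝ (h a x) (regOf ρ a x) : ℝ) - inner ℝ (h a x) (g a x))
      (fun a => ((hm a).inner (measurable_regOf ρ a)).sub ((hm a).inner (hn.meas_g a)))
      (hi2.sub hgAX)
  -- In the residual part of the score, integrating out the outcome replaces `Y` by its regression,
  -- and integrating out the treatment replaces `1 / e` by `propOf / e`. The plug-in part
  -- contributes the same error with weight one and opposite sign, which produces the factor `1 -
  -- propOf / e`.
  have h6 : ∀ a x, propOf ρ a x * ((inner ℝ (h a x) (regOf ρ a x) : ℝ) -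
      inner ℝ (h a x) (g a x)) =
      -(inner ℝ (w a x) (g a x - regOf ρ a x) * (propOf ρ a x / e a x)) := by
    intro a x
    simp only [hh, real_inner_smul_left, inner_sub_right]
    ring
  rw [h5]
  simp_rw [h6]
  have hneg : ∀ a, Integrable (fun x => -((inner ℝ (w a x) (g a x - regOf ρ a x) : ℝ) *
      (propOf ρ a x / e a x))) (covLawOf ρ) := fun a => (hwdr a).neg
  rw [integral_finsetSum _ fun a _ => hneg a, ← Finset.sum_add_distrib,
    ← Finset.sum_add_distrib]
  refine Finset.sum_congr rfl fun a _ => ?_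
  rw [integral_neg]
  have h7 : ∫ x, (inner ℝ (w a x) (g a x - regOf ρ a x) : ℝ) * (1 - propOf ρ a x / e a x)
      ∂covLawOf ρ = ∫ x, (inner ℝ (w a x) (g a x) : ℝ) ∂covLawOf ρ -
        ∫ x, (inner ℝ (w a x) (regOf ρ a x) : ℝ) ∂covLawOf ρ -
        ∫ x, (inner ℝ (w a x) (g a x - regOf ρ a x) : ℝ) * (propOf ρ a x / e a x)
          ∂covLawOf ρ := by
    have hgr : Integrable (fun x => (inner ℝ (w a x) (g a x) : ℝ) -
        inner ℝ (w a x) (regOf ρ a x)) (covLawOf ρ) := (hwg a).sub (hwr a)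
    rw [← integral_sub (hwg a) (hwr a), ← integral_sub hgr (hwdr a)]
    refine integral_congr_ae (ae_of_all _ fun x => ?_)
    simp only [inner_sub_right]
    ring
  rw [h7]
  ring

/-- The mean square distance between two pairs of nuisance functions. -/
def nuisDist (π : Measure S) (e e' : Trt m → S → ℝ) (g g' : Trt m → S → Outc m) : ℝ :=
  ∑ a, (∫ x, ‖g a x - g' a x‖ ^ 2 ∂π + ∫ x, |e a x - e' a x| ^ 2 ∂π)

lemma nuisDist_nonneg (π : Measure S) (e e' : Trt m → S → ℝ) (g g' : Trt m → S → Outc m) :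
    0 ≤ nuisDist π e e' g g' :=
  Finset.sum_nonneg fun _ _ => add_nonneg (integral_nonneg fun _ => by positivity)
    (integral_nonneg fun _ => by positivity)

lemma IsNuisance.memLp_sub_g {π : Measure S} [IsFiniteMeasure π] {e e' : Trt m → S → ℝ}
    {g g' : Trt m → S → Outc m} {c c' C C' : ℝ} (hn : IsNuisance π e g c C)
    (hn' : IsNuisance π e' g' c' C') (a : Trt m) : MemLp (fun x => g a x - g' a x) 2 π :=
  (MemLp.of_bound (hn.meas_g a).aestronglyMeasurable C (hn.norm_g_le a)).sub
    (MemLp.of_bound (hn'.meas_g a).aestronglyMeasurable C' (hn'.norm_g_le a))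

lemma IsNuisance.memLp_sub_e {π : Measure S} [IsFiniteMeasure π] {e e' : Trt m → S → ℝ}
    {g g' : Trt m → S → Outc m} {c c' C C' : ℝ} (hn : IsNuisance π e g c C)
    (hn' : IsNuisance π e' g' c' C') (a : Trt m) : MemLp (fun x => e a x - e' a x) 2 π :=
  (MemLp.of_bound (hn.meas_e a).aestronglyMeasurable 1 (hn.norm_e_le a)).sub
    (MemLp.of_bound (hn'.meas_e a).aestronglyMeasurable 1 (hn'.norm_e_le a))

/-- The score is mean square continuous in the nuisance functions. -/
lemma exists_lintegral_phiOf_sub_sq_le (hw : IsWeight w Cw) {V : ℝ} (hV0 : 0 ≤ V)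
    (hV : ∀ a, ∀ᵐ x ∂covLawOf ρ,
      ∫⁻ y, ‖y - regOf ρ a x‖ₑ ^ 2 ∂outLawOf ρ a x ≤ ENNReal.ofReal V)
    (hc : 0 < c) (hn : IsNuisance (covLawOf ρ) (propOf ρ) (regOf ρ) c C)
    {c' : ℝ} (hc' : 0 < c') (C' : ℝ) :
    ∃ B : ℝ, 0 ≤ B ∧ ∀ e' g', IsNuisance (covLawOf ρ) e' g' c' C' →
      ∫⁻ o, ‖phiOf w e' g' o - phiOf w (propOf ρ) (regOf ρ) o‖ₑ ^ 2 ∂ρ ≤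
        ENNReal.ofReal (B * nuisDist (covLawOf ρ) (propOf ρ) e' (regOf ρ) g') := by
  set n : ℝ := (Fintype.card (Trt m) : ℝ)
  -- The factor `3` comes from squaring a sum of three terms. `B1` collects the two terms driven by
  -- the regression error, with `n` from Cauchy–Schwarz over the treatments; `B2` belongs to the
  -- propensity error.
  set B1 : ℝ := 3 * (Cw / c') ^ 2 + 3 * Cw ^ 2 * n with hB1
  set B2 : ℝ := 3 * (Cw / (c * c')) ^ 2 with hB2
  have hB1n : 0 ≤ B1 := by positivity
  refine ⟨B1 + B2 * V, by positivity, fun e' g' hn' => ?_⟩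
  set G : S → ℝ := fun x => ∑ a, ‖regOf ρ a x - g' a x‖ ^ 2 with hG
  set E : S → ℝ := fun x => ∑ a, |propOf ρ a x - e' a x| ^ 2 with hE
  have hG0 : ∀ x, 0 ≤ G x := fun x => Finset.sum_nonneg fun _ _ => by positivity
  have hE0 : ∀ x, 0 ≤ E x := fun x => Finset.sum_nonneg fun _ _ => by positivity
  have hGm : Measurable G := Finset.measurable_fun_sum _ fun a _ =>
    ((measurable_regOf ρ a).sub (hn'.meas_g a)).norm.pow_const 2
  have hEm : Measurable E := Finset.measurable_fun_sum _ fun a _ =>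
    ((measurable_propOf ρ a).sub (hn'.meas_e a)).norm.pow_const 2
  have hGi : ∀ a, Integrable (fun x => ‖regOf ρ a x - g' a x‖ ^ 2) (covLawOf ρ) := fun a =>
    (hn.memLp_sub_g hn' a).integrable_norm_pow two_ne_zero
  have hEi : ∀ a, Integrable (fun x => |propOf ρ a x - e' a x| ^ 2) (covLawOf ρ) := fun a =>
    (hn.memLp_sub_e hn' a).integrable_norm_pow two_ne_zero
  have hpt : ∀ᵐ o ∂ρ, ‖phiOf w e' g' o - phiOf w (propOf ρ) (regOf ρ) o‖ₑ ^ 2 ≤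
      ENNReal.ofReal (B1 * G o.2.2) + ENNReal.ofReal (B2 * E o.2.2) *
        ‖o.1 - regOf ρ o.2.1 o.2.2‖ₑ ^ 2 := by
    filter_upwards [ae_trt hn.le_e, ae_trt hn'.le_e] with o h1 h2
    obtain ⟨y, a, x⟩ := o
    simp only at h1 h2 ⊢
    have hCw := hw.nonneg_bound x
    have he0 : 0 < propOf ρ a x := hc.trans_le (h1 a)
    have he0' : 0 < e' a x := hc'.trans_le (h2 a)
    -- The difference of the scores is split so that the change of the inverse weight, `T2`,
    -- multiplies the residual at the true regression, whose conditional second moment is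
    -- controlled. The regression error enters only through `T1` and `T3`.
    set T1 : ℝ := inner ℝ (w a x) (regOf ρ a x - g' a x) / e' a x with hT1
    set T2 : ℝ := inner ℝ (w a x) (y - regOf ρ a x) * (1 / e' a x - 1 / propOf ρ a x) with hT2
    set T3 : ℝ := ∑ b, inner ℝ (w b x) (g' b x - regOf ρ b x) with hT3
    have hdec : phiOf w e' g' (y, a, x) - phiOf w (propOf ρ) (regOf ρ) (y, a, x) =
        T1 + T2 + T3 := by
      simp only [phiOf, hT1, hT2, hT3, inner_sub_right, Finset.sum_sub_distrib]
      ring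
    have h1' : T1 ^ 2 ≤ (Cw / c') ^ 2 * G x := by
      have : |T1| ≤ Cw / c' * ‖regOf ρ a x - g' a x‖ := by
        rw [hT1, abs_div, abs_of_pos he0', div_mul_eq_mul_div]
        refine div_le_div₀ (by positivity) ((abs_real_inner_le_norm _ _).trans ?_) hc' (h2 a)
        gcongr
        exact hw.norm_le _ _
      calc T1 ^ 2 = |T1| ^ 2 := (sq_abs _).symm
        _ ≤ (Cw / c' * ‖regOf ρ a x - g' a x‖) ^ 2 := by gcongr
        _ = (Cw / c') ^ 2 * ‖regOf ρ a x - g' a x‖ ^ 2 := mul_pow _ _ _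
        _ ≤ (Cw / c') ^ 2 * G x := by
          gcongr
          exact Finset.single_le_sum (f := fun a => ‖regOf ρ a x - g' a x‖ ^ 2)
            (fun _ _ => by positivity) (Finset.mem_univ a)
    have h2' : T2 ^ 2 ≤ (Cw / (c * c')) ^ 2 * E x * ‖y - regOf ρ a x‖ ^ 2 := by
      have : |T2| ≤ Cw / (c * c') * |propOf ρ a x - e' a x| * ‖y - regOf ρ a x‖ := by
        have e1 : 1 / e' a x - 1 / propOf ρ a x =
            (propOf ρ a x - e' a x) / (propOf ρ a x * e' a x) := by
          field_simp
        rw [hT2, e1, abs_mul, abs_div, abs_of_pos (mul_pos he0 he0')]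
        calc _ ≤ (Cw * ‖y - regOf ρ a x‖) * (|propOf ρ a x - e' a x| / (c * c')) := by
              refine mul_le_mul ((abs_real_inner_le_norm _ _).trans ?_) ?_ (by positivity)
                (by positivity)
              · gcongr
                exact hw.norm_le _ _
              · gcongr
                · exact h1 a
                · exact h2 a
          _ = _ := by ring
      calc T2 ^ 2 = |T2| ^ 2 := (sq_abs _).symm
        _ ≤ (Cw / (c * c') * |propOf ρ a x - e' a x| * ‖y - regOf ρ a x‖) ^ 2 := by gcongr
        _ = (Cw / (c * c')) ^ 2 * |propOf ρ a x - e' a x| ^ 2 * ‖y - regOf ρ a x‖ ^ 2 := by ring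
        _ ≤ _ := by
          gcongr
          exact Finset.single_le_sum (f := fun a => |propOf ρ a x - e' a x| ^ 2)
            (fun _ _ => by positivity) (Finset.mem_univ a)
    have h3' : T3 ^ 2 ≤ Cw ^ 2 * n * G x := by
      have : |T3| ≤ Cw * ∑ b, ‖regOf ρ b x - g' b x‖ := by
        rw [hT3, Finset.mul_sum]
        refine (Finset.abs_sum_le_sum_abs _ _).trans (Finset.sum_le_sum fun b _ => ?_)
        refine (abs_real_inner_le_norm _ _).trans ?_
        rw [norm_sub_rev]
        gcongr
        exact hw.norm_le _ _
      calc T3 ^ 2 = |T3| ^ 2 := (sq_abs _).symm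
        _ ≤ (Cw * ∑ b, ‖regOf ρ b x - g' b x‖) ^ 2 := by gcongr
        _ = Cw ^ 2 * (∑ b, ‖regOf ρ b x - g' b x‖) ^ 2 := mul_pow _ _ _
        _ ≤ Cw ^ 2 * (n * G x) := by
          gcongr
          exact sq_sum_le_card_mul_sum_sq (s := Finset.univ)
            (f := fun b => ‖regOf ρ b x - g' b x‖)
        _ = _ := by ring
    have hfin : (T1 + T2 + T3) ^ 2 ≤ B1 * G x + B2 * E x * ‖y - regOf ρ a x‖ ^ 2 := by
      have : (T1 + T2 + T3) ^ 2 ≤ 3 * (T1 ^ 2 + T2 ^ 2 + T3 ^ 2) := by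
        nlinarith [sq_nonneg (T1 - T2), sq_nonneg (T2 - T3), sq_nonneg (T1 - T3)]
      rw [hB1, hB2]
      linarith
    rw [hdec, ← ofReal_norm (T1 + T2 + T3), ← ofReal_norm (y - regOf ρ a x),
      ← ENNReal.ofReal_pow (norm_nonneg _), ← ENNReal.ofReal_pow (norm_nonneg _),
      ← ENNReal.ofReal_mul (mul_nonneg (by positivity) (hE0 x)),
      ← ENNReal.ofReal_add (mul_nonneg hB1n (hG0 x))
        (mul_nonneg (mul_nonneg (by positivity) (hE0 x)) (by positivity)), Real.norm_eq_abs, sq_abs]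
    exact ENNReal.ofReal_le_ofReal hfin
  have hcomp : ∀ f : S → ℝ, Measurable f →
      ∫⁻ o : ObsData m S, ENNReal.ofReal (f o.2.2) ∂ρ = ∫⁻ x, ENNReal.ofReal (f x) ∂covLawOf ρ :=
    fun f hf => (lintegral_map (f := fun x => ENNReal.ofReal (f x)) hf.ennreal_ofReal
      measurable_cov).symm
  calc _ ≤ ∫⁻ o, (ENNReal.ofReal (B1 * G o.2.2) + ENNReal.ofReal (B2 * E o.2.2) *
        ‖o.1 - regOf ρ o.2.1 o.2.2‖ₑ ^ 2) ∂ρ := lintegral_mono_ae hpt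
    _ = ∫⁻ o, ENNReal.ofReal (B1 * G o.2.2) ∂ρ + ∫⁻ o, ENNReal.ofReal (B2 * E o.2.2) *
        ‖o.1 - regOf ρ o.2.1 o.2.2‖ₑ ^ 2 ∂ρ :=
      lintegral_add_left ((hGm.comp measurable_cov).const_mul B1).ennreal_ofReal _
    _ ≤ ∫⁻ o, ENNReal.ofReal (B1 * G o.2.2) ∂ρ +
        ENNReal.ofReal V * ∫⁻ o, ENNReal.ofReal (B2 * E o.2.2) ∂ρ := by
      gcongr
      -- The propensity error depends on the covariates alone, so the conditional variance bound
      -- applies with this error as weight.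
      exact lintegral_residual_sq_le hV (f := fun _ x => ENNReal.ofReal (B2 * E x))
        fun _ => (hEm.const_mul B2).ennreal_ofReal
    _ = ENNReal.ofReal (B1 * ∫ x, G x ∂covLawOf ρ) +
        ENNReal.ofReal V * ENNReal.ofReal (B2 * ∫ x, E x ∂covLawOf ρ) := by
      have hG1 : Integrable G (covLawOf ρ) := integrable_finsetSum _ fun a _ => hGi a
      have hE1 : Integrable E (covLawOf ρ) := integrable_finsetSum _ fun a _ => hEi a
      rw [hcomp (fun x => B1 * G x) (hGm.const_mul B1), hcomp (fun x => B2 * E x)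
        (hEm.const_mul B2), ← integral_const_mul, ← integral_const_mul,
        ofReal_integral_eq_lintegral_ofReal (hG1.const_mul B1)
          (ae_of_all _ fun x => mul_nonneg hB1n (hG0 x)),
        ofReal_integral_eq_lintegral_ofReal (hE1.const_mul B2)
          (ae_of_all _ fun x => mul_nonneg (by positivity) (hE0 x))]
    _ = ENNReal.ofReal (B1 * ∫ x, G x ∂covLawOf ρ + V * (B2 * ∫ x, E x ∂covLawOf ρ)) := by
      have := integral_nonneg (μ := covLawOf ρ) (f := G) hG0
      have := integral_nonneg (μ := covLawOf ρ) (f := E) hE0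
      rw [← ENNReal.ofReal_mul hV0, ← ENNReal.ofReal_add (by positivity) (by positivity)]
    _ ≤ _ := by
      have hI1 := integral_nonneg (μ := covLawOf ρ) (f := G) hG0
      have hI2 := integral_nonneg (μ := covLawOf ρ) (f := E) hE0
      have hsum : nuisDist (covLawOf ρ) (propOf ρ) e' (regOf ρ) g' =
          ∫ x, G x ∂covLawOf ρ + ∫ x, E x ∂covLawOf ρ := by
        rw [nuisDist, Finset.sum_add_distrib, integral_finsetSum _ fun a _ => hGi a,
          integral_finsetSum _ fun a _ => hEi a]
      rw [hsum]
      refine ENNReal.ofReal_le_ofReal ?_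
      have e1 : 0 ≤ B1 * ∫ x, E x ∂covLawOf ρ := by positivity
      have e2 : 0 ≤ B2 * V * ∫ x, G x ∂covLawOf ρ := by positivity
      linarith

/-- The product of the two nuisance errors bounds the bias of the score. -/
lemma abs_integral_phiOf_sub_le (hY : Integrable (fun o : ObsData m S => o.1) ρ)
    (hw : IsWeight w Cw) (hc : 0 < c)
    (hn : IsNuisance (covLawOf ρ) (propOf ρ) (regOf ρ) c C) {e' : Trt m → S → ℝ}
    {g' : Trt m → S → Outc m} {c' C' : ℝ} (hc' : 0 < c')
    (hn' : IsNuisance (covLawOf ρ) e' g' c' C') :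
    |∫ o, (phiOf w e' g' o - phiOf w (propOf ρ) (regOf ρ) o) ∂ρ| ≤
      ∑ a, Cw / c' * (√(∫ x, ‖regOf ρ a x - g' a x‖ ^ 2 ∂covLawOf ρ) *
        √(∫ x, |propOf ρ a x - e' a x| ^ 2 ∂covLawOf ρ)) := by
  have hYp : MemLp (fun o : ObsData m S => o.1) 1 ρ := memLp_one_iff_integrable.2 hY
  have h1 := (integral_phiOf hY hw hc hn hc hn.le_e).2
  have h2 := (integral_phiOf hY hw hc' hn' hc hn.le_e).2
  -- At the true nuisance functions the double robustness correction is zero, so `h1` reads off the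
  -- target; what remains of `h2 - h1` is the correction at the fitted functions.
  simp only [sub_self, inner_zero_right, zero_mul, integral_zero, Finset.sum_const_zero,
    add_zero] at h1
  rw [integral_sub (memLp_one_iff_integrable.1 (memLp_phiOf hYp hw hc' hn'))
    (memLp_one_iff_integrable.1 (memLp_phiOf hYp hw hc hn)), h1, h2, add_sub_cancel_left]
  refine (Finset.abs_sum_le_sum_abs _ _).trans (Finset.sum_le_sum fun a _ => ?_)
  have hG := (hn.memLp_sub_g hn' a).norm
  have hE := (hn.memLp_sub_e hn' a).norm
  have hCS : ∫ x, ‖regOf ρ a x - g' a x‖ * ‖propOf ρ a x - e' a x‖ ∂covLawOf ρ ≤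
      √(∫ x, ‖regOf ρ a x - g' a x‖ ^ 2 ∂covLawOf ρ) *
        √(∫ x, |propOf ρ a x - e' a x| ^ 2 ∂covLawOf ρ) := by
    have := integral_mul_le_Lp_mul_Lq_of_nonneg (μ := covLawOf ρ) Real.HolderConjugate.two_two
      (ae_of_all _ fun x => norm_nonneg (regOf ρ a x - g' a x))
      (ae_of_all _ fun x => norm_nonneg (propOf ρ a x - e' a x))
      (by simpa using hG) (by simpa using hE)
    simpa [Real.sqrt_eq_rpow] using this
  calc _ ≤ ∫ x, ‖(inner ℝ (w a x) (g' a x - regOf ρ a x) : ℝ) * (1 - propOf ρ a x / e' a x)‖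
        ∂covLawOf ρ := norm_integral_le_integral_norm _
    _ ≤ ∫ x, Cw / c' * (‖regOf ρ a x - g' a x‖ * ‖propOf ρ a x - e' a x‖) ∂covLawOf ρ := by
      refine integral_mono_of_nonneg (ae_of_all _ fun _ => norm_nonneg _)
        ((hG.integrable_mul hE).const_mul _) ?_
      filter_upwards [hn'.le_e a] with x hx
      have hpos := hc'.trans_le hx
      have hCw := hw.nonneg_bound x
      have e1 : 1 - propOf ρ a x / e' a x = -(propOf ρ a x - e' a x) / e' a x := by
        field_simp
        ring
      rw [e1, norm_mul, norm_div, norm_neg, Real.norm_of_nonneg hpos.le]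
      calc _ ≤ (Cw * ‖regOf ρ a x - g' a x‖) * (‖propOf ρ a x - e' a x‖ / c') := by
            refine mul_le_mul ((norm_inner_le_norm _ _).trans ?_) ?_ (by positivity)
              (by positivity)
            · rw [norm_sub_rev]
              gcongr
              exact hw.norm_le _ _
            · gcongr
        _ = _ := by ring
    _ ≤ _ := by
      rw [integral_const_mul]
      have hCw : 0 ≤ Cw := by
        obtain ⟨x⟩ := nonempty_of_isProbabilityMeasure (covLawOf ρ)
        exact hw.nonneg_bound x
      gcongr

end Score

/-! ### Identification of the estimand -/

section Identification

variable {m : ℕ} {S : Type*} [MeasurableSpace S]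

/-- Consistency within one cluster type. -/
def obsOf (d : FullData m S) : ObsData m S := (d.1 d.2.1, d.2)

lemma measurable_obsOf : Measurable (obsOf (m := m) (S := S)) := by
  refine Measurable.prodMk ?_ measurable_snd
  have h : Measurable fun q : (Trt m → Outc m) × Trt m => q.1 q.2 :=
    measurable_from_prod_countable_left fun a => measurable_pi_apply a
  exact h.comp (measurable_fst.prodMk (measurable_fst.comp measurable_snd))

variable {ρ : Measure (ObsData m S)} [IsProbabilityMeasure ρ]

/-- The joint probability is disintegrated as `Y` given `(A, X)`, then `A` given `X`, then `X`. This
is the observed-data side of the comparison that proves identification. -/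
lemma setIntegral_outLawOf_mul_propOf (a : Trt m) {B : Set (Outc m)} (hB : MeasurableSet B)
    {C : Set S} (hC : MeasurableSet C) :
    ∫ x in C, (outLawOf ρ a x).real B * propOf ρ a x ∂covLawOf ρ =
      ρ.real {o | o.1 ∈ B ∧ o.2.1 = a ∧ o.2.2 ∈ C} := by
  have hkm : Measurable fun q : Trt m × S =>
      (condDistrib (fun o : ObsData m S => o.1) (fun o => o.2) ρ q).real B :=
    (Kernel.measurable_coe _ hB).ennreal_toReal
  -- A function carried by `{a} × C`, so that averaging over the treatment leaves the single term at
  -- `a`.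
  set h : Trt m → S → ℝ := fun b x =>
    (({a} : Set (Trt m)) ×ˢ C).indicator (fun q => (outLawOf ρ q.1 q.2).real B) (b, x) with hh
  have hind : Measurable fun q : Trt m × S =>
      (({a} : Set (Trt m)) ×ˢ C).indicator (fun q => (outLawOf ρ q.1 q.2).real B) q :=
    hkm.indicator ((measurableSet_singleton a).prod hC)
  have hm : ∀ b, Measurable (h b) := fun b => hind.comp measurable_prodMk_left
  have hb : ∀ b x, ‖h b x‖ ≤ 1 := by
    intro b x
    refine (norm_indicator_le_norm_self _ _).trans ?_
    simp [measureReal_le_one, abs_of_nonneg]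
  have hi : Integrable (fun o : ObsData m S => h o.2.1 o.2.2) ρ :=
    Integrable.of_bound (measurable_comp_trt hm).aestronglyMeasurable 1 (ae_of_all _ fun o => hb _ _)
  have h1 : ∫ o, h o.2.1 o.2.2 ∂ρ = ∫ x in C, (outLawOf ρ a x).real B * propOf ρ a x
      ∂covLawOf ρ := by
    rw [integral_trt hm hi, ← integral_indicator hC]
    refine integral_congr_ae (ae_of_all _ fun x => ?_)
    simp only
    rw [Finset.sum_eq_single a]
    · by_cases hx : x ∈ C <;> simp [hh, hx, mul_comm]
    · intro b _ hba
      simp [hh, hba]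
    · simp
  rw [← h1]
  have h2 := setLIntegral_preimage_condDistrib (μ := ρ) (X := fun o : ObsData m S => o.2)
    (Y := fun o => o.1) measurable_snd measurable_fst.aemeasurable hB
    ((measurableSet_singleton a).prod hC)
  have hset : (fun o : ObsData m S => o.2) ⁻¹' (({a} : Set (Trt m)) ×ˢ C) ∩
      (fun o => o.1) ⁻¹' B = {o | o.1 ∈ B ∧ o.2.1 = a ∧ o.2.2 ∈ C} := by
    ext o
    simp [and_comm]
  rw [hset] at h2
  rw [measureReal_def, ← h2, ← integral_toReal]
  · rw [← integral_indicator (measurable_snd ((measurableSet_singleton a).prod hC))]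
    rfl
  · exact ((Kernel.measurable_coe _ hB).comp measurable_snd).aemeasurable
  · exact ae_of_all _ fun o => measure_lt_top _ _

variable [StandardBorelSpace S] {G : Measure (FullData m S)} [IsProbabilityMeasure G]

/-- Under conditional ignorability and overlap, the conditional law of `Y(a)` given `X` is the
conditional law of `Y` given `A = a` and `X`. -/
lemma map_cov_potential (hρ : G.map obsOf = ρ) (a : Trt m)
    (hign : CondIndepFun (MeasurableSpace.comap (fun d : FullData m S => d.2.2) inferInstance)
      (measurable_snd.comp measurable_snd).comap_le (fun d => d.1 a) (fun d => d.2.1) G)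
    (hpos : ∀ᵐ x ∂covLawOf ρ, 0 < propOf ρ a x) :
    G.map (fun d => (d.2.2, d.1 a)) = covLawOf ρ ⊗ₘ
      (condDistrib (fun o : ObsData m S => o.1) (fun o => o.2) ρ).comap (fun x => (a, x))
        measurable_prodMk_left := by
  have hXm : Measurable fun d : FullData m S => d.2.2 := measurable_snd.comp measurable_snd
  have hAm : Measurable fun d : FullData m S => d.2.1 := measurable_fst.comp measurable_snd
  have hYm : Measurable fun d : FullData m S => d.1 a := (measurable_pi_apply a).comp measurable_fst
  have hcov : covLawOf ρ = G.map fun d => d.2.2 := by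
    rw [← hρ, covLawOf, Measure.map_map measurable_cov measurable_obsOf]
    rfl
  refine Measure.ext_prod fun {C B} hC hB => ?_
  rw [Measure.compProd_apply_prod hC hB, Measure.map_apply (hXm.prodMk hYm) (hC.prod hB)]
  set q : S → ℝ := fun x => (condDistrib (fun d : FullData m S => d.1 a) (fun d => d.2.2) G x).real B
    with hq
  have hqm : Measurable q := (Kernel.measurable_coe _ hB).ennreal_toReal
  -- `obsOf` leaves `(A, X)` untouched, hence the propensity score may be computed from either law.
  have hprop : ∀ᵐ d ∂G, propOf ρ a d.2.2 =
      (condDistrib (fun d : FullData m S => d.2.1) (fun d => d.2.2) G d.2.2).real {a} := by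
    refine ae_of_ae_map hXm.aemeasurable (p := fun x => propOf ρ a x =
      (condDistrib (fun d : FullData m S => d.2.1) (fun d => d.2.2) G x).real {a}) ?_
    subst hρ
    have h := condDistrib_map (mβ := inferInstance) (ν := G) (f := obsOf)
      (X := fun o : ObsData m S => o.2.2) (Y := fun o : ObsData m S => o.2.1)
      measurable_cov.aemeasurable (measurable_fst.comp measurable_snd).aemeasurable
      measurable_obsOf.aemeasurable
    filter_upwards [h] with x hx
    rw [propOf, hx]
    rfl
  have hrm : Measurable fun x => (outLawOf ρ a x).real B :=
    ((Kernel.measurable_coe _ hB).comp measurable_prodMk_left).ennreal_toReal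
  have hbd : ∀ f : S → ℝ, Measurable f → (∀ x, 0 ≤ f x) → (∀ x, f x ≤ 1) →
      Integrable f (covLawOf ρ) := fun f hf h0 h1 =>
    Integrable.of_bound hf.aestronglyMeasurable 1
      (ae_of_all _ fun x => by rw [Real.norm_of_nonneg (h0 x)]; exact h1 x)
  -- Both sides have the same integral over every covariate set `C`, namely the probability that
  -- `Y(a) ∈ B`, `A = a` and `X ∈ C`. Ignorability factorizes this probability on the left; on the
  -- right it is the disintegration of the observed law.
  have hqe : (fun x => q x * propOf ρ a x) =ᵐ[covLawOf ρ]
      fun x => (outLawOf ρ a x).real B * propOf ρ a x := by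
    refine Integrable.ae_eq_of_forall_setIntegral_eq _ _
      (hbd _ (hqm.mul (measurable_propOf ρ a))
        (fun x => mul_nonneg measureReal_nonneg (propOf_nonneg ρ a x))
        (fun x => mul_le_one₀ measureReal_le_one (propOf_nonneg ρ a x) (propOf_le_one ρ a x)))
      (hbd _ (hrm.mul (measurable_propOf ρ a))
        (fun x => mul_nonneg measureReal_nonneg (propOf_nonneg ρ a x))
        (fun x => mul_le_one₀ measureReal_le_one (propOf_nonneg ρ a x) (propOf_le_one ρ a x)))
      fun C hC _ => ?_
    rw [setIntegral_outLawOf_mul_propOf a hB hC]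
    have h1 := (condIndepFun_iff_condExp_inter_preimage_eq_mul (hm' := hXm.comap_le) hYm hAm).1
      hign B {a} hB (measurableSet_singleton a)
    have h2 := condDistrib_ae_eq_condExp (μ := G) hXm hYm hB
    have h3 := condDistrib_ae_eq_condExp (μ := G) hXm hAm (measurableSet_singleton a)
    have hsm : MeasurableSet ((fun d : FullData m S => d.1 a) ⁻¹' B ∩
        (fun d => d.2.1) ⁻¹' {a}) := (hYm hB).inter (hAm (measurableSet_singleton a))
    calc ∫ x in C, q x * propOf ρ a x ∂covLawOf ρ
        = ∫ d in (fun d : FullData m S => d.2.2) ⁻¹' C, q d.2.2 * propOf ρ a d.2.2 ∂G := by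
          have hm : Measurable fun x => q x * propOf ρ a x := hqm.mul (measurable_propOf ρ a)
          rw [hcov, setIntegral_map hC hm.aestronglyMeasurable hXm.aemeasurable]
      _ = ∫ d in (fun d : FullData m S => d.2.2) ⁻¹' C,
          (G⟦(fun d : FullData m S => d.1 a) ⁻¹' B ∩ (fun d => d.2.1) ⁻¹' {a} |
            MeasurableSpace.comap (fun d : FullData m S => d.2.2) inferInstance⟧) d ∂G := by
          refine integral_congr_ae (ae_restrict_of_ae ?_)
          filter_upwards [h1, h2, h3, hprop] with d h1 h2 h3 h4
          rw [h1, ← h2, ← h3, h4]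
      _ = ρ.real {o | o.1 ∈ B ∧ o.2.1 = a ∧ o.2.2 ∈ C} := by
          rw [setIntegral_condExp hXm.comap_le ((integrable_const _).indicator hsm) ⟨C, hC, rfl⟩,
            integral_indicator_const _ hsm, smul_eq_mul, mul_one,
            measureReal_restrict_apply hsm, ← hρ, measureReal_def, measureReal_def,
            Measure.map_apply measurable_obsOf]
          -- Consistency: on the event `A = a` the observed outcome is `Y(a)`.
          · congr 2
            ext d
            simp only [Set.mem_inter_iff, Set.mem_preimage, Set.mem_singleton_iff,
              Set.mem_ofPred_eq, obsOf, and_assoc]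
            constructor
            · rintro ⟨hy, ha, hx⟩
              exact ⟨by rwa [ha], ha, hx⟩
            · rintro ⟨hy, ha, hx⟩
              exact ⟨by rwa [ha] at hy, ha, hx⟩
          · exact (measurable_fst hB).inter (((measurable_fst.comp measurable_snd)
              (measurableSet_singleton a)).inter (measurable_cov hC))
  -- Overlap cancels the propensity score. Doing this for each fixed `B` is enough, because
  -- rectangles determine the joint law.
  have hqr : ∀ᵐ x ∂covLawOf ρ,
      condDistrib (fun d : FullData m S => d.1 a) (fun d => d.2.2) G x B = outLawOf ρ a x B := by
    filter_upwards [hqe, hpos] with x hx hp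
    have := mul_right_cancel₀ hp.ne' hx
    simp only [hq] at this
    rwa [measureReal_def, measureReal_def,
      ENNReal.toReal_eq_toReal_iff' (measure_ne_top _ _) (measure_ne_top _ _)] at this
  have h4 := setLIntegral_preimage_condDistrib (μ := G) hXm hYm.aemeasurable hB hC
  calc G ((fun d => (d.2.2, d.1 a)) ⁻¹' C ×ˢ B) = _ := h4.symm
    _ = ∫⁻ x in C, condDistrib (fun d : FullData m S => d.1 a) (fun d => d.2.2) G x B
        ∂covLawOf ρ := by
      rw [hcov, setLIntegral_map hC (Kernel.measurable_coe _ hB) hXm]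
    _ = _ := lintegral_congr_ae (ae_restrict_of_ae hqr)

/-- Integrability of `Y(a)` is not assumed. It follows from the conditional variance and regression
bounds once the law of `(X, Y(a))` has been expressed through the observed conditional law. -/
lemma integral_inner_potential (hρ : G.map obsOf = ρ) (a : Trt m)
    (hign : CondIndepFun (MeasurableSpace.comap (fun d : FullData m S => d.2.2) inferInstance)
      (measurable_snd.comp measurable_snd).comap_le (fun d => d.1 a) (fun d => d.2.1) G)
    (hpos : ∀ᵐ x ∂covLawOf ρ, 0 < propOf ρ a x) {V : ℝ≥0∞} (hVt : V ≠ ∞)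
    (hV : ∀ᵐ x ∂covLawOf ρ, ∫⁻ y, ‖y - regOf ρ a x‖ₑ ^ 2 ∂outLawOf ρ a x ≤ V)
    {C : ℝ} (hg : ∀ᵐ x ∂covLawOf ρ, ‖regOf ρ a x‖ ≤ C)
    {w : Trt m → S → Outc m} {Cw : ℝ} (hw : IsWeight w Cw) :
    ∫ d, inner ℝ (w a d.2.2) (d.1 a) ∂G = ∫ x, inner ℝ (w a x) (regOf ρ a x) ∂covLawOf ρ := by
  have hXm : Measurable fun d : FullData m S => d.2.2 := measurable_snd.comp measurable_snd
  have hYm : Measurable fun d : FullData m S => d.1 a := (measurable_pi_apply a).comp measurable_fst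
  have hJ := map_cov_potential hρ a hign hpos
  set κ := (condDistrib (fun o : ObsData m S => o.1) (fun o => o.2) ρ).comap (fun x => (a, x))
    measurable_prodMk_left with hκ
  have hκx : ∀ x, κ x = outLawOf ρ a x := fun x => rfl
  have hmeas : Measurable fun p : S × Outc m => (inner ℝ (w a p.1) p.2 : ℝ) :=
    ((hw.meas a).comp measurable_fst).inner measurable_snd
  have h1 : ∫ d, (inner ℝ (w a d.2.2) (d.1 a) : ℝ) ∂G =
      ∫ p, (inner ℝ (w a p.1) p.2 : ℝ) ∂(covLawOf ρ ⊗ₘ κ) := by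
    rw [← hJ, integral_map (hXm.prodMk hYm).aemeasurable hmeas.aestronglyMeasurable]
  have hYi : Integrable (fun p : S × Outc m => p.2) (covLawOf ρ ⊗ₘ κ) := by
    refine ⟨measurable_snd.aestronglyMeasurable, ?_⟩
    rw [HasFiniteIntegral, Measure.lintegral_compProd measurable_snd.enorm]
    refine (lintegral_mono_ae (g := fun _ => V + 1 + ENNReal.ofReal C) ?_).trans_lt ?_
    · filter_upwards [hV, hg] with x h1 h2
      -- The inequality `t ≤ t ^ 2 + 1` turns the bound on the second central moment into one on the
      -- first moment.
      calc ∫⁻ y, ‖y‖ₑ ∂κ x ≤ ∫⁻ y, (‖y - regOf ρ a x‖ₑ ^ 2 + (1 + ENNReal.ofReal C)) ∂κ x := by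
            refine lintegral_mono fun y => ?_
            calc ‖y‖ₑ = ‖(y - regOf ρ a x) + regOf ρ a x‖ₑ := by simp
              _ ≤ ‖y - regOf ρ a x‖ₑ + ‖regOf ρ a x‖ₑ := enorm_add_le _ _
              _ ≤ (‖y - regOf ρ a x‖ₑ ^ 2 + 1) + ENNReal.ofReal C := by
                gcongr
                · rcases le_total ‖y - regOf ρ a x‖ₑ 1 with h | h
                  · exact h.trans le_add_self
                  · exact (le_self_pow h two_ne_zero).trans le_self_add
                · rw [← ofReal_norm]
                  exact ENNReal.ofReal_le_ofReal h2
              _ = _ := by ring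
        _ = ∫⁻ y, ‖y - regOf ρ a x‖ₑ ^ 2 ∂κ x + (1 + ENNReal.ofReal C) := by
            rw [lintegral_add_right _ measurable_const]
            simp
        _ ≤ V + (1 + ENNReal.ofReal C) := by gcongr; exact h1
        _ = _ := by ring
    · simp [hVt.lt_top]
  have hi : Integrable (fun p : S × Outc m => (inner ℝ (w a p.1) p.2 : ℝ)) (covLawOf ρ ⊗ₘ κ) := by
    refine (hYi.norm.const_mul Cw).mono' hmeas.aestronglyMeasurable (ae_of_all _ fun p => ?_)
    refine (norm_inner_le_norm _ _).trans ?_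
    gcongr
    exact hw.norm_le _ _
  rw [h1, Measure.integral_compProd hi]
  refine integral_congr_ae ?_
  filter_upwards [((Measure.integrable_compProd_iff hYi.1).1 hYi).1] with x hx
  exact integral_inner hx _

end Identification

/-! ### Passing from the full data to the observed data type by type -/

section ObservedLaw

variable {K : ℕ} {M : Fin K → ℕ} {S : Fin K → Type*} [∀ k, MeasurableSpace (S k)]
  (F : Measure (FullCluster M S))

lemma typeProb_obsLaw (k : Fin K) : typeProb (obsLaw F) k = typeProb F k := by
  rw [typeProb, obsLaw, measureReal_def, Measure.map_apply measurable_observe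
    (measurable_sigmaFst (measurableSet_singleton k))]
  rfl

/-- `observe` preserves the type and acts inside each fibre as `obsOf`, so conditioning on the type
commutes with it. -/
lemma typeLaw_obsLaw (k : Fin K) : typeLaw (obsLaw F) k = (typeLaw F k).map obsOf := by
  ext s hs
  rw [Measure.map_apply measurable_obsOf hs]
  simp only [typeLaw, Measure.smul_apply, (measurableEmbedding_sigmaMk k).comap_apply]
  have h1 : obsLaw F (Sigma.fst ⁻¹' {k}) = F (Sigma.fst ⁻¹' {k}) := by
    rw [obsLaw, Measure.map_apply measurable_observe
      (measurable_sigmaFst (measurableSet_singleton k))]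
    rfl
  have h2 : obsLaw F (Sigma.mk k '' s) = F (Sigma.mk k '' (obsOf ⁻¹' s)) := by
    rw [obsLaw, Measure.map_apply measurable_observe
      ((measurableEmbedding_sigmaMk k).measurableSet_image.2 hs)]
    congr 1
    ext ⟨l, d⟩
    simp only [Set.mem_preimage, Set.mem_image]
    constructor
    · rintro ⟨o, ho, h⟩
      obtain rfl : k = l := congrArg Sigma.fst h
      refine ⟨d, ?_, rfl⟩
      have h' : o = obsOf d := eq_of_heq (Sigma.mk.inj h).2
      rw [h'] at ho
      exact ho
    · rintro ⟨o, ho, h⟩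
      obtain rfl : k = l := congrArg Sigma.fst h
      obtain rfl := sigma_mk_injective h
      exact ⟨obsOf o, ho, rfl⟩
  rw [h1, h2]

end ObservedLaw

/-! ### The efficiency bound of a pathwise differentiable functional -/

section EfficiencyBound

variable {Z : Type*} [MeasurableSpace Z] {P : ProbabilityMeasure Z}

lemma integral_withDensity_ofReal {μ : Measure Z} {r : Z → ℝ} (hr : Measurable r)
    (hr0 : ∀ z, 0 ≤ r z) (f : Z → ℝ) :
    ∫ z, f z ∂(μ.withDensity fun z => ENNReal.ofReal (r z)) = ∫ z, r z * f z ∂μ := by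
  rw [integral_withDensity_eq_integral_toReal_smul hr.ennreal_ofReal
    (ae_of_all _ fun _ => ENNReal.ofReal_lt_top)]
  refine integral_congr_ae (ae_of_all _ fun z => ?_)
  simp [ENNReal.toReal_ofReal (hr0 z)]

lemma integral_sub_add {μ : Measure Z} {f g h : Z → ℝ} (hf : Integrable f μ)
    (hg : Integrable g μ) (hh : Integrable h μ) (c d : ℝ) :
    ∫ z, (f z - c * g z + d * h z) ∂μ = ∫ z, f z ∂μ - c * ∫ z, g z ∂μ + d * ∫ z, h z ∂μ := by
  have h1 : Integrable (fun z => f z - c * g z) μ := hf.sub (hg.const_mul c)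
  rw [integral_add h1 (hh.const_mul d), integral_sub hf (hg.const_mul c), integral_const_mul,
    integral_const_mul]

/-- The bound `C * |t|` forces the likelihood ratio to be identically one at `t = 0`. -/
lemma IsRegularSubmodel.eq_at_zero {Q : ℝ → ProbabilityMeasure Z} {s : Z → ℝ}
    (h : IsRegularSubmodel P Q s) : Q 0 = P := by
  obtain ⟨-, r, C, -, hev, -⟩ := h
  obtain ⟨h1, h2⟩ := hev.self_of_nhds
  refine Subtype.ext ?_
  change (Q 0 : Measure Z) = P
  have : ∀ z, r 0 z = 1 := fun z => by
    have := (h1 z).2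
    rw [abs_zero, mul_zero, abs_nonpos_iff, sub_eq_zero] at this
    exact this
  rw [h2]
  simp [this]

/-- Dominated convergence for the difference quotients `(r t - 1) / t * f`, with majorant `|C| *
|f|`. The uniform bound on the likelihood ratios is what makes mere integrability of `f` sufficient.
-/
lemma IsRegularSubmodel.hasDerivAt_integral {Q : ℝ → ProbabilityMeasure Z} {s : Z → ℝ}
    (h : IsRegularSubmodel P Q s) {f : Z → ℝ} (hf : Integrable f (P : Measure Z)) :
    HasDerivAt (fun t => ∫ z, f z ∂(Q t : Measure Z)) (∫ z, f z * s z ∂(P : Measure Z)) 0 := by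
  have hQ0 := h.eq_at_zero
  obtain ⟨hs, r, C, hrm, hev, hd⟩ := h
  have hr0 : ∀ z, r 0 z = 1 := fun z => by
    have := (hev.self_of_nhds.1 z).2
    rwa [abs_zero, mul_zero, abs_nonpos_iff, sub_eq_zero] at this
  have hint : ∀ᶠ t in 𝓝 (0 : ℝ), ∫ z, f z ∂(Q t : Measure Z) =
      ∫ z, r t z * f z ∂(P : Measure Z) := by
    filter_upwards [hev] with t ht
    rw [ht.2, integral_withDensity_ofReal (hrm t) fun z => (ht.1 z).1]
  rw [hasDerivAt_iff_tendsto_slope_zero]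
  have hlim : Tendsto (fun t : ℝ => ∫ z, t⁻¹ * (r t z - 1) * f z ∂(P : Measure Z)) (𝓝[≠] 0)
      (𝓝 (∫ z, f z * s z ∂(P : Measure Z))) := by
    refine tendsto_integral_filter_of_dominated_convergence (fun z => |C| * |f z|) ?_ ?_
      (hf.abs.const_mul _) ?_
    · exact Eventually.of_forall fun t =>
        ((((hrm t).sub_const 1).const_mul t⁻¹).aestronglyMeasurable).mul hf.1
    · filter_upwards [hev.filter_mono nhdsWithin_le_nhds, self_mem_nhdsWithin] with t ht ht0
      refine ae_of_all _ fun z => ?_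
      rw [norm_mul, norm_mul, norm_inv, Real.norm_eq_abs, Real.norm_eq_abs, Real.norm_eq_abs]
      gcongr
      have ht0' : 0 < |t| := abs_pos.2 ht0
      rw [inv_mul_le_iff₀ ht0', mul_comm]
      exact (ht.1 z).2.trans (by gcongr; exact le_abs_self C)
    · filter_upwards [hd] with z hz
      rw [hasDerivAt_iff_tendsto_slope_zero] at hz
      simp only [zero_add, hr0, smul_eq_mul] at hz
      rw [mul_comm (f z)]
      exact hz.mul_const _
  refine hlim.congr' ?_
  have hbdd : ∀ᶠ t in 𝓝 (0 : ℝ), Integrable (fun z => r t z * f z) (P : Measure Z) := by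
    filter_upwards [hev] with t ht
    refine hf.bdd_mul (hrm t).aestronglyMeasurable (c := 1 + C * |t|) (ae_of_all _ fun z => ?_)
    have h1 := abs_le.1 (ht.1 z).2
    rw [Real.norm_eq_abs, abs_of_nonneg (ht.1 z).1]
    linarith [h1.2]
  filter_upwards [hint.filter_mono nhdsWithin_le_nhds, hbdd.filter_mono nhdsWithin_le_nhds]
    with t h1 h2
  rw [zero_add, h1, hQ0, ← integral_sub h2 hf, smul_eq_mul, ← integral_const_mul]
  refine integral_congr_ae (ae_of_all _ fun z => ?_)
  simp only
  ring

/-- A score is a limit of difference quotients of the likelihood ratio, all of which are bounded by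
the same constant. -/
lemma IsRegularSubmodel.exists_bound {Q : ℝ → ProbabilityMeasure Z} {s : Z → ℝ}
    (h : IsRegularSubmodel P Q s) : ∃ C, ∀ᵐ z ∂(P : Measure Z), ‖s z‖ ≤ C := by
  obtain ⟨hs, r, C, hrm, hev, hd⟩ := h
  refine ⟨|C|, ?_⟩
  filter_upwards [hd] with z hz
  refine hz.le_of_lip' (abs_nonneg C) ?_
  have h0 : r 0 z = 1 := by
    have := (hev.self_of_nhds.1 z).2
    rwa [abs_zero, mul_zero, abs_nonpos_iff, sub_eq_zero] at this
  filter_upwards [hev] with t ht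
  rw [h0, sub_zero]
  exact (ht.1 z).2.trans (by rw [Real.norm_eq_abs]; gcongr; exact le_abs_self C)

/-- The total mass is constant along the submodel; its derivative is the mean of the score. -/
lemma IsRegularSubmodel.integral_score {Q : ℝ → ProbabilityMeasure Z} {s : Z → ℝ}
    (h : IsRegularSubmodel P Q s) : ∫ z, s z ∂(P : Measure Z) = 0 := by
  have h1 := h.hasDerivAt_integral (f := fun _ => 1) (integrable_const _)
  simp only [one_mul, integral_const, probReal_univ, smul_eq_mul, mul_one] at h1
  exact h1.unique (hasDerivAt_const _ _)

/-- Every bounded mean-zero function is the score of a regular submodel. -/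
lemma exists_isRegularSubmodel {s : Z → ℝ} (hs : Measurable s) {C : ℝ} (hb : ∀ z, |s z| ≤ C)
    (h0 : ∫ z, s z ∂(P : Measure Z) = 0) : ∃ Q, IsRegularSubmodel P Q s := by
  have hsi : Integrable s (P : Measure Z) :=
    Integrable.of_bound hs.aestronglyMeasurable C (ae_of_all _ hb)
  have hnn : ∀ t, |t| * C ≤ 1 → ∀ z, 0 ≤ 1 + t * s z := by
    intro t ht z
    have h1 : |t * s z| ≤ 1 := by
      rw [abs_mul]
      exact (mul_le_mul_of_nonneg_left (hb z) (abs_nonneg t)).trans ht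
    linarith [neg_le_of_abs_le h1]
  have hprob : ∀ t, |t| * C ≤ 1 →
      IsProbabilityMeasure ((P : Measure Z).withDensity fun z => ENNReal.ofReal (1 + t * s z)) := by
    intro t ht
    constructor
    rw [withDensity_apply _ MeasurableSet.univ, setLIntegral_univ,
      ← ofReal_integral_eq_lintegral_ofReal (f := fun z => 1 + t * s z)
        ((integrable_const 1).add (hsi.const_mul t)) (ae_of_all _ (hnn t ht)),
      integral_add (integrable_const _) (hsi.const_mul t), integral_const_mul, h0]
    simp
  classical
  -- The linear path `1 + t s` is a density as long as `|t| * C ≤ 1`. Beyond that the value `P` is a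
  -- dummy, since only `t` near zero matters.
  set Q : ℝ → ProbabilityMeasure Z := fun t =>
    if ht : |t| * C ≤ 1 then ⟨_, hprob t ht⟩ else P with hQ
  have hQt : ∀ t, |t| * C ≤ 1 → (Q t : Measure Z) =
      (P : Measure Z).withDensity fun z => ENNReal.ofReal (1 + t * s z) := by
    intro t ht
    have : Q t = ⟨_, hprob t ht⟩ := dif_pos ht
    rw [this]
    rfl
  refine ⟨Q, hs,
    fun t z => 1 + t * s z, C, fun t => measurable_const.add (hs.const_mul t), ?_, ?_⟩
  · have hev : ∀ᶠ t in 𝓝 (0 : ℝ), |t| * C < 1 := by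
      have : Tendsto (fun t : ℝ => |t| * C) (𝓝 0) (𝓝 (|0| * C)) :=
        (continuous_abs.mul continuous_const).tendsto 0
      rw [abs_zero, zero_mul] at this
      exact this.eventually_lt_const one_pos
    filter_upwards [hev] with t ht
    refine ⟨fun z => ⟨hnn t ht.le z, ?_⟩, ?_⟩
    · rw [add_sub_cancel_left, abs_mul, mul_comm]
      gcongr
      exact hb z
    · exact hQt t ht.le
  · refine ae_of_all _ fun z => ?_
    simpa using ((hasDerivAt_id (0 : ℝ)).mul_const (s z)).const_add 1

/-- The efficiency bound of a functional whose derivative along every regular submodel is the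
covariance of the score with a mean-zero, square integrable gradient. -/
theorem isEfficiencyBound_of_gradient {ψ : ProbabilityMeasure Z → ℝ} {f : Z → ℝ}
    (hfm : Measurable f) (hf : MemLp f 2 (P : Measure Z)) (hf0 : ∫ z, f z ∂(P : Measure Z) = 0)
    (hder : ∀ Q s, IsRegularSubmodel P Q s →
      HasDerivAt (fun t => ψ (Q t)) (∫ z, f z * s z ∂(P : Measure Z)) 0)
    {A : Set Z} (hA : MeasurableSet A) (hA0 : (P : Measure Z).real A ≠ 0)
    (hA1 : (P : Measure Z).real A ≠ 1) :
    IsEfficiencyBound P ψ Var[f; (P : Measure Z)] := by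
  rw [variance_of_integral_eq_zero hfm.aemeasurable hf0]
  refine ⟨fun Q s h => (hder Q s h).differentiableAt, ?_, ?_⟩
  · rintro b ⟨Q, s, h, hpos, rfl⟩
    rw [(hder Q s h).deriv]
    obtain ⟨C, hC⟩ := h.exists_bound
    have hs : MemLp s 2 (P : Measure Z) := MemLp.of_bound h.1.aestronglyMeasurable C hC
    set D := ∫ z, s z ^ 2 ∂(P : Measure Z) with hD
    set B := ∫ z, f z * s z ∂(P : Measure Z) with hB
    -- The coefficient `B / D` is that of the projection of `f` on `s`; nonnegativity of the
    -- residual is the Cauchy–Schwarz inequality `B ^ 2 / D ≤ ∫ f ^ 2`.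
    have hnn : 0 ≤ ∫ z, (f z - B / D * s z) ^ 2 ∂(P : Measure Z) :=
      integral_nonneg fun _ => sq_nonneg _
    have hfs : Integrable (fun z => f z * s z) (P : Measure Z) := hf.integrable_mul hs
    have hexp : ∫ z, (f z - B / D * s z) ^ 2 ∂(P : Measure Z) =
        ∫ z, f z ^ 2 ∂(P : Measure Z) - 2 * (B / D) * B + (B / D) ^ 2 * D := by
      have h1 : ∀ z, (f z - B / D * s z) ^ 2 =
          f z ^ 2 - 2 * (B / D) * (f z * s z) + (B / D) ^ 2 * s z ^ 2 := fun z => by ring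
      simp_rw [h1]
      rw [integral_sub_add hf.integrable_sq hfs hs.integrable_sq]
    rw [hexp] at hnn
    have : -(2 * (B / D) * B) + (B / D) ^ 2 * D = -(B ^ 2 / D) := by
      field_simp
      ring
    linarith
  · intro b hb
    -- Since bounded mean-zero functions are scores, an upper bound `b` dominates the Cramér–Rao
    -- value of each nondegenerate one.
    have key : ∀ (s : Z → ℝ) (C : ℝ), Measurable s → (∀ z, |s z| ≤ C) →
        ∫ z, s z ∂(P : Measure Z) = 0 → 0 < ∫ z, s z ^ 2 ∂(P : Measure Z) →
        (∫ z, f z * s z ∂(P : Measure Z)) ^ 2 / ∫ z, s z ^ 2 ∂(P : Measure Z) ≤ b := by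
      intro s C hs hC h0 hpos
      obtain ⟨Q, hQ⟩ := exists_isRegularSubmodel hs hC h0
      exact hb ⟨Q, s, hQ, hpos, by rw [(hder Q s hQ).deriv]⟩
    -- the truncated gradient
    set fn : ℕ → Z → ℝ := fun n z => if |f z| ≤ n then f z else 0 with hfn
    have hfnm : ∀ n, Measurable (fn n) := fun n =>
      Measurable.ite (measurableSet_le hfm.abs measurable_const) hfm measurable_const
    have hfnb : ∀ n z, |fn n z| ≤ n := by
      intro n z
      simp only [hfn]
      split_ifs with h
      · exact h
      · simp
    have hffn : ∀ n z, f z * fn n z = fn n z ^ 2 := by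
      intro n z
      simp only [hfn]
      split_ifs <;> ring
    have hfnl : ∀ n, MemLp (fn n) 2 (P : Measure Z) := fun n =>
      MemLp.of_bound (hfnm n).aestronglyMeasurable n (ae_of_all _ (hfnb n))
    have hlim : Tendsto (fun n => ∫ z, fn n z ^ 2 ∂(P : Measure Z)) atTop
        (𝓝 (∫ z, f z ^ 2 ∂(P : Measure Z))) := by
      refine tendsto_integral_of_dominated_convergence (fun z => f z ^ 2)
        (fun n => ((hfnm n).pow_const 2).aestronglyMeasurable) hf.integrable_sq ?_ ?_
      · refine fun n => ae_of_all _ fun z => ?_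
        simp only [hfn]
        split_ifs
        · simp
        · simp [sq_nonneg]
      · refine ae_of_all _ fun z => ?_
        refine tendsto_const_nhds.congr' ?_
        obtain ⟨n0, hn0⟩ := exists_nat_ge |f z|
        filter_upwards [eventually_ge_atTop n0] with n hn
        simp only [hfn]
        rw [if_pos (hn0.trans (by exact_mod_cast hn))]
    -- If a truncation vanishes almost surely it gives no admissible score, and `b ≥ 0` must come
    -- from elsewhere. The centred indicator of `A` is a nondegenerate score, which is the role of
    -- `0 < P(A) < 1`.
    have hb0 : 0 ≤ b := by
      set p := (P : Measure Z).real A with hp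
      have hp0 : 0 ≤ p := measureReal_nonneg
      have hp1 : p ≤ 1 := measureReal_le_one
      have hi : Integrable (A.indicator fun _ => (1 : ℝ)) (P : Measure Z) :=
        (integrable_const 1).indicator hA
      have hiA : ∫ z, A.indicator (fun _ => (1 : ℝ)) z ∂(P : Measure Z) = p := by
        simp [integral_indicator_const, hA, hp]
      have hsq : ∀ z, (A.indicator (fun _ => (1 : ℝ)) z - p) ^ 2 =
          (1 - 2 * p) * A.indicator (fun _ => (1 : ℝ)) z + p ^ 2 := by
        intro z
        by_cases hz : z ∈ A <;> simp [hz] <;> ring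
      refine le_trans ?_ (key (fun z => A.indicator (fun _ => (1 : ℝ)) z - p) 2
        ((measurable_const.indicator hA).sub_const p) ?_ ?_ ?_)
      · exact div_nonneg (sq_nonneg _) (integral_nonneg fun _ => sq_nonneg _)
      · intro z
        rw [abs_le]
        by_cases hz : z ∈ A
        · rw [Set.indicator_of_mem hz]; constructor <;> linarith
        · rw [Set.indicator_of_notMem hz]; constructor <;> linarith
      · rw [integral_sub hi (integrable_const _), hiA]
        simp
      · simp_rw [hsq]
        rw [integral_add (hi.const_mul _) (integrable_const _), integral_const_mul, hiA]
        simp only [integral_const, probReal_univ, smul_eq_mul, one_mul]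
        have h1 : 0 < p := lt_of_le_of_ne hp0 (Ne.symm hA0)
        have h2 : p < 1 := lt_of_le_of_ne hp1 hA1
        nlinarith
    refine le_of_tendsto hlim (Eventually.of_forall fun n => ?_)
    set bn := ∫ z, fn n z ^ 2 ∂(P : Measure Z) with hbn
    set mn := ∫ z, fn n z ∂(P : Measure Z) with hmn
    have hbn0 : 0 ≤ bn := integral_nonneg fun _ => sq_nonneg _
    rcases hbn0.eq_or_lt with h | hbpos
    · rw [← h]; exact hb0
    have hfni : Integrable (fn n) (P : Measure Z) := (hfnl n).integrable one_le_two
    have hBs : ∫ z, f z * (fn n z - mn) ∂(P : Measure Z) = bn := by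
      have h1 : ∀ z, f z * (fn n z - mn) = fn n z ^ 2 - mn * f z := fun z => by
        rw [← hffn]; ring
      simp_rw [h1]
      rw [integral_sub (hfnl n).integrable_sq ((hf.integrable one_le_two).const_mul _),
        integral_const_mul, hf0]
      simp [hbn]
    have hDs : ∫ z, (fn n z - mn) ^ 2 ∂(P : Measure Z) = bn - mn ^ 2 := by
      have h1 : ∀ z, (fn n z - mn) ^ 2 = fn n z ^ 2 - 2 * mn * fn n z + mn ^ 2 * 1 := fun z => by ring
      simp_rw [h1]
      rw [integral_sub_add (hfnl n).integrable_sq hfni (integrable_const 1)]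
      simp only [integral_const, probReal_univ, smul_eq_mul, one_mul, ← hmn, ← hbn]
      ring
    have hsl : MemLp (fun z => fn n z - mn) 2 (P : Measure Z) := (hfnl n).sub (memLp_const _)
    -- If the centred truncation vanished almost surely, its inner product with `f`, which equals
    -- `bn > 0`, would be zero.
    have hDpos : 0 < bn - mn ^ 2 := by
      rw [← hDs]
      refine lt_of_le_of_ne (integral_nonneg fun _ => sq_nonneg _) fun h0 => ?_
      have h2 := (integral_eq_zero_iff_of_nonneg (fun _ => sq_nonneg _) hsl.integrable_sq).1 h0.symm
      have h3 : ∫ z, f z * (fn n z - mn) ∂(P : Measure Z) = 0 := by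
        refine integral_eq_zero_of_ae ?_
        filter_upwards [h2] with z hz
        have : fn n z - mn = 0 := by simpa using hz
        simp [this]
      rw [hBs] at h3
      exact hbpos.ne' h3
    have h4 := key (fun z => fn n z - mn) (n + |mn|) ((hfnm n).sub_const _)
      (fun z => (abs_sub _ _).trans (add_le_add (hfnb n z) le_rfl))
      (by rw [integral_sub hfni (integrable_const _)]; simp [hmn])
      (by rw [hDs]; exact hDpos)
    rw [hBs, hDs] at h4
    -- Centring leaves the inner product with the mean-zero `f` at `bn` and can only reduce the
    -- information, so the Cramér–Rao value `bn ^ 2 / (bn - mn ^ 2)` is at least `bn`.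
    refine le_trans ?_ h4
    rw [le_div_iff₀ hDpos]
    nlinarith [sq_nonneg mn]

end EfficiencyBound

/-! ### Pathwise differentiability of the identified functional -/

section Perturbation

variable {m : ℕ} {S : Type*} [MeasurableSpace S]
  {ρ ρ' : Measure (ObsData m S)} {r : ObsData m S → ℝ} {δ : ℝ}

/-- `ρ'` has a density with respect to `ρ` that deviates from one by at most `δ`. -/
structure IsPerturbation (ρ ρ' : Measure (ObsData m S)) (r : ObsData m S → ℝ) (δ : ℝ) : Prop where
  meas : Measurable r
  nonneg : ∀ o, 0 ≤ r o
  abs_sub_one_le : ∀ o, |r o - 1| ≤ δ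
  eq_withDensity : ρ' = ρ.withDensity fun o => ENNReal.ofReal (r o)

lemma IsPerturbation.integral_eq (h : IsPerturbation ρ ρ' r δ) (f : ObsData m S → ℝ) :
    ∫ o, f o ∂ρ' = ∫ o, r o * f o ∂ρ := by
  rw [h.eq_withDensity, integral_withDensity_ofReal h.meas h.nonneg]

lemma IsPerturbation.integrable_mul {E : Type*} [NormedAddCommGroup E] [NormedSpace ℝ E]
    (h : IsPerturbation ρ ρ' r δ) {f : ObsData m S → E}
    (hf : Integrable f ρ) : Integrable (fun o => r o • f o) ρ := by
  refine hf.bdd_smul (1 + δ) h.meas.aestronglyMeasurable (ae_of_all _ fun o => ?_)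
  have h1 := abs_le.1 (h.abs_sub_one_le o)
  rw [Real.norm_eq_abs, abs_of_nonneg (h.nonneg o)]
  linarith [h1.2]

lemma IsPerturbation.integrable {E : Type*} [NormedAddCommGroup E] [NormedSpace ℝ E]
    (h : IsPerturbation ρ ρ' r δ) {f : ObsData m S → E}
    (hf : Integrable f ρ) : Integrable f ρ' := by
  rw [h.eq_withDensity, integrable_withDensity_iff_integrable_smul' h.meas.ennreal_ofReal
    (ae_of_all _ fun _ => ENNReal.ofReal_lt_top)]
  refine (h.integrable_mul hf).congr (ae_of_all _ fun o => ?_)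
  simp [ENNReal.toReal_ofReal (h.nonneg o)]

lemma IsPerturbation.delta_nonneg [IsProbabilityMeasure ρ] (h : IsPerturbation ρ ρ' r δ) : 0 ≤ δ := by
  obtain ⟨o⟩ := nonempty_of_isProbabilityMeasure ρ
  exact (abs_nonneg _).trans (h.abs_sub_one_le o)

lemma IsPerturbation.absolutelyContinuous (h : IsPerturbation ρ ρ' r δ) : ρ' ≪ ρ := by
  rw [h.eq_withDensity]
  exact withDensity_absolutelyContinuous _ _

/-- For `δ ≤ 1 / 2` the density is at least `1 / 2`, so almost-everywhere statements transfer in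
both directions. -/
lemma IsPerturbation.absolutelyContinuous' (h : IsPerturbation ρ ρ' r δ) (hδ : δ ≤ 1 / 2) :
    ρ ≪ ρ' := by
  rw [h.eq_withDensity]
  refine withDensity_absolutelyContinuous' h.meas.ennreal_ofReal.aemeasurable
    (ae_of_all _ fun o => ?_)
  have := (abs_le.1 (h.abs_sub_one_le o)).1
  rw [Ne, ENNReal.ofReal_eq_zero, not_le]
  linarith

/-- Integrals of functions that are centered under `ρ` are of the order of the perturbation. -/
lemma IsPerturbation.abs_integral_le (h : IsPerturbation ρ ρ' r δ) {f : ObsData m S → ℝ}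
    (hf : Integrable f ρ) (h0 : ∫ o, f o ∂ρ = 0) : |∫ o, f o ∂ρ'| ≤ δ * ∫ o, |f o| ∂ρ := by
  have h1 : Integrable (fun o => r o * f o) ρ := h.integrable_mul hf
  have h2 : ∫ o, f o ∂ρ' = ∫ o, (r o - 1) * f o ∂ρ := by
    rw [h.integral_eq, ← sub_zero (∫ o, r o * f o ∂ρ), ← h0, ← integral_sub h1 hf]
    refine integral_congr_ae (ae_of_all _ fun o => ?_)
    simp only
    ring
  rw [h2, ← integral_const_mul]
  refine (norm_integral_le_integral_norm _).trans (integral_mono_of_nonneg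
    (ae_of_all _ fun o => norm_nonneg ((r o - 1) * f o)) (hf.abs.const_mul δ)
    (ae_of_all _ fun o => ?_))
  simp only [norm_mul, Real.norm_eq_abs]
  gcongr
  exact h.abs_sub_one_le o

/-- With `u` the propensity score of one law, the integrand is centred under that law, and its
integral under a second law measures how far the second propensity score has moved. -/
lemma setIntegral_propOf {ρ : Measure (ObsData m S)} [IsProbabilityMeasure ρ] (a : Trt m)
    {C : Set S} (hC : MeasurableSet C) {u : S → ℝ} (hu : Measurable u)
    {B : ℝ} (hB : ∀ x, ‖u x‖ ≤ B) :
    Integrable (fun o : ObsData m S =>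
      C.indicator (fun x => ({a} : Set (Trt m)).indicator 1 o.2.1 - u x) o.2.2) ρ ∧
    ∫ o : ObsData m S, C.indicator (fun x => ({a} : Set (Trt m)).indicator 1 o.2.1 - u x) o.2.2 ∂ρ
      = ∫ x in C, (propOf ρ a x - u x) ∂covLawOf ρ := by
  set h : Trt m → S → ℝ := fun b x =>
    C.indicator (fun x => ({a} : Set (Trt m)).indicator 1 b - u x) x with hh
  have hm : ∀ b, Measurable (h b) := fun b => (measurable_const.sub hu).indicator hC
  have hi : Integrable (fun o : ObsData m S => h o.2.1 o.2.2) ρ := by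
    refine Integrable.of_bound (measurable_comp_trt hm).aestronglyMeasurable (1 + B)
      (ae_of_all _ fun o => ?_)
    refine (norm_indicator_le_norm_self _ _).trans ((norm_sub_le _ _).trans
      (add_le_add ?_ (hB _)))
    exact (norm_indicator_le_norm_self _ _).trans (by simp)
  refine ⟨hi, ?_⟩
  rw [integral_trt hm hi, ← integral_indicator hC]
  refine integral_congr_ae (ae_of_all _ fun x => ?_)
  have hsum : ∑ b, propOf ρ b x = 1 := by
    simp only [propOf]
    rw [sum_measureReal_singleton]
    simp
  by_cases hx : x ∈ C
  · simp only [hh, Set.indicator_of_mem hx, mul_sub, Finset.sum_sub_distrib, ← Finset.sum_mul, hsum,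
      one_mul]
    congr 1
    rw [Finset.sum_eq_single a]
    · simp
    · intro b _ hb
      simp [hb]
    · simp
  · simp [hh, hx]

/-- Propensity scores are compared through integrals over covariate sets `C`. The function `1_C(X)
(1(A = a) - propOf ρ a X)` is centred under `ρ`, so its `ρ'`-integral is at most `δ ρ(X ∈ C)`. Since
the density is at least `1 / 2`, this is at most `2 δ ρ'(X ∈ C)`, and letting `C` vary gives the
pointwise bound. -/
lemma IsPerturbation.abs_propOf_sub_le [IsProbabilityMeasure ρ] [IsProbabilityMeasure ρ']
    (h : IsPerturbation ρ ρ' r δ) (hδ : δ ≤ 1 / 2)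
    (a : Trt m) : ∀ᵐ x ∂covLawOf ρ', |propOf ρ' a x - propOf ρ a x| ≤ 2 * δ := by
  have hδ0 := h.delta_nonneg
  have hb : ∀ x, ‖propOf ρ a x‖ ≤ 1 := fun x => by
    rw [Real.norm_of_nonneg (propOf_nonneg ρ a x)]; exact propOf_le_one ρ a x
  have key : ∀ C : Set S, MeasurableSet C →
      |∫ x in C, (propOf ρ' a x - propOf ρ a x) ∂covLawOf ρ'| ≤
        ∫ _ in C, 2 * δ ∂covLawOf ρ' := by
    intro C hC
    obtain ⟨hi, h1⟩ := setIntegral_propOf (ρ := ρ) a hC (measurable_propOf ρ a) hb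
    obtain ⟨-, h2⟩ := setIntegral_propOf (ρ := ρ') a hC (measurable_propOf ρ a) hb
    simp only [sub_self, integral_zero] at h1
    have hCm : MeasurableSet ((fun o : ObsData m S => o.2.2) ⁻¹' C) := measurable_cov hC
    have h3 : ρ.real ((fun o : ObsData m S => o.2.2) ⁻¹' C) ≤
        2 * ρ'.real ((fun o : ObsData m S => o.2.2) ⁻¹' C) := by
      set D := (fun o : ObsData m S => o.2.2) ⁻¹' C with hD
      have e1 : ∫ o, D.indicator (fun _ => (1 : ℝ)) o ∂ρ = ρ.real D := by
        simp [integral_indicator_const, hCm]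
      have e2 : ∫ o, D.indicator (fun _ => (1 : ℝ)) o ∂ρ' = ρ'.real D := by
        simp [integral_indicator_const, hCm]
      have hiD : Integrable (D.indicator (fun _ => (1 : ℝ))) ρ :=
        (integrable_const 1).indicator hCm
      rw [← e1, ← e2, h.integral_eq, ← integral_const_mul]
      refine integral_mono hiD ((h.integrable_mul hiD).const_mul 2) fun o => ?_
      have hr := (abs_le.1 (h.abs_sub_one_le o)).1
      by_cases ho : o ∈ D
      · simp only [Set.indicator_of_mem ho, mul_one]; linarith
      · simp [Set.indicator_of_notMem ho]
    have hcl : (covLawOf ρ').real C = ρ'.real ((fun o : ObsData m S => o.2.2) ⁻¹' C) := by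
      rw [covLawOf, measureReal_def, Measure.map_apply measurable_cov hC, measureReal_def]
    have h4 : ∫ _ in C, 2 * δ ∂covLawOf ρ' =
        2 * δ * ρ'.real ((fun o : ObsData m S => o.2.2) ⁻¹' C) := by
      rw [setIntegral_const, hcl, smul_eq_mul, mul_comm]
    rw [h4, ← h2]
    refine (h.abs_integral_le hi h1).trans ?_
    have h5 : ∫ o : ObsData m S, |C.indicator (fun x => ({a} : Set (Trt m)).indicator 1 o.2.1 -
        propOf ρ a x) o.2.2| ∂ρ ≤ ρ.real ((fun o : ObsData m S => o.2.2) ⁻¹' C) := by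
      rw [show ρ.real ((fun o : ObsData m S => o.2.2) ⁻¹' C) =
        ∫ o, ((fun o : ObsData m S => o.2.2) ⁻¹' C).indicator (fun _ => (1 : ℝ)) o ∂ρ by
        simp [integral_indicator_const, hCm]]
      refine integral_mono hi.abs ((integrable_const 1).indicator hCm) fun o => ?_
      by_cases ho : o.2.2 ∈ C
      · have hmem : o ∈ (fun o : ObsData m S => o.2.2) ⁻¹' C := ho
        simp only [Set.indicator_of_mem ho, Set.indicator_of_mem hmem]
        have e0 := propOf_nonneg ρ a o.2.2
        have e1 := propOf_le_one ρ a o.2.2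
        rw [abs_le]
        by_cases hoa : o.2.1 = a
        · simp only [hoa, Set.mem_singleton_iff, Set.indicator_of_mem, Pi.one_apply]
          constructor <;> linarith
        · simp only [Set.mem_singleton_iff, hoa, not_false_eq_true, Set.indicator_of_notMem]
          constructor <;> linarith
      · have hmem : o ∉ (fun o : ObsData m S => o.2.2) ⁻¹' C := ho
        simp only [Set.indicator_of_notMem ho, Set.indicator_of_notMem hmem, abs_zero, le_refl]
    calc _ ≤ δ * (2 * ρ'.real ((fun o : ObsData m S => o.2.2) ⁻¹' C)) := by
          gcongr
          exact h5.trans h3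
      _ = _ := by ring
  have hint : Integrable (fun x => propOf ρ' a x - propOf ρ a x) (covLawOf ρ') :=
    Integrable.of_bound ((measurable_propOf ρ' a).sub (measurable_propOf ρ a)).aestronglyMeasurable
      2 (ae_of_all _ fun x => (norm_sub_le _ _).trans (by
        have := hb x
        have h2 : ‖propOf ρ' a x‖ ≤ 1 := by
          rw [Real.norm_of_nonneg (propOf_nonneg ρ' a x)]; exact propOf_le_one ρ' a x
        linarith))
  have hle := ae_le_of_forall_setIntegral_le hint (integrable_const (2 * δ))
    fun C hC _ => (le_abs_self _).trans (key C hC)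
  have hge := ae_le_of_forall_setIntegral_le hint.neg (integrable_const (2 * δ))
    fun C hC _ => by
      simp only [Pi.neg_apply]
      rw [integral_neg]
      exact (neg_le_abs _).trans (key C hC)
  filter_upwards [hle, hge] with x h1 h2
  rw [abs_le]
  simp only [Pi.neg_apply] at h2
  constructor <;> linarith

/-- The identified functional is linear in the law up to a quadratic error. -/
lemma exists_abs_theta_sub_integral_phiOf_le [IsProbabilityMeasure ρ]
    (hY : Integrable (fun o : ObsData m S => o.1) ρ)
    {w : Trt m → S → Outc m} {Cw c C : ℝ} (hw : IsWeight w Cw) (hc : 0 < c)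
    (hn : IsNuisance (covLawOf ρ) (propOf ρ) (regOf ρ) c C) :
    ∃ B, 0 ≤ B ∧ ∀ (ρ' : Measure (ObsData m S)) [IsProbabilityMeasure ρ'] (r : ObsData m S → ℝ)
      (δ : ℝ), IsPerturbation ρ ρ' r δ → δ ≤ 1 / 2 → δ ≤ c / 4 →
      Integrable (phiOf w (propOf ρ) (regOf ρ)) ρ' ∧
      |∑ a, ∫ x, inner ℝ (w a x) (regOf ρ' a x) ∂covLawOf ρ' -
        ∫ o, phiOf w (propOf ρ) (regOf ρ) o ∂ρ'| ≤ B * δ ^ 2 := by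
  have hCw : 0 ≤ Cw := by
    obtain ⟨x⟩ := nonempty_of_isProbabilityMeasure (covLawOf ρ)
    exact hw.nonneg_bound x
  have hregi : Integrable (fun o : ObsData m S => regOf ρ o.2.1 o.2.2) ρ :=
    (integral_inner_outcome (h := fun _ _ => 0) (fun _ => measurable_const) hY
      (C := 0) (by simp)).2.1
  have hres : Integrable (fun o : ObsData m S => o.1 - regOf ρ o.2.1 o.2.2) ρ := hY.sub hregi
  refine ⟨4 * Cw / c ^ 2 * ∫ o : ObsData m S, ‖o.1 - regOf ρ o.2.1 o.2.2‖ ∂ρ,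
    mul_nonneg (by positivity) (integral_nonneg fun _ => norm_nonneg _),
    fun ρ' _ r δ h hδ hδc => ?_⟩
  have hδ0 := h.delta_nonneg
  have hac : covLawOf ρ' ≪ covLawOf ρ := h.absolutelyContinuous.map measurable_cov
  have hac' : covLawOf ρ ≪ covLawOf ρ' := (h.absolutelyContinuous' hδ).map measurable_cov
  have hdiff := h.abs_propOf_sub_le hδ
  have hY' : Integrable (fun o : ObsData m S => o.1) ρ' := h.integrable hY
  have hYp' : MemLp (fun o : ObsData m S => o.1) 1 ρ' := memLp_one_iff_integrable.2 hY'
  -- The propensity score moves by at most `2 * δ ≤ c / 2`.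
  have hlow : ∀ a, ∀ᵐ x ∂covLawOf ρ', c / 2 ≤ propOf ρ' a x := by
    intro a
    filter_upwards [hdiff a, hac.ae_le (hn.le_e a)] with x h1 h2
    linarith [(abs_le.1 h1).1]
  -- The mixed pair: propensity score of `ρ'`, regression of `ρ`. Because the propensity score is
  -- the right one for `ρ'`, the `ρ'`-mean of this score is the functional at `ρ'` whatever the
  -- regression is.
  have hn' : IsNuisance (covLawOf ρ') (propOf ρ') (regOf ρ) (c / 2) C :=
    ⟨measurable_propOf ρ', hn.meas_g, hlow, fun a => ae_of_all _ fun x => by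
      rw [Real.norm_of_nonneg (propOf_nonneg ρ' a x)]; exact propOf_le_one ρ' a x,
      fun a => hac.ae_le (hn.norm_g_le a)⟩
  have hn'' : IsNuisance (covLawOf ρ') (propOf ρ) (regOf ρ) c C :=
    ⟨hn.meas_e, hn.meas_g, fun a => hac.ae_le (hn.le_e a), fun a => hac.ae_le (hn.norm_e_le a),
      fun a => hac.ae_le (hn.norm_g_le a)⟩
  have hi1 : Integrable (phiOf w (propOf ρ') (regOf ρ)) ρ' :=
    memLp_one_iff_integrable.1 (memLp_phiOf hYp' hw (half_pos hc) hn')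
  have hi2 : Integrable (phiOf w (propOf ρ) (regOf ρ)) ρ' :=
    memLp_one_iff_integrable.1 (memLp_phiOf hYp' hw hc hn'')
  refine ⟨hi2, ?_⟩
  have hid := (integral_phiOf hY' hw (half_pos hc) hn' (half_pos hc) hlow).2
  have hz : ∀ a, ∀ᵐ x ∂covLawOf ρ', (inner ℝ (w a x) (regOf ρ a x - regOf ρ' a x) : ℝ) *
      (1 - propOf ρ' a x / propOf ρ' a x) = 0 := by
    intro a
    filter_upwards [hlow a] with x hx
    have hne : propOf ρ' a x ≠ 0 := ((half_pos hc).trans_le hx).ne'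
    rw [div_self hne, sub_self, mul_zero]
  rw [Finset.sum_congr rfl fun a _ => integral_eq_zero_of_ae (hz a), Finset.sum_const_zero,
    add_zero] at hid
  rw [← hid, ← integral_sub hi1 hi2]
  -- The two scores share the regression, so their difference is the residual of `ρ` weighted by
  -- `h'`. The weight is `O(δ)`: the numerator is at most `2 δ` and the denominators are at least `c
  -- / 2` and `c`, whence `4 * Cw / c ^ 2`.
  set h' : Trt m → S → Outc m := fun a x => (1 / propOf ρ' a x - 1 / propOf ρ a x) • w a x with hh'
  have hm' : ∀ a, Measurable (h' a) := fun a =>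
    (((measurable_propOf ρ' a).const_div 1).sub ((measurable_propOf ρ a).const_div 1)).smul
      (hw.meas a)
  have hbd : ∀ᵐ o ∂ρ, ‖h' o.2.1 o.2.2‖ ≤ 4 * Cw / c ^ 2 * δ := by
    filter_upwards [ae_trt fun a => hac'.ae_le (hdiff a), ae_trt fun a => hac'.ae_le (hlow a),
      ae_trt hn.le_e] with o h1 h2 h3
    have p1 : 0 < propOf ρ' o.2.1 o.2.2 := (half_pos hc).trans_le (h2 _)
    have p2 : 0 < propOf ρ o.2.1 o.2.2 := hc.trans_le (h3 _)
    have e1 : 1 / propOf ρ' o.2.1 o.2.2 - 1 / propOf ρ o.2.1 o.2.2 =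
        -(propOf ρ' o.2.1 o.2.2 - propOf ρ o.2.1 o.2.2) /
          (propOf ρ' o.2.1 o.2.2 * propOf ρ o.2.1 o.2.2) := by
      field_simp
      ring
    rw [hh', norm_smul, e1, norm_div, norm_neg, Real.norm_of_nonneg (mul_pos p1 p2).le,
      Real.norm_eq_abs]
    calc _ ≤ (2 * δ) / (c / 2 * c) * Cw := by
          gcongr
          · exact h1 _
          · exact h2 _
          · exact h3 _
          · exact hw.norm_le _ _
      _ = _ := by field_simp; ring
  obtain ⟨j1, -, j2, j3⟩ := integral_inner_outcome hm' hY hbd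
  have hrem : ∀ o : ObsData m S, phiOf w (propOf ρ') (regOf ρ) o - phiOf w (propOf ρ) (regOf ρ) o =
      inner ℝ (h' o.2.1 o.2.2) o.1 - inner ℝ (h' o.2.1 o.2.2) (regOf ρ o.2.1 o.2.2) := by
    intro o
    simp only [phiOf, hh', real_inner_smul_left, inner_sub_right]
    ring
  simp_rw [hrem]
  -- The weighted residual is centred under `ρ`, so integrating it under `ρ'` contributes a second
  -- factor `δ`; this makes the error quadratic.
  refine (h.abs_integral_le (j1.sub j2) ?_).trans ?_
  · simp only [Pi.sub_apply]
    rw [integral_sub j1 j2, j3, sub_self]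
  · have h6 : ∫ o : ObsData m S, |(inner ℝ (h' o.2.1 o.2.2) o.1 : ℝ) -
        inner ℝ (h' o.2.1 o.2.2) (regOf ρ o.2.1 o.2.2)| ∂ρ ≤
        ∫ o : ObsData m S, 4 * Cw / c ^ 2 * δ * ‖o.1 - regOf ρ o.2.1 o.2.2‖ ∂ρ := by
      refine integral_mono_of_nonneg (ae_of_all _ fun _ => abs_nonneg _)
        (hres.norm.const_mul _) ?_
      filter_upwards [hbd] with o ho
      rw [← inner_sub_right]
      refine (abs_real_inner_le_norm _ _).trans ?_
      gcongr
    rw [integral_const_mul] at h6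
    calc _ ≤ δ * (4 * Cw / c ^ 2 * δ * ∫ o : ObsData m S, ‖o.1 - regOf ρ o.2.1 o.2.2‖ ∂ρ) := by
          gcongr
          exact h6
      _ = _ := by ring

end Perturbation

/-! ### The influence function of an observed-data law -/

section Gradient

variable {K : ℕ} {M : Fin K → ℕ} {S : Fin K → Type*} [∀ k, MeasurableSpace (S k)]

/-- Regularity of an observed-data law: all types occur, weights and nuisance functions are bounded,
and the conditional variance of the outcome is bounded. -/
structure IsRegularLaw (P : Measure (ObsCluster M S)) [IsProbabilityMeasure P]
    (w : ∀ k, Trt (M k) → S k → Outc (M k)) (Cw c C V : ℝ) : Prop where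
  pos : ∀ k, 0 < typeProb P k
  weight : ∀ k, IsWeight (w k) Cw
  overlap_pos : 0 < c
  nuisance : ∀ k, IsNuisance (covLaw P k) (propensity P k) (outcomeReg P k) c C
  var_nonneg : 0 ≤ V
  var_le : ∀ k a, ∀ᵐ x ∂covLaw P k,
    ∫⁻ y, ‖y - outcomeReg P k a x‖ₑ ^ 2 ∂outcomeLaw P k a x ≤ ENNReal.ofReal V

/-- `θ_k` as a functional of the observed-data law. -/
def thetaObs (w : ∀ k, Trt (M k) → S k → Outc (M k)) (P : Measure (ObsCluster M S))
    [IsFiniteMeasure P] (k : Fin K) : ℝ :=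
  ∑ a : Trt (M k), ∫ x, inner ℝ (w k a x) (outcomeReg P k a x) ∂(covLaw P k)

/-- The influence function of an observed-data law. -/
def inflObs (w : ∀ k, Trt (M k) → S k → Outc (M k)) (v : Fin K → ℝ → ℝ)
    (P : Measure (ObsCluster M S)) [IsFiniteMeasure P] (z : ObsCluster M S) : ℝ :=
  ∑ k, v k (typeProb P k) *
      (typeInd k z * (phi w (propensity P) (outcomeReg P) k z - thetaObs w P k) / typeProb P k)
    + ∑ k, (typeInd k z - typeProb P k) * deriv (v k) (typeProb P k) * thetaObs w P k

section Score

variable {K : ℕ} {M : Fin K → ℕ} {S : Fin K → Type*}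
  (w : ∀ k, Trt (M k) → S k → Outc (M k)) (e : ∀ k, Trt (M k) → S k → ℝ)
  (g : ∀ k, Trt (M k) → S k → Outc (M k))

lemma phi_mk_same (k : Fin K) (o : ObsData (M k) (S k)) :
    phi w e g k ⟨k, o⟩ = phiOf (w k) (e k) (g k) o := by
  obtain ⟨y, a, x⟩ := o
  simp [phi, phiOf]

lemma phi_mk_of_ne {k l : Fin K} (h : l ≠ k) (o : ObsData (M l) (S l)) :
    phi w e g k ⟨l, o⟩ = 0 := by
  obtain ⟨y, a, x⟩ := o
  simp [phi, h]

lemma typeInd_mul_phi (k : Fin K) (z : ObsCluster M S) :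
    typeInd k z * phi w e g k z = phi w e g k z := by
  obtain ⟨l, o⟩ := z
  by_cases h : l = k
  · simp [typeInd, h]
  · simp [typeInd, h, phi_mk_of_ne]

lemma typeInd_nonneg (k : Fin K) (z : ObsCluster M S) : 0 ≤ typeInd k z := by
  unfold typeInd; split_ifs <;> simp

lemma typeInd_le_one (k : Fin K) (z : ObsCluster M S) : typeInd k z ≤ 1 := by
  unfold typeInd; split_ifs <;> simp

end Score

lemma measurable_typeInd (k : Fin K) : Measurable (typeInd (M := M) (S := S) k) :=
  measurable_sigma fun l =>
    (measurable_const : Measurable fun _ : ObsData (M l) (S l) => if l = k then (1 : ℝ) else 0)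

lemma measurable_phi {w : ∀ k, Trt (M k) → S k → Outc (M k)} {e : ∀ k, Trt (M k) → S k → ℝ}
    {g : ∀ k, Trt (M k) → S k → Outc (M k)} (hw : ∀ k a, Measurable (w k a))
    (he : ∀ k a, Measurable (e k a)) (hg : ∀ k a, Measurable (g k a)) (k : Fin K) :
    Measurable (phi w e g k) := by
  refine measurable_sigma fun l => ?_
  by_cases h : l = k
  · subst h
    simp_rw [phi_mk_same]
    exact measurable_phiOf (hw l) (he l) (hg l)
  · simp_rw [phi_mk_of_ne w e g h]
    exact measurable_const

lemma memLp_sigma {K : ℕ} {D : Fin K → Type*} [∀ k, MeasurableSpace (D k)]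
    {Q : Measure (Σ k, D k)} [IsFiniteMeasure Q] {f : (Σ k, D k) → ℝ} (hf : Measurable f)
    (h : ∀ k, 0 < typeProb Q k → MemLp (fun d => f ⟨k, d⟩) 2 (typeLaw Q k)) : MemLp f 2 Q := by
  rw [memLp_two_iff_integrable_sq hf.aestronglyMeasurable, integrable_sigma_iff]
  exact fun k hk => (h k hk).integrable_sq

lemma integral_typeInd (P : Measure (ObsCluster M S)) (k : Fin K) : ∫ z, typeInd k z ∂P = typeProb P k := by
  have h : ∀ z : ObsCluster M S, typeInd k z = (Sigma.fst ⁻¹' {k}).indicator (fun _ => (1 : ℝ)) z := by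
    intro z
    by_cases hz : z.1 = k <;> simp [typeInd, Set.indicator, hz]
  simp_rw [h]
  rw [integral_indicator_const _ (measurable_sigmaFst (measurableSet_singleton k)), smul_eq_mul,
    mul_one, typeProb]

variable {P : Measure (ObsCluster M S)} [IsProbabilityMeasure P]
  {w : ∀ k, Trt (M k) → S k → Outc (M k)} {v : Fin K → ℝ → ℝ} {Cw c C V : ℝ}

lemma integrable_typeInd (k : Fin K) : Integrable (typeInd k) P :=
  Integrable.of_bound (measurable_typeInd k).aestronglyMeasurable 1 (ae_of_all _ fun z => by
    rw [Real.norm_of_nonneg (typeInd_nonneg k z)]; exact typeInd_le_one k z)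

lemma integral_phi {e : ∀ k, Trt (M k) → S k → ℝ} {g : ∀ k, Trt (M k) → S k → Outc (M k)}
    {k : Fin K} (hk : Integrable (phiOf (w k) (e k) (g k)) (typeLaw P k)) :
    Integrable (phi w e g k) P ∧
    ∫ z, phi w e g k z ∂P = typeProb P k * ∫ o, phiOf (w k) (e k) (g k) o ∂typeLaw P k := by
  have hi : Integrable (phi w e g k) P := by
    rw [integrable_sigma_iff]
    intro l hl
    by_cases h : l = k
    · subst h
      simp_rw [phi_mk_same]
      exact hk
    · simp_rw [phi_mk_of_ne w e g h]
      exact integrable_zero _ _ _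
  refine ⟨hi, ?_⟩
  rw [integral_sigma P hi, Finset.sum_eq_single k]
  · simp_rw [phi_mk_same]
    rfl
  · intro l _ h
    simp_rw [phi_mk_of_ne w e g h]
    simp
  · simp

namespace IsRegularLaw

lemma isProbabilityMeasure (h : IsRegularLaw P w Cw c C V) (k : Fin K) : IsProbabilityMeasure (typeLaw P k) :=
  isProbabilityMeasure_typeLaw P (h.pos k)

lemma memLp_outcome (h : IsRegularLaw P w Cw c C V) (k : Fin K) :
    MemLp (fun o : ObsData (M k) (S k) => o.1) 2 (typeLaw P k) := by
  have := h.isProbabilityMeasure k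
  exact PartialInterference.memLp_outcome (ENNReal.ofReal_ne_top) (h.var_le k)
    (h.nuisance k).norm_g_le

lemma measurable_phi (h : IsRegularLaw P w Cw c C V) (k : Fin K) :
    Measurable (phi w (propensity P) (outcomeReg P) k) :=
  PartialInterference.measurable_phi (fun k => (h.weight k).meas) (fun k => (h.nuisance k).meas_e)
    (fun k => (h.nuisance k).meas_g) k

lemma memLp_phi (h : IsRegularLaw P w Cw c C V) (k : Fin K) :
    MemLp (phi w (propensity P) (outcomeReg P) k) 2 P := by
  refine memLp_sigma (h.measurable_phi k) fun l _ => ?_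
  by_cases hlk : l = k
  · subst hlk
    have := h.isProbabilityMeasure l
    simp_rw [phi_mk_same]
    exact memLp_phiOf (h.memLp_outcome l) (h.weight l) h.overlap_pos (h.nuisance l)
  · simp_rw [phi_mk_of_ne _ _ _ hlk]
    exact MemLp.zero

/-- Double robustness at the true regression: the correction vanishes since its factor `g - regOf`
is zero. -/
lemma integral_phiOf_eq (h : IsRegularLaw P w Cw c C V) (k : Fin K) :
    ∫ o, phiOf (w k) (propensity P k) (outcomeReg P k) o ∂typeLaw P k = thetaObs w P k := by
  have := h.isProbabilityMeasure k
  have h1 := (integral_phiOf ((h.memLp_outcome k).integrable one_le_two) (h.weight k)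
    h.overlap_pos (h.nuisance k) h.overlap_pos (h.nuisance k).le_e).2
  refine h1.trans (add_eq_left.2 ?_)
  refine Finset.sum_eq_zero fun a _ => ?_
  have : ∀ x, outcomeReg P k a x - regOf (typeLaw P k) a x = 0 := fun x => sub_self _
  simp [this]

lemma integral_phi_eq (h : IsRegularLaw P w Cw c C V) (k : Fin K) :
    ∫ z, phi w (propensity P) (outcomeReg P) k z ∂P = typeProb P k * thetaObs w P k := by
  have := h.isProbabilityMeasure k
  rw [← h.integral_phiOf_eq k]
  exact (integral_phi (memLp_one_iff_integrable.1 (memLp_phiOf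
    ((h.memLp_outcome k).mono_exponent one_le_two) (h.weight k) h.overlap_pos (h.nuisance k)))).2

lemma measurable_inflObs (h : IsRegularLaw P w Cw c C V) : Measurable (inflObs w v P) := by
  unfold inflObs
  refine Measurable.add (Finset.measurable_fun_sum _ fun k _ => ?_)
    (Finset.measurable_fun_sum _ fun k _ => ?_)
  · exact (((measurable_typeInd k).mul ((h.measurable_phi k).sub_const _)).div_const _).const_mul _
  · exact (((measurable_typeInd k).sub_const _).mul_const _).mul_const _

/-- Written as an affine combination of the scores and the type indicators, the influence function
can be integrated, averaged over the sample and compared with its estimate term by term. -/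
lemma _root_.PartialInterference.inflObs_eq (z : ObsCluster M S) : inflObs w v P z =
    ∑ k, ((v k (typeProb P k) / typeProb P k) * phi w (propensity P) (outcomeReg P) k z +
      (deriv (v k) (typeProb P k) * thetaObs w P k -
        v k (typeProb P k) / typeProb P k * thetaObs w P k) * typeInd k z -
      typeProb P k * deriv (v k) (typeProb P k) * thetaObs w P k) := by
  rw [inflObs, ← Finset.sum_add_distrib]
  refine Finset.sum_congr rfl fun k _ => ?_
  rw [mul_sub, typeInd_mul_phi]
  ring

lemma memLp_inflObs (h : IsRegularLaw P w Cw c C V) : MemLp (inflObs w v P) 2 P := by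
  have heq : inflObs w v P = fun z => ∑ k, ((v k (typeProb P k) / typeProb P k) *
      phi w (propensity P) (outcomeReg P) k z +
      (deriv (v k) (typeProb P k) * thetaObs w P k -
        v k (typeProb P k) / typeProb P k * thetaObs w P k) * typeInd k z -
      typeProb P k * deriv (v k) (typeProb P k) * thetaObs w P k) := funext inflObs_eq
  rw [heq]
  refine memLp_finsetSum _ fun k _ => ?_
  have h1 : MemLp (typeInd (M := M) (S := S) k) 2 P :=
    MemLp.of_bound (measurable_typeInd k).aestronglyMeasurable 1 (ae_of_all _ fun z => by
      rw [Real.norm_of_nonneg (typeInd_nonneg k z)]; exact typeInd_le_one k z)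
  exact (((h.memLp_phi k).const_mul _).add (h1.const_mul _)).sub (memLp_const _)

/-- The covariance of the influence function with a bounded function. -/
lemma integral_inflObs_mul (h : IsRegularLaw P w Cw c C V) {s : ObsCluster M S → ℝ}
    (hs : Measurable s) {B : ℝ} (hB : ∀ᵐ z ∂P, ‖s z‖ ≤ B) :
    ∫ z, inflObs w v P z * s z ∂P =
    ∑ k, (v k (typeProb P k) / typeProb P k *
        ∫ z, phi w (propensity P) (outcomeReg P) k z * s z ∂P
      - typeProb P k * deriv (v k) (typeProb P k) * thetaObs w P k * ∫ z, s z ∂P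
      + (deriv (v k) (typeProb P k) * thetaObs w P k -
        v k (typeProb P k) / typeProb P k * thetaObs w P k) * ∫ z, typeInd k z * s z ∂P) := by
  have h1 : ∀ k, Integrable (fun z => v k (typeProb P k) / typeProb P k *
      (phi w (propensity P) (outcomeReg P) k z * s z)) P := fun k =>
    (((h.memLp_phi k).integrable one_le_two).mul_bdd hs.aestronglyMeasurable hB).const_mul _
  have h2 : ∀ k, Integrable (fun z => typeInd k z * s z) P := fun k =>
    (integrable_typeInd k).mul_bdd hs.aestronglyMeasurable hB
  have h3 : Integrable s P := Integrable.of_bound hs.aestronglyMeasurable B hB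
  have heq : ∀ z, inflObs w v P z * s z = ∑ k, (v k (typeProb P k) / typeProb P k *
      (phi w (propensity P) (outcomeReg P) k z * s z)
      - typeProb P k * deriv (v k) (typeProb P k) * thetaObs w P k * s z
      + (deriv (v k) (typeProb P k) * thetaObs w P k -
        v k (typeProb P k) / typeProb P k * thetaObs w P k) * (typeInd k z * s z)) := by
    intro z
    rw [inflObs_eq, Finset.sum_mul]
    exact Finset.sum_congr rfl fun k _ => by ring
  simp_rw [heq]
  have h4 : ∀ k, Integrable (fun z => v k (typeProb P k) / typeProb P k *
      (phi w (propensity P) (outcomeReg P) k z * s z)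
      - typeProb P k * deriv (v k) (typeProb P k) * thetaObs w P k * s z
      + (deriv (v k) (typeProb P k) * thetaObs w P k -
        v k (typeProb P k) / typeProb P k * thetaObs w P k) * (typeInd k z * s z)) P :=
    fun k => ((h1 k).sub (h3.const_mul _)).add ((h2 k).const_mul _)
  rw [integral_finsetSum _ fun k _ => h4 k]
  refine Finset.sum_congr rfl fun k _ => ?_
  rw [integral_sub_add (h1 k) h3 (h2 k), integral_const_mul]

lemma integral_inflObs (h : IsRegularLaw P w Cw c C V) : ∫ z, inflObs w v P z ∂P = 0 := by
  have h1 := h.integral_inflObs_mul (v := v) (s := fun _ => 1) measurable_const (B := 1) (by simp)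
  simp only [mul_one, integral_const, probReal_univ, smul_eq_mul, h.integral_phi_eq,
    integral_typeInd] at h1
  rw [h1]
  refine Finset.sum_eq_zero fun k _ => ?_
  have := (h.pos k).ne'
  field_simp
  ring

end IsRegularLaw

/-! ### Differentiating the functional along a submodel -/

section Submodel

/-- The conditional law given the type of a law with a density. -/
lemma typeLaw_withDensity {K : ℕ} {D : Fin K → Type*} [∀ k, MeasurableSpace (D k)]
    {P Q : Measure (Σ k, D k)} [IsFiniteMeasure P] [IsFiniteMeasure Q] {r : (Σ k, D k) → ℝ}
    (hr : Measurable r) (hr0 : ∀ z, 0 ≤ r z)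
    (hQ : Q = P.withDensity fun z => ENNReal.ofReal (r z)) {k : Fin K} (hk : 0 < typeProb Q k) :
    typeLaw Q k = (typeLaw P k).withDensity fun d =>
      ENNReal.ofReal (r ⟨k, d⟩ * (typeProb P k / typeProb Q k)) := by
  have hrk : Measurable fun d => r ⟨k, d⟩ := hr.comp (measurable_sigmaMk k)
  ext s hs
  have h1 := congrArg (fun m : Measure (D k) => m s) (smul_typeLaw Q k)
  simp only [Measure.smul_apply, smul_eq_mul, (measurableEmbedding_sigmaMk k).comap_apply] at h1
  have hne : ENNReal.ofReal (typeProb Q k) ≠ 0 := by simpa using hk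
  have h2 : typeLaw Q k s = (ENNReal.ofReal (typeProb Q k))⁻¹ * Q (Sigma.mk k '' s) := by
    rw [← h1, ← mul_assoc, ENNReal.inv_mul_cancel hne ENNReal.ofReal_ne_top, one_mul]
  have hsm : MeasurableSet (Sigma.mk k '' s) :=
    (measurableEmbedding_sigmaMk k).measurableSet_image.2 hs
  have h3 : Q (Sigma.mk k '' s) =
      ENNReal.ofReal (typeProb P k) * ∫⁻ d in s, ENNReal.ofReal (r ⟨k, d⟩) ∂typeLaw P k := by
    have h4 := (measurableEmbedding_sigmaMk k).restrict_map (P.comap (Sigma.mk k))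
      (Sigma.mk k '' s)
    rw [(measurableEmbedding_sigmaMk k).map_comap, Measure.restrict_restrict hsm,
      Set.inter_eq_left.2 (Set.image_subset_range _ _),
      Set.preimage_image_eq _ sigma_mk_injective] at h4
    rw [hQ, withDensity_apply _ hsm, h4, (measurableEmbedding_sigmaMk k).lintegral_map,
      ← smul_typeLaw, Measure.restrict_smul, lintegral_smul_measure, smul_eq_mul]
  rw [h2, h3, withDensity_apply _ hs]
  simp_rw [ENNReal.ofReal_mul (hr0 _)]
  rw [lintegral_mul_const _ hrk.ennreal_ofReal, ENNReal.ofReal_div_of_pos hk, div_eq_mul_inv]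
  ring

/-- Conditioning on the type rescales the density by `p / q`, where `q` lies between `(1 - δ) p` and
`(1 + δ) p`. The rescaled density then deviates from one by at most `2 δ / (1 - δ)`, which is at
most `4 δ` for `δ ≤ 1 / 2`. -/
lemma isPerturbation_typeLaw {P Q : Measure (ObsCluster M S)} [IsProbabilityMeasure P]
    [IsProbabilityMeasure Q] {r : ObsCluster M S → ℝ} (hr : Measurable r) (hr0 : ∀ z, 0 ≤ r z)
    {δ : ℝ} (hδ : ∀ z, |r z - 1| ≤ δ) (hδ2 : δ ≤ 1 / 2)
    (hQ : Q = P.withDensity fun z => ENNReal.ofReal (r z)) {k : Fin K} (hk : 0 < typeProb P k) :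
    0 < typeProb Q k ∧ IsPerturbation (typeLaw P k) (typeLaw Q k)
      (fun d => r ⟨k, d⟩ * (typeProb P k / typeProb Q k)) (4 * δ) := by
  set p := typeProb P k with hp
  set q := typeProb Q k with hq
  have hpi : q = ∫ z, r z * typeInd k z ∂P := by
    rw [hq, ← integral_typeInd, hQ, integral_withDensity_ofReal hr hr0]
  have hri : Integrable (fun z => r z * typeInd k z) P := by
    refine (integrable_typeInd k).bdd_mul hr.aestronglyMeasurable (c := 1 + δ)
      (ae_of_all _ fun z => ?_)
    rw [Real.norm_eq_abs, abs_of_nonneg (hr0 z)]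
    linarith [(abs_le.1 (hδ z)).2]
  have hlow : (1 - δ) * p ≤ q := by
    rw [hpi, hp, ← integral_typeInd, ← integral_const_mul]
    refine integral_mono ((integrable_typeInd k).const_mul _) hri fun z => ?_
    exact mul_le_mul_of_nonneg_right (by linarith [(abs_le.1 (hδ z)).1]) (typeInd_nonneg k z)
  have hup : q ≤ (1 + δ) * p := by
    rw [hpi, hp, ← integral_typeInd, ← integral_const_mul]
    refine integral_mono hri ((integrable_typeInd k).const_mul _) fun z => ?_
    exact mul_le_mul_of_nonneg_right (by linarith [(abs_le.1 (hδ z)).2]) (typeInd_nonneg k z)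
  have hq0 : 0 < q := by nlinarith
  refine ⟨hq0, (hr.comp (measurable_sigmaMk k)).mul_const _,
    fun d => mul_nonneg (hr0 _) (div_nonneg hk.le hq0.le), fun d => ?_,
    typeLaw_withDensity hr hr0 hQ hq0⟩
  have h1 := abs_le.1 (hδ ⟨k, d⟩)
  have hδ0 : 0 ≤ δ := (abs_nonneg _).trans (hδ ⟨k, d⟩)
  rw [abs_le, neg_le_sub_iff_le_add, sub_le_iff_le_add, ← mul_div_assoc, ← sub_le_iff_le_add,
    le_div_iff₀ hq0, div_le_iff₀ hq0]
  constructor <;> nlinarith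

/-- The identified mean is a ratio of integrals up to a quadratic error. -/
lemma IsRegularLaw.exists_abs_thetaObs_sub_le {P : Measure (ObsCluster M S)}
    [IsProbabilityMeasure P] {w : ∀ k, Trt (M k) → S k → Outc (M k)} {Cw c C V : ℝ}
    (h : IsRegularLaw P w Cw c C V) (k : Fin K) :
    ∃ D, ∀ (Q : Measure (ObsCluster M S)) [IsProbabilityMeasure Q] (r : ObsCluster M S → ℝ)
      (δ : ℝ), Measurable r → (∀ z, 0 ≤ r z) → (∀ z, |r z - 1| ≤ δ) →
      4 * δ ≤ min (1 / 2) (c / 4) → Q = P.withDensity (fun z => ENNReal.ofReal (r z)) →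
      |thetaObs w Q k - (∫ z, phi w (propensity P) (outcomeReg P) k z ∂Q) / typeProb Q k| ≤
        D * δ ^ 2 := by
  have := h.isProbabilityMeasure k
  obtain ⟨D, hD0, hD⟩ := exists_abs_theta_sub_integral_phiOf_le
    ((h.memLp_outcome k).integrable one_le_two) (h.weight k) h.overlap_pos (h.nuisance k)
  -- The law given the type is perturbed by `4 * δ`, whose square gives the factor `16`.
  refine ⟨D * 16, fun Q _ r δ hr hr0 hδ hδ4 hQ => ?_⟩
  have h12 := hδ4.trans (min_le_left _ _)
  have hc4 := hδ4.trans (min_le_right _ _)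
  obtain ⟨z⟩ := nonempty_of_isProbabilityMeasure P
  have hδ0 : 0 ≤ δ := (abs_nonneg _).trans (hδ z)
  obtain ⟨hq0, hper⟩ := isPerturbation_typeLaw (k := k) hr hr0 hδ (by linarith) hQ (h.pos k)
  have := isProbabilityMeasure_typeLaw Q hq0
  obtain ⟨hi, hle⟩ := hD _ _ _ hper h12 hc4
  rw [(integral_phi (P := Q) (w := w) (e := propensity P) (g := outcomeReg P) (k := k) hi).2,
    mul_div_cancel_left₀ _ hq0.ne']
  refine hle.trans (le_of_eq ?_)
  ring

/-- The nuisance functions of the submodel depend nonlinearly on its law and need not be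
differentiated: their whole effect is in this remainder, which is quadratic in `t`. What is left is
a ratio of integrals of fixed functions. -/
lemma IsRegularLaw.hasDerivAt_remainder {P : ProbabilityMeasure (ObsCluster M S)}
    {w : ∀ k, Trt (M k) → S k → Outc (M k)} {Cw c C V : ℝ}
    (h : IsRegularLaw (P : Measure (ObsCluster M S)) w Cw c C V)
    {Q : ℝ → ProbabilityMeasure (ObsCluster M S)} {s : ObsCluster M S → ℝ}
    (hQ : IsRegularSubmodel P Q s) (k : Fin K) :
    HasDerivAt (fun t => thetaObs w (Q t : Measure (ObsCluster M S)) k -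
      (∫ z, phi w (propensity (P : Measure (ObsCluster M S)))
        (outcomeReg (P : Measure (ObsCluster M S))) k z ∂(Q t : Measure (ObsCluster M S))) /
        typeProb (Q t : Measure (ObsCluster M S)) k) 0 0 := by
  obtain ⟨D, hD⟩ := h.exists_abs_thetaObs_sub_le k
  obtain ⟨-, r, A, hrm, hev, -⟩ := hQ
  have hsmall : ∀ᶠ t in 𝓝 (0 : ℝ), 4 * (|A| * |t|) < min (1 / 2) (c / 4) := by
    have : Tendsto (fun t : ℝ => 4 * (|A| * |t|)) (𝓝 0) (𝓝 (4 * (|A| * |0|))) :=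
      (continuous_const.mul (continuous_const.mul continuous_abs)).tendsto 0
    rw [abs_zero, mul_zero, mul_zero] at this
    exact this.eventually_lt_const (by have := h.overlap_pos; positivity)
  generalize hf : (fun t => thetaObs w (Q t : Measure (ObsCluster M S)) k -
      (∫ z, phi w (propensity (P : Measure (ObsCluster M S)))
        (outcomeReg (P : Measure (ObsCluster M S))) k z ∂(Q t : Measure (ObsCluster M S))) /
        typeProb (Q t : Measure (ObsCluster M S)) k) = f
  have hbound : ∀ᶠ t in 𝓝 (0 : ℝ), |f t| ≤ D * (|A| * |t|) ^ 2 := by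
    filter_upwards [hev, hsmall] with t ht hts
    rw [← hf]
    exact hD _ _ _ (hrm t) (fun z => (ht.1 z).1)
      (fun z => (ht.1 z).2.trans (by gcongr; exact le_abs_self A)) hts.le ht.2
  have hz : f 0 = 0 := by
    have := hbound.self_of_nhds
    rw [abs_zero, mul_zero, zero_pow two_ne_zero, mul_zero] at this
    exact abs_nonpos_iff.1 this
  rw [hasDerivAt_iff_isLittleO, hz]
  simp only [sub_zero, smul_zero]
  refine IsBigO.trans_isLittleO (g := fun t : ℝ => t ^ 2) ?_ ?_
  · refine IsBigO.of_bound (D * |A| ^ 2) ?_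
    filter_upwards [hbound] with t ht
    rw [Real.norm_eq_abs, norm_pow, Real.norm_eq_abs]
    exact ht.trans (le_of_eq (by ring))
  · simpa using isLittleO_pow_pow (𝕜 := ℝ) one_lt_two

/-- The identified functional has gradient `inflObs`. -/
lemma IsRegularLaw.hasDerivAt_tauObs {P : ProbabilityMeasure (ObsCluster M S)}
    {w : ∀ k, Trt (M k) → S k → Outc (M k)} {v : Fin K → ℝ → ℝ} {Cw c C V : ℝ}
    (h : IsRegularLaw (P : Measure (ObsCluster M S)) w Cw c C V)
    (hv : ∀ k, DifferentiableAt ℝ (v k) (typeProb (P : Measure (ObsCluster M S)) k))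
    {Q : ℝ → ProbabilityMeasure (ObsCluster M S)} {s : ObsCluster M S → ℝ}
    (hQ : IsRegularSubmodel P Q s) :
    HasDerivAt (fun t => tauObs w v (Q t))
      (∫ z, inflObs w v (P : Measure (ObsCluster M S)) z * s z ∂(P : Measure (ObsCluster M S)))
      0 := by
  set P' := (P : Measure (ObsCluster M S)) with hP'
  obtain ⟨B, hB⟩ := hQ.exists_bound
  rw [h.integral_inflObs_mul hQ.1 hB, hQ.integral_score]
  have hQ0 := hQ.eq_at_zero
  have htau : (fun t => tauObs w v (Q t)) = fun t => ∑ k,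
      v k (typeProb (Q t : Measure (ObsCluster M S)) k) *
        thetaObs w (Q t : Measure (ObsCluster M S)) k := rfl
  rw [htau]
  refine HasDerivAt.fun_sum fun k _ => ?_
  -- the type probability
  have hpk : HasDerivAt (fun t => typeProb (Q t : Measure (ObsCluster M S)) k)
      (∫ z, typeInd k z * s z ∂P') 0 := by
    have := hQ.hasDerivAt_integral (integrable_typeInd (P := P') k)
    simpa only [integral_typeInd] using this
  set phik := phi w (propensity P') (outcomeReg P') k with hphik
  have hIk : HasDerivAt (fun t => ∫ z, phik z ∂(Q t : Measure (ObsCluster M S)))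
      (∫ z, phik z * s z ∂P') 0 :=
    hQ.hasDerivAt_integral ((h.memLp_phi k).integrable one_le_two)
  have hp0 : typeProb (Q 0 : Measure (ObsCluster M S)) k = typeProb P' k := by rw [hQ0]
  have hI0 : ∫ z, phik z ∂(Q 0 : Measure (ObsCluster M S)) = typeProb P' k * thetaObs w P' k := by
    rw [hQ0]
    exact h.integral_phi_eq k
  have hpos := h.pos k
  have hR : HasDerivAt (fun t => thetaObs w (Q t : Measure (ObsCluster M S)) k -
      (∫ z, phik z ∂(Q t : Measure (ObsCluster M S))) /
        typeProb (Q t : Measure (ObsCluster M S)) k) 0 0 := h.hasDerivAt_remainder hQ k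
  -- `θ_k` is the remainder, with derivative zero, plus a ratio to which the quotient rule applies.
  have hθ : HasDerivAt (fun t => thetaObs w (Q t : Measure (ObsCluster M S)) k)
      (((∫ z, phik z * s z ∂P') * typeProb P' k -
        typeProb P' k * thetaObs w P' k * ∫ z, typeInd k z * s z ∂P') / typeProb P' k ^ 2) 0 := by
    have h1 := hIk.fun_div hpk (by rw [hp0]; exact hpos.ne')
    rw [hp0, hI0] at h1
    have h2 := hR.fun_add h1
    simpa only [sub_add_cancel, zero_add] using h2
  have hvk : HasDerivAt (fun t => v k (typeProb (Q t : Measure (ObsCluster M S)) k))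
      (deriv (v k) (typeProb P' k) * ∫ z, typeInd k z * s z ∂P') 0 :=
    HasDerivAt.comp (0 : ℝ) (h₂ := v k) (by rw [hp0]; exact (hv k).hasDerivAt) hpk
  have hmul := hvk.fun_mul hθ
  rw [hp0, hQ0] at hmul
  have key : ∀ p θ a b I J : ℝ, p ≠ 0 → a / p * I - p * b * θ * 0 + (b * θ - a / p * θ) * J =
      b * J * θ + a * ((I * p - p * θ * J) / p ^ 2) := by
    intro p θ a b I J hp
    field_simp
    ring
  exact hmul.congr_deriv (key _ _ _ _ _ _ hpos.ne').symm

end Submodel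

end Gradient

/-! ### Identification and efficiency for the observed-data law -/

section Main

variable {K : ℕ} {M : Fin K → ℕ} {S : Fin K → Type*} [∀ k, MeasurableSpace (S k)]

/-- The event that the type is `k` and the treatment is `a` has probability `p_k E[e(a | X)]`, which
is positive and at most `1 - c` by two-sided overlap. -/
lemma IsRegularLaw.exists_nondegenerate {P : Measure (ObsCluster M S)} [IsProbabilityMeasure P]
    {w : ∀ k, Trt (M k) → S k → Outc (M k)} {Cw c C V : ℝ} (h : IsRegularLaw P w Cw c C V)
    (hover : ∀ k a, ∀ᵐ x ∂covLaw P k, propensity P k a x < 1 - c) :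
    ∃ A : Set (ObsCluster M S), MeasurableSet A ∧ P.real A ≠ 0 ∧ P.real A ≠ 1 := by
  obtain ⟨⟨k, -⟩⟩ := nonempty_of_isProbabilityMeasure P
  have := h.isProbabilityMeasure k
  set a : Trt (M k) := fun _ => false
  set s : Set (ObsData (M k) (S k)) := {o | o.2.1 = a} with hs
  have hsm : MeasurableSet s := (measurable_fst.comp measurable_snd) (measurableSet_singleton a)
  have h1 : P.real (Sigma.mk k '' s) = typeProb P k * (typeLaw P k).real s := by
    rw [measureReal_def, ← (measurableEmbedding_sigmaMk k).comap_apply, ← smul_typeLaw,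
      Measure.smul_apply, smul_eq_mul, ENNReal.toReal_mul,
      ENNReal.toReal_ofReal (typeProb_nonneg P k), measureReal_def]
  have h2 : (typeLaw P k).real s = ∫ x, propensity P k a x ∂covLaw P k := by
    have h3 := setIntegral_outLawOf_mul_propOf (ρ := typeLaw P k) a MeasurableSet.univ
      MeasurableSet.univ
    simp only [probReal_univ, one_mul, Measure.restrict_univ, Set.mem_univ, true_and,
      and_true] at h3
    exact h3.symm
  have : IsProbabilityMeasure (covLaw P k) :=
    (inferInstance : IsProbabilityMeasure (covLawOf (typeLaw P k)))
  have hi : Integrable (propensity P k a) (covLaw P k) :=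
    Integrable.of_bound ((h.nuisance k).meas_e a).aestronglyMeasurable 1
      ((h.nuisance k).norm_e_le a)
  have hlow : c ≤ ∫ x, propensity P k a x ∂covLaw P k := by
    have := integral_mono_ae (integrable_const c) hi ((h.nuisance k).le_e a)
    simpa using this
  have hup : ∫ x, propensity P k a x ∂covLaw P k ≤ 1 - c := by
    have := integral_mono_ae hi (integrable_const (1 - c)) ((hover k a).mono fun x hx => hx.le)
    simpa using this
  have hc := h.overlap_pos
  have hp := h.pos k
  have hp1 : typeProb P k ≤ 1 := measureReal_le_one
  refine ⟨Sigma.mk k '' s, (measurableEmbedding_sigmaMk k).measurableSet_image.2 hsm, ?_, ?_⟩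
  · rw [h1, h2]
    exact (mul_pos hp (hc.trans_le hlow)).ne'
  · rw [h1, h2]
    have : typeProb P k * ∫ x, propensity P k a x ∂covLaw P k ≤ 1 * (1 - c) :=
      mul_le_mul hp1 hup (hc.le.trans hlow) zero_le_one
    exact (by linarith : typeProb P k * ∫ x, propensity P k a x ∂covLaw P k < 1).ne

theorem IsRegularLaw.isEfficiencyBound {P : Measure (ObsCluster M S)} [IsProbabilityMeasure P]
    {w : ∀ k, Trt (M k) → S k → Outc (M k)} {v : Fin K → ℝ → ℝ} {Cw c C V : ℝ}
    (h : IsRegularLaw P w Cw c C V)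
    (hv : ∀ k, DifferentiableAt ℝ (v k) (typeProb P k))
    (hover : ∀ k a, ∀ᵐ x ∂covLaw P k, propensity P k a x < 1 - c) :
    IsEfficiencyBound ⟨P, inferInstance⟩ (tauObs w v) Var[inflObs w v P; P] := by
  obtain ⟨A, hA, hA0, hA1⟩ := h.exists_nondegenerate hover
  exact isEfficiencyBound_of_gradient (P := ⟨P, inferInstance⟩) h.measurable_inflObs h.memLp_inflObs
    h.integral_inflObs
    (fun Q s hQ => IsRegularLaw.hasDerivAt_tauObs (P := ⟨P, inferInstance⟩) h hv hQ) hA hA0 hA1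

variable [∀ k, StandardBorelSpace (S k)] {F : Measure (FullCluster M S)} [IsProbabilityMeasure F]
  {w : ∀ k, Trt (M k) → S k → Outc (M k)} {v : Fin K → ℝ → ℝ} {Cw c C V Ct : ℝ}

lemma isRegularLaw_obsLaw (hp : ∀ k, 0 < typeProb F k) (hF : IdentifyingAssumptions F)
    (hw_meas : ∀ k a, Measurable (w k a)) (hw_bdd : ∀ k a x, ‖w k a x‖ ≤ Cw) (hc : 0 < c)
    (hover : ∀ k (a : Trt (M k)), ∀ᵐ x ∂(covLaw (obsLaw F) k), c < propensity (obsLaw F) k a x)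
    (hCt : 0 < Ct)
    (hg_bdd : ∀ k a, ∀ᵐ x ∂(covLaw (obsLaw F) k), ‖outcomeReg (obsLaw F) k a x‖ ≤ Ct)
    (hCov_bdd : ∀ k a, ∀ᵐ x ∂(covLaw (obsLaw F) k),
      ‖Matrix.toEuclideanCLM (n := Fin (M k)) (𝕜 := ℝ) (outcomeCov (obsLaw F) k a x)‖ ≤ Ct) :
    IsRegularLaw (obsLaw F) w Cw c Ct (∑ k, M k * Ct) where
  pos k := by rw [typeProb_obsLaw]; exact hp k
  weight k := ⟨hw_meas k, hw_bdd k⟩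
  overlap_pos := hc
  nuisance k := by
    have : IsProbabilityMeasure (typeLaw (obsLaw F) k) :=
      isProbabilityMeasure_typeLaw _ (by rw [typeProb_obsLaw]; exact hp k)
    refine ⟨measurable_propOf (typeLaw (obsLaw F) k), measurable_regOf (typeLaw (obsLaw F) k),
      fun a => (hover k a).mono fun x hx => hx.le, fun a => ae_of_all _ fun x => ?_, hg_bdd k⟩
    have h0 : 0 ≤ propensity (obsLaw F) k a x := propOf_nonneg (typeLaw (obsLaw F) k) a x
    rw [Real.norm_of_nonneg h0]
    exact propOf_le_one (typeLaw (obsLaw F) k) a x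
  var_nonneg := Finset.sum_nonneg fun k _ => by positivity
  var_le k a := by
    have : IsProbabilityMeasure (typeLaw (obsLaw F) k) :=
      isProbabilityMeasure_typeLaw _ (by rw [typeProb_obsLaw]; exact hp k)
    filter_upwards [hF.moments k a, hCov_bdd k a] with x h1 h2
    have : IsProbabilityMeasure (outcomeLaw (obsLaw F) k a x) :=
      (inferInstance : IsProbabilityMeasure (outLawOf (typeLaw (obsLaw F) k) a x))
    refine (lintegral_enorm_sub_mean_sq_le _ h1 h2).trans (ENNReal.ofReal_le_ofReal ?_)
    -- The trace bound for type `k` is one summand of the common constant `V`.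
    exact Finset.single_le_sum (f := fun k => (M k : ℝ) * Ct) (fun k _ => by positivity)
      (Finset.mem_univ k)

lemma thetaObs_obsLaw (hF : IdentifyingAssumptions F)
    (h : IsRegularLaw (obsLaw F) w Cw c C V) (k : Fin K) :
    thetaObs w (obsLaw F) k = theta w F k := by
  have := h.isProbabilityMeasure k
  have : IsProbabilityMeasure (typeLaw F k) :=
    isProbabilityMeasure_typeLaw F (by rw [← typeProb_obsLaw]; exact h.pos k)
  refine Finset.sum_congr rfl fun a _ => ?_
  exact (integral_inner_potential (typeLaw_obsLaw F k).symm a (hF.ignorability k a)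
    (((h.nuisance k).le_e a).mono fun x hx => h.overlap_pos.trans_le hx) ENNReal.ofReal_ne_top
    (h.var_le k a) ((h.nuisance k).norm_g_le a) (h.weight k)).symm

lemma tauObs_obsLaw (hF : IdentifyingAssumptions F) (h : IsRegularLaw (obsLaw F) w Cw c C V) :
    tauObs w v ⟨obsLaw F, inferInstance⟩ = tau w v F := by
  refine Finset.sum_congr rfl fun k _ => ?_
  rw [← thetaObs_obsLaw hF h, ← typeProb_obsLaw]
  rfl

lemma influence_eq_inflObs (hF : IdentifyingAssumptions F)
    (h : IsRegularLaw (obsLaw F) w Cw c C V) : influence w v F = inflObs w v (obsLaw F) := by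
  funext z
  simp only [influence, inflObs, thetaObs_obsLaw hF h, typeProb_obsLaw]

end Main

/-! ### Calculus of stochastic orders -/

section StochasticOrder

variable {Ω : Type*} [MeasurableSpace Ω] {μ : Measure Ω} {X Y : ℕ → Ω → ℝ} {a b : ℕ → ℝ}

/-- Convergence to zero in probability. -/
def IsLittleOP (μ : Measure Ω) (X : ℕ → Ω → ℝ) : Prop :=
  ∀ ε : ℝ, 0 < ε → ∀ η : ℝ, 0 < η → ∀ᶠ N in atTop, μ.real {ω | ε ≤ |X N ω|} ≤ η

lemma isLittleOP_zero : IsLittleOP μ (fun _ _ => 0) := by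
  intro ε hε η hη
  refine Eventually.of_forall fun N => ?_
  simp [not_le.2 hε, hη.le]

lemma isBigOP_const (c : ℝ) : IsBigOP μ (fun _ _ => c) fun _ => 1 := by
  intro ε hε
  refine ⟨|c|, Eventually.of_forall fun N => ?_⟩
  simp [hε.le]

/-- Uniform boundedness in mean implies boundedness in probability. -/
lemma isBigOP_of_lintegral {c : ℝ} (hX : ∀ N, AEMeasurable (X N) μ)
    (h : ∀ᶠ N in atTop, ∫⁻ ω, ‖X N ω‖ₑ ∂μ ≤ ENNReal.ofReal c) : IsBigOP μ X fun _ => 1 := by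
  intro ε hε
  set B : ℝ := max c 1 / ε with hB
  have hB0 : 0 < B := by positivity
  refine ⟨B, h.mono fun N hN => ?_⟩
  have h1 : μ {ω | B * |(1 : ℝ)| < |X N ω|} ≤ ENNReal.ofReal ε := by
    calc _ ≤ μ {ω | ENNReal.ofReal B ≤ ‖X N ω‖ₑ} := by
          refine measure_mono fun ω hω => ?_
          simp only [Set.mem_ofPred_eq, abs_one, mul_one] at hω ⊢
          rw [← ofReal_norm]
          exact ENNReal.ofReal_le_ofReal hω.le
      _ ≤ (∫⁻ ω, ‖X N ω‖ₑ ∂μ) / ENNReal.ofReal B :=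
          meas_ge_le_lintegral_div (hX N).enorm (by simpa using hB0) ENNReal.ofReal_ne_top
      _ ≤ ENNReal.ofReal c / ENNReal.ofReal B := by gcongr
      _ = ENNReal.ofReal (c / B) := (ENNReal.ofReal_div_of_pos hB0).symm
      _ ≤ ENNReal.ofReal ε := by
          refine ENNReal.ofReal_le_ofReal ?_
          rw [div_le_iff₀ hB0, hB, mul_div_cancel₀ _ hε.ne']
          exact le_max_left _ _
  exact ENNReal.toReal_le_of_le_ofReal hε.le h1

/-- Convergence in mean implies convergence in probability. -/
lemma isLittleOP_of_lintegral (hX : ∀ N, AEMeasurable (X N) μ)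
    (h : ∀ ε : ℝ, 0 < ε → ∀ᶠ N in atTop, ∫⁻ ω, ‖X N ω‖ₑ ∂μ ≤ ENNReal.ofReal ε) :
    IsLittleOP μ X := by
  intro ε hε η hη
  filter_upwards [h (ε * η) (by positivity)] with N hN
  refine ENNReal.toReal_le_of_le_ofReal hη.le ?_
  calc μ {ω | ε ≤ |X N ω|} ≤ μ {ω | ENNReal.ofReal ε ≤ ‖X N ω‖ₑ} := by
        refine measure_mono fun ω hω => ?_
        simp only [Set.mem_ofPred_eq] at hω ⊢
        rw [← ofReal_norm]
        exact ENNReal.ofReal_le_ofReal hω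
    _ ≤ (∫⁻ ω, ‖X N ω‖ₑ ∂μ) / ENNReal.ofReal ε :=
        meas_ge_le_lintegral_div (hX N).enorm (by simpa using hε) ENNReal.ofReal_ne_top
    _ ≤ ENNReal.ofReal (ε * η) / ENNReal.ofReal ε := by gcongr
    _ = ENNReal.ofReal η := by
        rw [← ENNReal.ofReal_div_of_pos hε, mul_div_cancel_left₀ _ hε.ne']

variable [IsProbabilityMeasure μ]

lemma tendstoInMeasure_iff_isLittleOP {c : ℝ} :
    TendstoInMeasure μ X atTop (fun _ => c) ↔ IsLittleOP μ fun N ω => X N ω - c := by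
  rw [tendstoInMeasure_iff_measureReal_norm]
  refine forall₂_congr fun ε hε => ?_
  simp only [Real.norm_eq_abs]
  constructor
  · intro h η hη
    exact (h.eventually_lt_const hη).mono fun N hN => hN.le
  · intro h
    rw [Metric.tendsto_nhds]
    intro η hη
    filter_upwards [h (η / 2) (half_pos hη)] with N hN
    rw [Real.dist_0_eq_abs, abs_of_nonneg measureReal_nonneg]
    linarith

/-- Only monotonicity of the outer measure is used. No measurability is required, so the calculus
applies directly to nuisance distances and fitted quantities. -/
lemma IsLittleOP.of_abs_le (hY : IsLittleOP μ Y)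
    (h : ∀ᶠ N in atTop, ∀ᵐ ω ∂μ, |X N ω| ≤ |Y N ω|) : IsLittleOP μ X := by
  intro ε hε η hη
  filter_upwards [hY ε hε η hη, h] with N h1 h2
  refine le_trans ?_ h1
  refine ENNReal.toReal_mono (measure_ne_top _ _) (measure_mono_ae ?_)
  filter_upwards [h2] with ω hω h3
  exact le_trans (α := ℝ) h3 hω

lemma IsLittleOP.congr (hY : IsLittleOP μ Y)
    (h : ∀ᶠ N in atTop, ∀ᵐ ω ∂μ, X N ω = Y N ω) : IsLittleOP μ X :=
  hY.of_abs_le (h.mono fun N hN => hN.mono fun ω hω => by rw [hω])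

lemma IsLittleOP.add (hX : IsLittleOP μ X) (hY : IsLittleOP μ Y) :
    IsLittleOP μ fun N ω => X N ω + Y N ω := by
  intro ε hε η hη
  filter_upwards [hX _ (half_pos hε) _ (half_pos hη), hY _ (half_pos hε) _ (half_pos hη)]
    with N h1 h2
  have hsub : {ω | ε ≤ |X N ω + Y N ω|} ⊆ {ω | ε / 2 ≤ |X N ω|} ∪ {ω | ε / 2 ≤ |Y N ω|} := by
    intro ω hω
    by_contra hcon
    simp only [Set.mem_union, Set.mem_ofPred_eq, not_or, not_le] at hcon hω
    linarith [abs_add_le (X N ω) (Y N ω)]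
  linarith [(measureReal_mono (μ := μ) hsub).trans (measureReal_union_le _ _)]

lemma IsLittleOP.sum {ι : Type*} (s : Finset ι) {X : ι → ℕ → Ω → ℝ}
    (h : ∀ i ∈ s, IsLittleOP μ (X i)) : IsLittleOP μ fun N ω => ∑ i ∈ s, X i N ω := by
  classical
  induction s using Finset.induction_on with
  | empty => simpa using isLittleOP_zero
  | insert i s hi ih =>
    simp_rw [Finset.sum_insert hi]
    exact (h i (Finset.mem_insert_self _ _)).add
      (ih fun j hj => h j (Finset.mem_insert_of_mem hj))

lemma IsBigOP.exists_pos (h : IsBigOP μ X a) {ε : ℝ} (hε : 0 < ε) :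
    ∃ B : ℝ, 0 < B ∧ ∀ᶠ N in atTop, μ.real {ω | B * |a N| < |X N ω|} ≤ ε := by
  obtain ⟨B, hB⟩ := h ε hε
  refine ⟨max B 1, by positivity, hB.mono fun N hN => le_trans (measureReal_mono ?_) hN⟩
  intro ω hω
  simp only [Set.mem_ofPred_eq] at hω ⊢
  exact lt_of_le_of_lt (by gcongr; exact le_max_left _ _) hω

lemma IsBigOP.mul (hX : IsBigOP μ X a) (hY : IsBigOP μ Y b) :
    IsBigOP μ (fun N ω => X N ω * Y N ω) (fun N => a N * b N) := by
  intro ε hε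
  obtain ⟨B1, hB1, h1⟩ := hX.exists_pos (half_pos hε)
  obtain ⟨B2, hB2, h2⟩ := hY.exists_pos (half_pos hε)
  refine ⟨B1 * B2, ?_⟩
  filter_upwards [h1, h2] with N h1 h2
  have hsub : {ω | B1 * B2 * |a N * b N| < |X N ω * Y N ω|} ⊆
      {ω | B1 * |a N| < |X N ω|} ∪ {ω | B2 * |b N| < |Y N ω|} := by
    intro ω hω
    by_contra hcon
    simp only [Set.mem_union, Set.mem_ofPred_eq, not_or, not_lt] at hcon hω
    have := mul_le_mul hcon.1 hcon.2 (abs_nonneg _) (by positivity)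
    rw [abs_mul, abs_mul] at hω
    nlinarith
  linarith [(measureReal_mono (μ := μ) hsub).trans (measureReal_union_le _ _)]

lemma IsBigOP.add_one (hX : IsBigOP μ X fun _ => 1) (hY : IsBigOP μ Y fun _ => 1) :
    IsBigOP μ (fun N ω => X N ω + Y N ω) fun _ => 1 := by
  intro ε hε
  obtain ⟨B1, hB1, h1⟩ := hX.exists_pos (half_pos hε)
  obtain ⟨B2, hB2, h2⟩ := hY.exists_pos (half_pos hε)
  refine ⟨B1 + B2, ?_⟩
  filter_upwards [h1, h2] with N h1 h2
  have hsub : {ω | (B1 + B2) * |(1 : ℝ)| < |X N ω + Y N ω|} ⊆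
      {ω | B1 * |(1 : ℝ)| < |X N ω|} ∪ {ω | B2 * |(1 : ℝ)| < |Y N ω|} := by
    intro ω hω
    by_contra hcon
    simp only [Set.mem_union, Set.mem_ofPred_eq, not_or, not_lt, abs_one, mul_one] at hcon hω
    linarith [abs_add_le (X N ω) (Y N ω)]
  exact ((measureReal_mono hsub).trans (measureReal_union_le _ _)).trans
    ((add_le_add h1 h2).trans_eq (add_halves ε))

lemma IsBigOP.sqrt (hX : IsBigOP μ X fun N => a N ^ 2) :
    IsBigOP μ (fun N ω => √(X N ω)) a := by
  intro ε hε
  obtain ⟨B, hB, h⟩ := hX.exists_pos hε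
  refine ⟨√B, h.mono fun N hN => (measureReal_mono fun ω hω => ?_).trans hN⟩
  simp only [Set.mem_ofPred_eq] at hω ⊢
  rw [abs_of_nonneg (Real.sqrt_nonneg _), ← Real.sqrt_sq_eq_abs, ← Real.sqrt_mul hB.le] at hω
  have := lt_of_not_ge fun hcon => hω.not_ge (Real.sqrt_le_sqrt hcon)
  rw [abs_of_nonneg (sq_nonneg _)]
  exact this.trans_le (le_abs_self _)

/-- A term of stochastic order `a`, multiplied by `b` with `b a → 0`, vanishes in probability. -/
lemma IsBigOP.isLittleOP_mul (hX : IsBigOP μ X a) (hb : Tendsto (fun N => b N * a N) atTop (𝓝 0)) :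
    IsLittleOP μ fun N ω => b N * X N ω := by
  intro ε hε η hη
  obtain ⟨B, hB, h⟩ := hX.exists_pos hη
  have hb' : Tendsto (fun N => |b N * a N|) atTop (𝓝 0) := by simpa using hb.abs
  filter_upwards [h, hb'.eventually_lt_const (div_pos hε hB)] with N h1 h2
  refine (measureReal_mono fun ω hω => ?_).trans h1
  simp only [Set.mem_ofPred_eq] at hω ⊢
  rw [lt_div_iff₀ hB, abs_mul] at h2
  rw [abs_mul] at hω
  by_contra hcon
  rw [not_lt] at hcon
  have := mul_le_mul_of_nonneg_left hcon (abs_nonneg (b N))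
  nlinarith

lemma IsBigOP.isLittleOP (hX : IsBigOP μ X a) (ha : Tendsto a atTop (𝓝 0)) : IsLittleOP μ X := by
  simpa using hX.isLittleOP_mul (b := fun _ => 1) (by simpa using ha)

lemma IsLittleOP.mul (hX : IsLittleOP μ X) (hY : IsBigOP μ Y fun _ => 1) :
    IsLittleOP μ fun N ω => X N ω * Y N ω := by
  intro ε hε η hη
  obtain ⟨B, hB, h⟩ := hY.exists_pos (half_pos hη)
  filter_upwards [h, hX _ (div_pos hε hB) _ (half_pos hη)] with N h1 h2
  have hsub : {ω | ε ≤ |X N ω * Y N ω|} ⊆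
      {ω | B * |(1 : ℝ)| < |Y N ω|} ∪ {ω | ε / B ≤ |X N ω|} := by
    intro ω hω
    by_contra hcon
    simp only [Set.mem_union, Set.mem_ofPred_eq, not_or, not_lt, not_le, abs_one, mul_one] at hcon hω
    rw [lt_div_iff₀ hB] at hcon
    rw [abs_mul] at hω
    have := mul_le_mul_of_nonneg_left hcon.1 (abs_nonneg (X N ω))
    linarith [hcon.2]
  linarith [(measureReal_mono (μ := μ) hsub).trans (measureReal_union_le _ _)]

lemma IsLittleOP.isBigOP (hX : IsLittleOP μ X) : IsBigOP μ X fun _ => 1 := by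
  intro ε hε
  refine ⟨1, (hX 1 one_pos ε hε).mono fun N hN => (measureReal_mono fun ω hω => ?_).trans hN⟩
  simp only [Set.mem_ofPred_eq, abs_one, mul_one] at hω ⊢
  exact hω.le

lemma isBigOP_of_sub (c : ℝ) (hX : IsLittleOP μ fun N ω => X N ω - c) :
    IsBigOP μ X fun _ => 1 := by
  simpa using hX.isBigOP.add_one (isBigOP_const c)

lemma IsLittleOP.const_mul (hX : IsLittleOP μ X) (c : ℝ) : IsLittleOP μ fun N ω => c * X N ω := by
  simpa [mul_comm] using hX.mul (isBigOP_const c)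

/-- Convergence in probability is preserved by functions that are continuous at the limit. -/
lemma IsLittleOP.comp_continuousAt {f : ℝ → ℝ} {c : ℝ} (hX : IsLittleOP μ fun N ω => X N ω - c)
    (hf : ContinuousAt f c) : IsLittleOP μ fun N ω => f (X N ω) - f c := by
  intro ε hε η hη
  obtain ⟨δ, hδ, h⟩ := Metric.continuousAt_iff.1 hf ε hε
  filter_upwards [hX δ hδ η hη] with N hN
  refine (measureReal_mono fun ω hω => ?_).trans hN
  simp only [Set.mem_ofPred_eq] at hω ⊢
  by_contra hcon
  rw [not_le, ← Real.dist_eq] at hcon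
  have := h hcon
  rw [Real.dist_eq] at this
  linarith

lemma IsLittleOP.sub_mul_sub {c d : ℝ} (hX : IsLittleOP μ fun N ω => X N ω - c)
    (hY : IsLittleOP μ fun N ω => Y N ω - d) : IsLittleOP μ fun N ω => X N ω * Y N ω - c * d := by
  have h1 := hX.mul (isBigOP_of_sub d hY)
  have h2 := hY.const_mul c
  refine (h1.add h2).congr (Eventually.of_forall fun N => ae_of_all _ fun ω => ?_)
  ring

lemma IsLittleOP.of_sq (hX : IsLittleOP μ fun N ω => X N ω ^ 2) : IsLittleOP μ X := by
  intro ε hε η hη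
  filter_upwards [hX (ε ^ 2) (by positivity) η hη] with N hN
  refine (measureReal_mono fun ω hω => ?_).trans hN
  simp only [Set.mem_ofPred_eq] at hω ⊢
  rw [abs_of_nonneg (sq_nonneg _), ← sq_abs (X N ω)]
  exact pow_le_pow_left₀ hε.le hω 2

/-- Bounded convergence: the mean of a bounded sequence that vanishes in probability vanishes. -/
lemma IsLittleOP.eventually_lintegral_le (hX : IsLittleOP μ X) {B : ℝ}
    (hB : ∀ N, ∀ᵐ ω ∂μ, |X N ω| ≤ B) {ε : ℝ} (hε : 0 < ε) :
    ∀ᶠ N in atTop, ∫⁻ ω, ENNReal.ofReal (X N ω) ∂μ ≤ ENNReal.ofReal ε := by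
  have hB1 : 0 < |B| + 1 := by positivity
  have hη : 0 < ε / 2 / (|B| + 1) := by positivity
  filter_upwards [hX (ε / 2) (half_pos hε) _ hη] with N hN
  set s := {ω | ε / 2 ≤ |X N ω|} with hs
  -- `X N` is not assumed measurable, so its exceptional set is replaced by a measurable hull. The
  -- probability `ε / 2 / (|B| + 1)` is chosen so that this set contributes at most `ε / 2` to the
  -- mean.
  set t := toMeasurable μ s with ht
  have htm : MeasurableSet t := measurableSet_toMeasurable _ _
  have hle : ∀ᵐ ω ∂μ, ENNReal.ofReal (X N ω) ≤
      ENNReal.ofReal (ε / 2) + t.indicator (fun _ => ENNReal.ofReal (|B| + 1)) ω := by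
    filter_upwards [hB N] with ω hω
    by_cases h : ω ∈ s
    · rw [Set.indicator_of_mem (subset_toMeasurable μ s h)]
      refine le_trans (ENNReal.ofReal_le_ofReal ?_) le_add_self
      linarith [le_abs_self (X N ω), le_abs_self B]
    · refine le_trans (ENNReal.ofReal_le_ofReal ?_) le_self_add
      simp only [hs, Set.mem_ofPred_eq, not_le] at h
      linarith [le_abs_self (X N ω)]
  calc _ ≤ ∫⁻ ω, (ENNReal.ofReal (ε / 2) + t.indicator (fun _ => ENNReal.ofReal (|B| + 1)) ω) ∂μ :=
        lintegral_mono_ae hle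
    _ = ENNReal.ofReal (ε / 2) + ENNReal.ofReal (|B| + 1) * μ s := by
        rw [lintegral_add_left measurable_const, lintegral_indicator_const htm,
          ht, measure_toMeasurable]
        simp
    _ ≤ ENNReal.ofReal (ε / 2) + ENNReal.ofReal (|B| + 1) * ENNReal.ofReal (ε / 2 / (|B| + 1)) := by
        gcongr
        rw [← ofReal_measureReal]
        exact ENNReal.ofReal_le_ofReal hN
    _ = ENNReal.ofReal ε := by
        rw [← ENNReal.ofReal_mul hB1.le, ← ENNReal.ofReal_add (half_pos hε).le (by positivity)]
        congr 1
        field_simp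
        ring

end StochasticOrder

/-! ### Resampling one cluster within its type -/

section Resample

variable {K N : ℕ} {D : Fin K → Type*} [∀ k, MeasurableSpace (D k)]
  {𝒰 : Type*} [MeasurableSpace 𝒰] {Ω : Type*} [MeasurableSpace Ω]
  {μ : Measure Ω} {P : Measure (Σ k, D k)} {ν : Measure 𝒰}

lemma map_prodMk_eq_prod_pi [IsProbabilityMeasure μ] {Z : ℕ → Ω → Σ k, D k}
    (hZ_meas : ∀ i, Measurable (Z i))
    (hZ_indep : iIndepFun Z μ) (hZ_law : ∀ i, μ.map (Z i) = P)
    {U : Ω → 𝒰} (hU_meas : Measurable U) (hU_indep : IndepFun U (fun ω i => Z i ω) μ) (N : ℕ) :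
    μ.map (fun ω => (U ω, fun i : Fin N => Z i ω)) =
      (μ.map U).prod (Measure.pi fun _ => P) := by
  have h1 : IndepFun U (fun ω (i : Fin N) => Z i ω) μ :=
    hU_indep.comp measurable_id
      (measurable_pi_lambda (fun (z : ℕ → Σ k, D k) (i : Fin N) => z i)
        fun i => measurable_pi_apply (i : ℕ))
  rw [(indepFun_iff_map_prod_eq_prod_map_map hU_meas.aemeasurable
    (measurable_pi_lambda _ fun i => hZ_meas _).aemeasurable).1 h1]
  have h2 : iIndepFun (fun i : Fin N => Z i) μ := hZ_indep.precomp Fin.val_injective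
  rw [(iIndepFun_iff_map_fun_eq_pi_map fun i => (hZ_meas _).aemeasurable).1 h2]
  simp_rw [hZ_law]

lemma measurable_typeAt (i : Fin N) :
    Measurable fun q : 𝒰 × (Fin N → Σ k, D k) => (q.2 i).1 :=
  measurable_sigmaFst.comp ((measurable_pi_apply i).comp measurable_snd)

lemma measurable_resample (i : Fin N) (k : Fin K) :
    Measurable fun p : (𝒰 × (Fin N → Σ k, D k)) × D k =>
      ((p.1.1, Function.update p.1.2 i ⟨k, p.2⟩) : 𝒰 × (Fin N → Σ k, D k)) := by
  refine (measurable_fst.comp measurable_fst).prodMk ?_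
  refine measurable_pi_lambda _ fun j => ?_
  by_cases h : j = i
  · subst h
    simp only [Function.update_self]
    exact (measurable_sigmaMk k).comp measurable_snd
  · simp only [Function.update_of_ne h]
    exact (measurable_pi_apply j).comp (measurable_snd.comp measurable_fst)

variable [IsProbabilityMeasure P]

/-- It suffices to integrate out coordinate `i` alone. Decomposing its law by type, only the summand
`l = k` survives the indicator; there the right-hand inner integral no longer depends on the
coordinate, and `typeLaw P k` is a probability measure. -/
lemma lintegral_pi_resample {k : Fin K} (hk : 0 < typeProb P k) (i : Fin N)
    {G : (Fin N → Σ k, D k) → ℝ≥0∞} (hG : Measurable G) :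
    ∫⁻ z, {z | (z i).1 = k}.indicator G z ∂(Measure.pi fun _ => P) =
      ∫⁻ z, {z | (z i).1 = k}.indicator
        (fun z => ∫⁻ d, G (Function.update z i ⟨k, d⟩) ∂(typeLaw P k)) z
          ∂(Measure.pi fun _ => P) := by
  have := isProbabilityMeasure_typeLaw P hk
  have hs : MeasurableSet {z : Fin N → Σ k, D k | (z i).1 = k} :=
    (measurable_sigmaFst.comp (measurable_pi_apply i)) (measurableSet_singleton k)
  have hupd : ∀ z : Fin N → Σ k, D k, Measurable fun y => Function.update z i y :=
    fun z => measurable_update z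
  have hG' : Measurable fun z : Fin N → Σ k, D k =>
      ∫⁻ d, G (Function.update z i ⟨k, d⟩) ∂(typeLaw P k) := by
    refine Measurable.lintegral_prod_right'
      (f := fun p : (Fin N → Σ k, D k) × D k => G (Function.update p.1 i ⟨k, p.2⟩)) ?_
    refine hG.comp ?_
    exact measurable_snd.comp ((measurable_resample (𝒰 := Unit) i k).comp
      (((measurable_const (a := ())).prodMk measurable_fst).prodMk measurable_snd))
  refine lintegral_eq_of_lmarginal_eq {i} (hG.indicator hs) (hG'.indicator hs) ?_
  rw [lmarginal_singleton, lmarginal_singleton]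
  funext z
  have hm1 : Measurable fun y => {z : Fin N → Σ k, D k | (z i).1 = k}.indicator G
      (Function.update z i y) := (hG.indicator hs).comp (hupd z)
  have hm2 := (hG'.indicator hs).comp (hupd z)
  rw [lintegral_sigma P hm1]
  refine Eq.trans ?_ (lintegral_sigma P hm2).symm
  refine Finset.sum_congr rfl fun l _ => ?_
  congr 1
  by_cases h : l = k
  · subst h
    simp [Set.indicator]
  · simp [Set.indicator, h]

/-- Given that cluster `i` is of type `k`, it may be replaced by a fresh cluster of type `k`
without changing the joint law of the sample and the external randomness. -/
lemma map_resample [IsFiniteMeasure μ] [SFinite ν] {W : Ω → 𝒰 × (Fin N → Σ k, D k)}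
    (hWm : Measurable W)
    (hW : μ.map W = ν.prod (Measure.pi fun _ => P)) {k : Fin K} (hk : 0 < typeProb P k)
    (i : Fin N) :
    ((μ.restrict {ω | ((W ω).2 i).1 = k}).prod (typeLaw P k)).map
        (fun p => ((W p.1).1, Function.update (W p.1).2 i ⟨k, p.2⟩)) =
      (μ.restrict {ω | ((W ω).2 i).1 = k}).map W := by
  have hs : MeasurableSet {q : 𝒰 × (Fin N → Σ k, D k) | (q.2 i).1 = k} :=
    measurable_typeAt i (measurableSet_singleton k)
  have hsW : MeasurableSet {ω | ((W ω).2 i).1 = k} := hWm hs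
  have hT : Measurable fun p : Ω × D k =>
      (((W p.1).1, Function.update (W p.1).2 i ⟨k, p.2⟩) : 𝒰 × (Fin N → Σ k, D k)) :=
    (measurable_resample i k).comp ((hWm.comp measurable_fst).prodMk measurable_snd)
  have key : ∀ G : 𝒰 × (Fin N → Σ k, D k) → ℝ≥0∞, Measurable G →
      ∫⁻ ω in {ω | ((W ω).2 i).1 = k}, G (W ω) ∂μ =
        ∫⁻ q, {q : 𝒰 × (Fin N → Σ k, D k) | (q.2 i).1 = k}.indicator G q
          ∂(ν.prod (Measure.pi fun _ => P)) := by
    intro G hG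
    rw [← hW, lintegral_map (hG.indicator hs) hWm, ← lintegral_indicator hsW]
    rfl
  refine Measure.ext_of_lintegral _ fun G hG => ?_
  have hG2 : Measurable fun q : 𝒰 × (Fin N → Σ k, D k) =>
      ∫⁻ d, G (q.1, Function.update q.2 i ⟨k, d⟩) ∂(typeLaw P k) :=
    (hG.comp (measurable_resample i k)).lintegral_prod_right'
  rw [lintegral_map hG hT, lintegral_map hG hWm, key G hG]
  refine (lintegral_prod _ (hG.comp hT).aemeasurable).trans ((key _ hG2).trans ?_)
  rw [lintegral_prod _ (hG2.indicator hs).aemeasurable,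
    lintegral_prod _ (hG.indicator hs).aemeasurable]
  refine lintegral_congr fun u => ?_
  exact (lintegral_pi_resample hk i (hG.comp measurable_prodMk_left)).symm

/-- The contribution of cluster `i` to a sum over held-out clusters: `A i` is the event that
cluster `i` is held out, and `H q` is fitted without the held-out clusters. -/
def heldOut (A : Fin N → Set (𝒰 × (Fin N → Σ k, D k)))
    (H : 𝒰 × (Fin N → Σ k, D k) → (Σ k, D k) → ℝ) (i : Fin N)
    (q : 𝒰 × (Fin N → Σ k, D k)) : ℝ :=
  (A i).indicator (fun q => H q (q.2 i)) q

/-- The held-out clusters are all of type `k`; replacing one of them by another cluster of type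
`k` changes neither the set of held-out clusters nor the fitted function. -/
structure IsHeldOut (k : Fin K) (A : Fin N → Set (𝒰 × (Fin N → Σ k, D k)))
    (H : 𝒰 × (Fin N → Σ k, D k) → (Σ k, D k) → ℝ) : Prop where
  measurableSet : ∀ i, MeasurableSet (A i)
  measurable : Measurable fun p : (𝒰 × (Fin N → Σ k, D k)) × (Σ k, D k) => H p.1 p.2
  type_eq : ∀ i q, q ∈ A i → (q.2 i).1 = k
  mem_iff : ∀ i j q (d : D k), (q.2 i).1 = k →
    ((q.1, Function.update q.2 i ⟨k, d⟩) ∈ A j ↔ q ∈ A j)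
  fit_eq : ∀ i q (d : D k), q ∈ A i → H (q.1, Function.update q.2 i ⟨k, d⟩) = H q

namespace IsHeldOut

variable {k : Fin K} {A : Fin N → Set (𝒰 × (Fin N → Σ k, D k))}
  {H : 𝒰 × (Fin N → Σ k, D k) → (Σ k, D k) → ℝ}

lemma measurable_heldOut (h : IsHeldOut k A H) (i : Fin N) : Measurable (heldOut A H i) :=
  (h.measurable.comp (measurable_id.prodMk ((measurable_pi_apply i).comp measurable_snd))).indicator
    (h.measurableSet i)

lemma heldOut_eq_zero (h : IsHeldOut k A H) {i : Fin N} {q : 𝒰 × (Fin N → Σ k, D k)}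
    (hq : (q.2 i).1 ≠ k) : heldOut A H i q = 0 :=
  Set.indicator_of_notMem (fun hmem => hq (h.type_eq i q hmem)) _

lemma heldOut_update_self (h : IsHeldOut k A H) {i : Fin N} {q : 𝒰 × (Fin N → Σ k, D k)}
    (hq : (q.2 i).1 = k) (d : D k) :
    heldOut A H i (q.1, Function.update q.2 i ⟨k, d⟩) =
      (A i).indicator (fun q => H q ⟨k, d⟩) q := by
  unfold heldOut
  by_cases hA : q ∈ A i
  · rw [Set.indicator_of_mem ((h.mem_iff i i q d hq).2 hA), Set.indicator_of_mem hA,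
      h.fit_eq i q d hA]
    simp
  · rw [Set.indicator_of_notMem (fun hmem => hA ((h.mem_iff i i q d hq).1 hmem)),
      Set.indicator_of_notMem hA]

/-- While cluster `i` is resampled, the other contributions stay fixed and can be taken out of the
integral over the fresh cluster. -/
lemma heldOut_update_of_ne (h : IsHeldOut k A H) {i j : Fin N} (hij : j ≠ i)
    {q : 𝒰 × (Fin N → Σ k, D k)} (hq : q ∈ A i) (d : D k) :
    heldOut A H j (q.1, Function.update q.2 i ⟨k, d⟩) = heldOut A H j q := by
  unfold heldOut
  have hk := h.type_eq i q hq
  by_cases hA : q ∈ A j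
  · rw [Set.indicator_of_mem ((h.mem_iff i j q d hk).2 hA), Set.indicator_of_mem hA,
      h.fit_eq i q d hq]
    simp [Function.update_of_ne hij]
  · rw [Set.indicator_of_notMem (fun hmem => hA ((h.mem_iff i j q d hk).1 hmem)),
      Set.indicator_of_notMem hA]

variable [IsProbabilityMeasure μ] [SFinite ν] {W : Ω → 𝒰 × (Fin N → Σ k, D k)}
  {B : Ω → ℝ≥0∞}

/-- After resampling cluster `i`, the fitted function is evaluated at an independent draw of type
`k`, so `B` bounds the inner second moment. -/
lemma lintegral_heldOut_sq_le (h : IsHeldOut k A H) (hWm : Measurable W)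
    (hW : μ.map W = ν.prod (Measure.pi fun _ => P)) (hk : 0 < typeProb P k) (i : Fin N)
    (hB : ∀ᵐ ω ∂μ, ∫⁻ d, ‖H (W ω) ⟨k, d⟩‖ₑ ^ 2 ∂(typeLaw P k) ≤ B ω) :
    ∫⁻ ω, ‖heldOut A H i (W ω)‖ₑ ^ 2 ∂μ ≤ ∫⁻ ω, B ω ∂μ := by
  have hs : MeasurableSet {ω | ((W ω).2 i).1 = k} :=
    hWm (measurable_typeAt i (measurableSet_singleton k))
  have hG : Measurable fun q => ‖heldOut A H i q‖ₑ ^ 2 := (h.measurable_heldOut i).enorm.pow_const 2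
  have hT : Measurable fun p : Ω × D k =>
      (((W p.1).1, Function.update (W p.1).2 i ⟨k, p.2⟩) : 𝒰 × (Fin N → Σ k, D k)) :=
    (measurable_resample i k).comp ((hWm.comp measurable_fst).prodMk measurable_snd)
  calc ∫⁻ ω, ‖heldOut A H i (W ω)‖ₑ ^ 2 ∂μ
      = ∫⁻ ω in {ω | ((W ω).2 i).1 = k}, ‖heldOut A H i (W ω)‖ₑ ^ 2 ∂μ := by
        rw [← lintegral_indicator hs]
        refine lintegral_congr fun ω => ?_
        by_cases hω : ((W ω).2 i).1 = k
        · simp [Set.indicator, hω]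
        · simp [Set.indicator, hω, h.heldOut_eq_zero hω]
    _ = ∫⁻ ω in {ω | ((W ω).2 i).1 = k}, ∫⁻ d,
          ‖heldOut A H i ((W ω).1, Function.update (W ω).2 i ⟨k, d⟩)‖ₑ ^ 2 ∂(typeLaw P k) ∂μ := by
        rw [← lintegral_map hG hWm, ← map_resample hWm hW hk i, lintegral_map hG hT]
        exact lintegral_prod _ (hG.comp hT).aemeasurable
    _ ≤ ∫⁻ ω in {ω | ((W ω).2 i).1 = k}, B ω ∂μ := by
        refine lintegral_mono_ae ?_
        filter_upwards [ae_restrict_of_ae hB, ae_restrict_mem hs] with ω h1 h2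
        refine le_trans (lintegral_mono fun d => ?_) h1
        rw [h.heldOut_update_self h2]
        by_cases hA : W ω ∈ A i
        · rw [Set.indicator_of_mem hA]
        · rw [Set.indicator_of_notMem hA]; simp
    _ ≤ _ := setLIntegral_le_lintegral _ _

lemma memLp_heldOut (h : IsHeldOut k A H) (hWm : Measurable W)
    (hW : μ.map W = ν.prod (Measure.pi fun _ => P)) (hk : 0 < typeProb P k) (i : Fin N)
    (hB : ∀ᵐ ω ∂μ, ∫⁻ d, ‖H (W ω) ⟨k, d⟩‖ₑ ^ 2 ∂(typeLaw P k) ≤ B ω)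
    (hB_fin : ∫⁻ ω, B ω ∂μ ≠ ∞) : MemLp (fun ω => heldOut A H i (W ω)) 2 μ := by
  refine ⟨((h.measurable_heldOut i).comp hWm).aestronglyMeasurable, ?_⟩
  rw [eLpNorm_lt_top_iff_lintegral_rpow_enorm_lt_top (by simp) (by simp)]
  simpa using (h.lintegral_heldOut_sq_le hWm hW hk i hB).trans_lt hB_fin.lt_top

/-- The contributions of different held-out clusters are uncorrelated if they are centred given
the fit. -/
lemma integral_heldOut_mul_eq_zero (h : IsHeldOut k A H) (hWm : Measurable W)
    (hW : μ.map W = ν.prod (Measure.pi fun _ => P)) (hk : 0 < typeProb P k) {i j : Fin N}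
    (hij : j ≠ i)
    (hB : ∀ᵐ ω ∂μ, ∫⁻ d, ‖H (W ω) ⟨k, d⟩‖ₑ ^ 2 ∂(typeLaw P k) ≤ B ω)
    (hB_fin : ∫⁻ ω, B ω ∂μ ≠ ∞)
    (hmean : ∀ᵐ ω ∂μ, ∫ d, H (W ω) ⟨k, d⟩ ∂(typeLaw P k) = 0) :
    ∫ ω, heldOut A H i (W ω) * heldOut A H j (W ω) ∂μ = 0 := by
  have hs : MeasurableSet {ω | ((W ω).2 i).1 = k} :=
    hWm (measurable_typeAt i (measurableSet_singleton k))
  have hGm : Measurable fun q => heldOut A H i q * heldOut A H j q :=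
    (h.measurable_heldOut i).mul (h.measurable_heldOut j)
  have hT : Measurable fun p : Ω × D k =>
      (((W p.1).1, Function.update (W p.1).2 i ⟨k, p.2⟩) : 𝒰 × (Fin N → Σ k, D k)) :=
    (measurable_resample i k).comp ((hWm.comp measurable_fst).prodMk measurable_snd)
  have hint : Integrable (fun ω => heldOut A H i (W ω) * heldOut A H j (W ω)) μ :=
    (h.memLp_heldOut hWm hW hk i hB hB_fin).integrable_mul
      (h.memLp_heldOut hWm hW hk j hB hB_fin)
  have hint' := (integrable_map_measure (μ := μ.restrict {ω | ((W ω).2 i).1 = k})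
    hGm.aestronglyMeasurable hWm.aemeasurable).2 hint.restrict
  rw [← map_resample hWm hW hk i, integrable_map_measure hGm.aestronglyMeasurable
    hT.aemeasurable] at hint'
  calc ∫ ω, heldOut A H i (W ω) * heldOut A H j (W ω) ∂μ
      = ∫ ω in {ω | ((W ω).2 i).1 = k}, heldOut A H i (W ω) * heldOut A H j (W ω) ∂μ := by
        rw [← integral_indicator hs]
        refine integral_congr_ae (ae_of_all _ fun ω => ?_)
        by_cases hω : ((W ω).2 i).1 = k
        · simp [Set.indicator, hω]
        · simp [Set.indicator, hω, h.heldOut_eq_zero hω]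
    _ = ∫ ω in {ω | ((W ω).2 i).1 = k}, ∫ d,
          heldOut A H i ((W ω).1, Function.update (W ω).2 i ⟨k, d⟩) *
          heldOut A H j ((W ω).1, Function.update (W ω).2 i ⟨k, d⟩) ∂(typeLaw P k) ∂μ := by
        rw [← integral_map (f := fun q => heldOut A H i q * heldOut A H j q)
          hWm.aemeasurable hGm.aestronglyMeasurable, ← map_resample hWm hW hk i,
          integral_map hT.aemeasurable hGm.aestronglyMeasurable]
        exact integral_prod _ hint'
    _ = 0 := by
        refine integral_eq_zero_of_ae ?_
        filter_upwards [ae_restrict_of_ae hmean, ae_restrict_mem hs] with ω h1 h2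
        simp only [Pi.zero_apply]
        -- If cluster `i` is held out, factor `j` is constant in the fresh draw and factor `i`
        -- integrates to zero; otherwise factor `i` vanishes.
        by_cases hA : W ω ∈ A i
        · simp_rw [h.heldOut_update_of_ne hij hA, h.heldOut_update_self h2,
            Set.indicator_of_mem hA]
          rw [integral_mul_const, h1, zero_mul]
        · simp_rw [h.heldOut_update_self h2, Set.indicator_of_notMem hA]
          simp

/-- Orthogonality removes the cross terms, so the second moment grows like `N` and not `N ^ 2`. This
is the gain from cross-fitting. -/
lemma lintegral_sum_heldOut_sq_le (h : IsHeldOut k A H) (hWm : Measurable W)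
    (hW : μ.map W = ν.prod (Measure.pi fun _ => P)) (hk : 0 < typeProb P k)
    (hB : ∀ᵐ ω ∂μ, ∫⁻ d, ‖H (W ω) ⟨k, d⟩‖ₑ ^ 2 ∂(typeLaw P k) ≤ B ω)
    (hB_fin : ∫⁻ ω, B ω ∂μ ≠ ∞)
    (hmean : ∀ᵐ ω ∂μ, ∫ d, H (W ω) ⟨k, d⟩ ∂(typeLaw P k) = 0) :
    ∫⁻ ω, ‖∑ i, heldOut A H i (W ω)‖ₑ ^ 2 ∂μ ≤ N * ∫⁻ ω, B ω ∂μ := by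
  have hL := fun i => h.memLp_heldOut hWm hW hk i hB hB_fin
  have hsq : ∀ {f : Ω → ℝ}, MemLp f 2 μ →
      ∫⁻ ω, ‖f ω‖ₑ ^ 2 ∂μ = ENNReal.ofReal (∫ ω, f ω ^ 2 ∂μ) := by
    intro f hf
    rw [ofReal_integral_eq_lintegral_ofReal hf.integrable_sq (ae_of_all _ fun _ => sq_nonneg _)]
    refine lintegral_congr fun ω => ?_
    rw [← sq_abs, ENNReal.ofReal_pow (abs_nonneg _), ← Real.norm_eq_abs, ofReal_norm]
  have hint : ∀ i j, Integrable (fun ω => heldOut A H i (W ω) * heldOut A H j (W ω)) μ :=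
    fun i j => (hL i).integrable_mul (hL j)
  have hsum : ∫ ω, (∑ i, heldOut A H i (W ω)) ^ 2 ∂μ = ∑ i, ∫ ω, heldOut A H i (W ω) ^ 2 ∂μ := by
    simp_rw [sq, Finset.sum_mul_sum]
    rw [integral_finsetSum _ fun i _ => integrable_finsetSum _ fun j _ => hint i j]
    refine Finset.sum_congr rfl fun i _ => ?_
    rw [integral_finsetSum _ fun j _ => hint i j]
    refine Finset.sum_eq_single i (fun j _ hj => ?_) (by simp)
    exact h.integral_heldOut_mul_eq_zero hWm hW hk hj hB hB_fin hmean
  rw [hsq (memLp_finsetSum _ fun i _ => hL i), hsum,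
    ENNReal.ofReal_sum_of_nonneg fun i _ => integral_nonneg fun _ => sq_nonneg _]
  calc _ ≤ ∑ _i : Fin N, ∫⁻ ω, B ω ∂μ := by
        refine Finset.sum_le_sum fun i _ => ?_
        rw [← hsq (hL i)]
        exact h.lintegral_heldOut_sq_le hWm hW hk i hB
    _ = _ := by simp

end IsHeldOut

end Resample

/-! ### Cross-fitted scores -/

section CrossFitting

/-- A crude uniform bound that upgrades convergence of the nuisance distance in probability to
convergence in mean. -/
lemma nuisDist_le {m : ℕ} {S : Type*} [MeasurableSpace S] {π : Measure S} [IsProbabilityMeasure π]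
    {e e' : Trt m → S → ℝ} {g g' : Trt m → S → Outc m} {c c' C C' : ℝ}
    (hn : IsNuisance π e g c C) (hn' : IsNuisance π e' g' c' C') :
    nuisDist π e e' g g' ≤ ∑ _a : Trt m, ((C + C') ^ 2 + 2 ^ 2) := by
  refine Finset.sum_le_sum fun a _ => add_le_add ?_ ?_
  · refine (integral_mono_ae (hn.memLp_sub_g hn' a).norm.integrable_sq
      (integrable_const ((C + C') ^ 2)) ?_).trans (by simp)
    filter_upwards [hn.norm_g_le a, hn'.norm_g_le a] with x h1 h2
    exact pow_le_pow_left₀ (norm_nonneg _) ((norm_sub_le _ _).trans (add_le_add h1 h2)) 2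
  · refine (integral_mono_ae (hn.memLp_sub_e hn' a).norm.integrable_sq
      (integrable_const ((2 : ℝ) ^ 2)) ?_).trans (by simp)
    filter_upwards [hn.norm_e_le a, hn'.norm_e_le a] with x h1 h2
    refine pow_le_pow_left₀ (norm_nonneg _) ((norm_sub_le _ _).trans ?_) 2
    linarith

lemma lintegral_sub_integral_sq_le {α : Type*} [MeasurableSpace α] {ρ : Measure α}
    [IsProbabilityMeasure ρ] {f : α → ℝ} (hf : MemLp f 2 ρ) :
    ∫⁻ x, ‖f x - ∫ y, f y ∂ρ‖ₑ ^ 2 ∂ρ ≤ ∫⁻ x, ‖f x‖ₑ ^ 2 ∂ρ := by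
  have h1 : ∫⁻ x, ‖f x - ∫ y, f y ∂ρ‖ₑ ^ 2 ∂ρ = ENNReal.ofReal Var[f; ρ] :=
    hf.ofReal_variance_eq.symm
  rw [h1]
  refine (ENNReal.ofReal_le_ofReal (variance_le_expectation_sq hf.aestronglyMeasurable)).trans ?_
  simp only [Pi.pow_apply]
  rw [ofReal_integral_eq_lintegral_ofReal hf.integrable_sq (ae_of_all _ fun _ => sq_nonneg _)]
  refine lintegral_mono fun x => ?_
  rw [← sq_abs, ENNReal.ofReal_pow (abs_nonneg _), ← Real.norm_eq_abs, ofReal_norm]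

variable {K : ℕ} {M : Fin K → ℕ} {S : Fin K → Type*} [∀ k, MeasurableSpace (S k)]
  {𝒰 : Type*} [MeasurableSpace 𝒰] {Ω : Type*} [MeasurableSpace Ω]

/-- Two-fold cross-fitting with a random split that depends on the cluster types and on external
randomness only. -/
structure IsCrossFit (μ : Measure Ω) (Z : ℕ → Ω → ObsCluster M S) (U : Ω → 𝒰)
    (split : (N : ℕ) → 𝒰 → (Fin N → Fin K) → Fin N → Fin 2)
    (fold : (N : ℕ) → Ω → Fin N → Fin 2)
    (learnE : (N : ℕ) → Fin 2 → 𝒰 → (Fin N → Unit ⊕ ObsCluster M S) →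
      ∀ k, Trt (M k) → S k → ℝ)
    (learnG : (N : ℕ) → Fin 2 → 𝒰 → (Fin N → Unit ⊕ ObsCluster M S) →
      ∀ k, Trt (M k) → S k → Outc (M k))
    (eT : (N : ℕ) → Ω → Fin 2 → ∀ k, Trt (M k) → S k → ℝ)
    (gT : (N : ℕ) → Ω → Fin 2 → ∀ k, Trt (M k) → S k → Outc (M k))
    (P : Measure (ObsCluster M S)) : Prop where
  measurable_sample : ∀ i, Measurable (Z i)
  indep_sample : iIndepFun Z μ
  law_sample : ∀ i, μ.map (Z i) = P
  measurable_ext : Measurable U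
  indep_ext : IndepFun U (fun ω i => Z i ω) μ
  measurable_split : ∀ N t, Measurable fun u => split N u t
  fold_eq : ∀ N ω, fold N ω = split N (U ω) (fun i => (Z i ω).1)
  measurable_learnE : ∀ N ℓ k a, Measurable
    fun q : 𝒰 × (Fin N → Unit ⊕ ObsCluster M S) × S k => learnE N ℓ q.1 q.2.1 k a q.2.2
  measurable_learnG : ∀ N ℓ k a, Measurable
    fun q : 𝒰 × (Fin N → Unit ⊕ ObsCluster M S) × S k => learnG N ℓ q.1 q.2.1 k a q.2.2
  eT_eq : ∀ N ω ℓ, eT N ω ℓ = learnE N ℓ (U ω) (trainData (fold N ω) (fun i => Z i ω) ℓ)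
  gT_eq : ∀ N ω ℓ, gT N ω ℓ = learnG N ℓ (U ω) (trainData (fold N ω) (fun i => Z i ω) ℓ)

/-- The score at the estimated minus the score at the true nuisance functions. -/
def phiDiff (w : ∀ k, Trt (M k) → S k → Outc (M k)) (P : Measure (ObsCluster M S))
    [IsFiniteMeasure P] (e : ∀ k, Trt (M k) → S k → ℝ) (g : ∀ k, Trt (M k) → S k → Outc (M k))
    (k : Fin K) (z : ObsCluster M S) : ℝ :=
  phi w e g k z - phi w (propensity P) (outcomeReg P) k z

lemma phiDiff_mk_same (w : ∀ k, Trt (M k) → S k → Outc (M k)) (P : Measure (ObsCluster M S))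
    [IsFiniteMeasure P] (e : ∀ k, Trt (M k) → S k → ℝ) (g : ∀ k, Trt (M k) → S k → Outc (M k))
    (k : Fin K) (o : ObsData (M k) (S k)) : phiDiff w P e g k ⟨k, o⟩ =
      phiOf (w k) (e k) (g k) o - phiOf (w k) (propensity P k) (outcomeReg P k) o := by
  rw [phiDiff, phi_mk_same, phi_mk_same]

lemma phiDiff_of_ne (w : ∀ k, Trt (M k) → S k → Outc (M k)) (P : Measure (ObsCluster M S))
    [IsFiniteMeasure P] (e : ∀ k, Trt (M k) → S k → ℝ) (g : ∀ k, Trt (M k) → S k → Outc (M k))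
    {k : Fin K} {z : ObsCluster M S} (h : z.1 ≠ k) : phiDiff w P e g k z = 0 := by
  obtain ⟨l, o⟩ := z
  rw [phiDiff, phi_mk_of_ne _ _ _ h, phi_mk_of_ne _ _ _ h, sub_zero]

/-- The conditional mean, within type `k`, of the difference of the scores. -/
def biasOf (w : ∀ k, Trt (M k) → S k → Outc (M k)) (P : Measure (ObsCluster M S))
    [IsFiniteMeasure P] (e : ∀ k, Trt (M k) → S k → ℝ) (g : ∀ k, Trt (M k) → S k → Outc (M k))
    (k : Fin K) : ℝ :=
  ∫ d, phiDiff w P e g k ⟨k, d⟩ ∂(typeLaw P k)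

/-! ### Folds and fitted functions as functions of the sample -/

section Deterministic

variable {N : ℕ} (split : (N : ℕ) → 𝒰 → (Fin N → Fin K) → Fin N → Fin 2) (ℓ : Fin 2)
  (learnE : (N : ℕ) → Fin 2 → 𝒰 → (Fin N → Unit ⊕ ObsCluster M S) → ∀ k, Trt (M k) → S k → ℝ)
  (learnG : (N : ℕ) → Fin 2 → 𝒰 → (Fin N → Unit ⊕ ObsCluster M S) →
    ∀ k, Trt (M k) → S k → Outc (M k))

/-- The folds as a function of the external randomness and the sample. -/
def foldAt (q : 𝒰 × (Fin N → ObsCluster M S)) : Fin N → Fin 2 :=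
  split N q.1 fun i => (q.2 i).1

/-- The propensity score fitted without fold `ℓ`. -/
def fitE (q : 𝒰 × (Fin N → ObsCluster M S)) : ∀ k, Trt (M k) → S k → ℝ :=
  learnE N ℓ q.1 (trainData (foldAt split q) q.2 ℓ)

/-- The outcome regression fitted without fold `ℓ`. -/
def fitG (q : 𝒰 × (Fin N → ObsCluster M S)) : ∀ k, Trt (M k) → S k → Outc (M k) :=
  learnG N ℓ q.1 (trainData (foldAt split q) q.2 ℓ)

/-- Cluster `i` is of type `k` and in fold `ℓ`. -/
def heldSet (k : Fin K) (i : Fin N) : Set (𝒰 × (Fin N → ObsCluster M S)) :=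
  {q | foldAt split q i = ℓ ∧ (q.2 i).1 = k}

variable {split} {ℓ} {learnE} {learnG}

/-- The split sees only the types, and the replacement has the same type. -/
lemma foldAt_update {k : Fin K} {i : Fin N} {q : 𝒰 × (Fin N → ObsCluster M S)}
    (hq : (q.2 i).1 = k) (d : ObsData (M k) (S k)) :
    foldAt split (q.1, Function.update q.2 i ⟨k, d⟩) = foldAt split q := by
  unfold foldAt
  congr 1
  funext j
  by_cases h : j = i
  · subst h; simp [hq]
  · simp [Function.update_of_ne h]

/-- The folds do not move, and the record of a held-out cluster is the dummy before and after. Hence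
the functions fitted without its fold cannot notice the replacement. -/
lemma trainData_update {k : Fin K} {i : Fin N} {q : 𝒰 × (Fin N → ObsCluster M S)}
    (hq : q ∈ heldSet split ℓ k i) (d : ObsData (M k) (S k)) :
    trainData (foldAt split (q.1, Function.update q.2 i ⟨k, d⟩))
      (Function.update q.2 i ⟨k, d⟩) ℓ = trainData (foldAt split q) q.2 ℓ := by
  rw [foldAt_update hq.2]
  funext j
  unfold trainData
  by_cases h : j = i
  · subst h; simp [hq.1]
  · simp [Function.update_of_ne h]

lemma mem_heldSet_update {k : Fin K} {i j : Fin N} {q : 𝒰 × (Fin N → ObsCluster M S)}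
    (hq : (q.2 i).1 = k) (d : ObsData (M k) (S k)) :
    (q.1, Function.update q.2 i ⟨k, d⟩) ∈ heldSet split ℓ k j ↔ q ∈ heldSet split ℓ k j := by
  simp only [heldSet, Set.mem_ofPred_eq, foldAt_update hq]
  refine and_congr_right fun _ => ?_
  by_cases h : j = i
  · subst h; simp [hq]
  · simp [Function.update_of_ne h]

lemma measurable_foldAt (hsplit : ∀ t, Measurable fun u => split N u t) :
    Measurable (foldAt (M := M) (S := S) (N := N) split) := by
  have h : Measurable fun p : 𝒰 × (Fin N → Fin K) => split N p.1 p.2 :=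
    measurable_from_prod_countable_left hsplit
  exact h.comp (measurable_fst.prodMk (measurable_pi_lambda _ fun i => measurable_typeAt i))

lemma measurableSet_foldAt (hsplit : ∀ t, Measurable fun u => split N u t) (i : Fin N) :
    MeasurableSet {q : 𝒰 × (Fin N → ObsCluster M S) | foldAt split q i = ℓ} :=
  ((measurable_pi_apply i).comp (measurable_foldAt hsplit)) (measurableSet_singleton ℓ)

lemma measurable_trainAt (hsplit : ∀ t, Measurable fun u => split N u t) :
    Measurable fun q : 𝒰 × (Fin N → ObsCluster M S) => trainData (foldAt split q) q.2 ℓ := by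
  refine measurable_pi_lambda _ fun i => ?_
  exact Measurable.ite (measurableSet_foldAt hsplit i) measurable_const
    (measurable_inr.comp ((measurable_pi_apply i).comp measurable_snd))

lemma measurable_phi_fit {w : ∀ k, Trt (M k) → S k → Outc (M k)}
    (hw : ∀ k a, Measurable (w k a)) (hsplit : ∀ t, Measurable fun u => split N u t)
    (hE : ∀ k a, Measurable
      fun q : 𝒰 × (Fin N → Unit ⊕ ObsCluster M S) × S k => learnE N ℓ q.1 q.2.1 k a q.2.2)
    (hG : ∀ k a, Measurable
      fun q : 𝒰 × (Fin N → Unit ⊕ ObsCluster M S) × S k => learnG N ℓ q.1 q.2.1 k a q.2.2)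
    (k : Fin K) :
    Measurable fun p : (𝒰 × (Fin N → ObsCluster M S)) × ObsCluster M S =>
      phi w (fitE split ℓ learnE p.1) (fitG split ℓ learnG p.1) k p.2 := by
  refine measurable_prod_sigma fun l => ?_
  by_cases h : l = k
  · subst h
    simp_rw [phi_mk_same]
    have h1 : ∀ l, Measurable fun p : (𝒰 × (Fin N → ObsCluster M S)) × S l =>
        (p.1.1, trainData (foldAt split p.1) p.1.2 ℓ, p.2) := fun l =>
      (measurable_fst.comp measurable_fst).prodMk
        (((measurable_trainAt hsplit).comp measurable_fst).prodMk measurable_snd)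
    exact measurable_phiOf_param (T := 𝒰 × (Fin N → ObsCluster M S))
      (e := fun q => fitE split ℓ learnE q l) (g := fun q => fitG split ℓ learnG q l) (hw l)
      (fun a => (hE l a).comp (h1 l)) (fun a => (hG l a).comp (h1 l))
  · simp_rw [phi_mk_of_ne w _ _ h]
    exact measurable_const

/-- `H` is kept abstract to serve both the score difference and its version centred given the fit.
-/
lemma isHeldOut_fit
    (hsplit : ∀ t, Measurable fun u => split N u t)
    {H : (∀ k, Trt (M k) → S k → ℝ) → (∀ k, Trt (M k) → S k → Outc (M k)) →
      ObsCluster M S → ℝ} (k : Fin K)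
    (hH : Measurable fun p : (𝒰 × (Fin N → ObsCluster M S)) × ObsCluster M S =>
      H (fitE split ℓ learnE p.1) (fitG split ℓ learnG p.1) p.2) :
    IsHeldOut k (heldSet split ℓ k) fun q : 𝒰 × (Fin N → ObsCluster M S) =>
      H (fitE split ℓ learnE q) (fitG split ℓ learnG q) where
  measurableSet i := (measurableSet_foldAt hsplit i).inter
    (measurable_typeAt i (measurableSet_singleton k))
  measurable := hH
  type_eq i q hq := hq.2
  mem_iff i j q d hq := mem_heldSet_update hq d
  fit_eq i q d hq := by
    simp only [fitE, fitG, trainData_update hq d]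

end Deterministic

end CrossFitting

/-! ### The cross-fitted scores are asymptotically equivalent to the true scores -/

namespace IsCrossFit

variable {K : ℕ} {M : Fin K → ℕ} {S : Fin K → Type*} [∀ k, MeasurableSpace (S k)]
  {𝒰 : Type*} [MeasurableSpace 𝒰] {Ω : Type*} [MeasurableSpace Ω] {μ : Measure Ω}
  {Z : ℕ → Ω → ObsCluster M S} {U : Ω → 𝒰}
  {split : (N : ℕ) → 𝒰 → (Fin N → Fin K) → Fin N → Fin 2} {fold : (N : ℕ) → Ω → Fin N → Fin 2}
  {learnE : (N : ℕ) → Fin 2 → 𝒰 → (Fin N → Unit ⊕ ObsCluster M S) →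
      ∀ k, Trt (M k) → S k → ℝ}
  {learnG : (N : ℕ) → Fin 2 → 𝒰 → (Fin N → Unit ⊕ ObsCluster M S) →
      ∀ k, Trt (M k) → S k → Outc (M k)}
  {eT : (N : ℕ) → Ω → Fin 2 → ∀ k, Trt (M k) → S k → ℝ}
  {gT : (N : ℕ) → Ω → Fin 2 → ∀ k, Trt (M k) → S k → Outc (M k)}
  {P : Measure (ObsCluster M S)}
  {w : ∀ k, Trt (M k) → S k → Outc (M k)} {Cw c C V ct Ct : ℝ}

lemma measurable_joint (h : IsCrossFit μ Z U split fold learnE learnG eT gT P) (N : ℕ) :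
    Measurable fun ω => (U ω, fun i : Fin N => Z i ω) :=
  h.measurable_ext.prodMk (measurable_pi_lambda _ fun _ => h.measurable_sample _)

lemma fold_eq_foldAt (h : IsCrossFit μ Z U split fold learnE learnG eT gT P) (N : ℕ) (ω : Ω) :
    fold N ω = foldAt split (U ω, fun i : Fin N => Z i ω) := h.fold_eq N ω

lemma eT_eq_fitE (h : IsCrossFit μ Z U split fold learnE learnG eT gT P) (N : ℕ) (ω : Ω)
    (ℓ : Fin 2) : eT N ω ℓ = fitE split ℓ learnE (U ω, fun i : Fin N => Z i ω) := by
  rw [h.eT_eq, h.fold_eq_foldAt]; rfl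

lemma gT_eq_fitG (h : IsCrossFit μ Z U split fold learnE learnG eT gT P) (N : ℕ) (ω : Ω)
    (ℓ : Fin 2) : gT N ω ℓ = fitG split ℓ learnG (U ω, fun i : Fin N => Z i ω) := by
  rw [h.gT_eq, h.fold_eq_foldAt]; rfl

lemma measurable_sum_phi (h : IsCrossFit μ Z U split fold learnE learnG eT gT P)
    (hw : ∀ k a, Measurable (w k a)) (N : ℕ) (ℓ : Fin 2) (k : Fin K) :
    Measurable fun ω => ∑ i with fold N ω i = ℓ, phi w (eT N ω ℓ) (gT N ω ℓ) k (Z i ω) := by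
  simp_rw [Finset.sum_filter, h.fold_eq_foldAt, h.eT_eq_fitE, h.gT_eq_fitG]
  refine Finset.measurable_fun_sum _ fun i _ => ?_
  refine Measurable.ite
    (h.measurable_joint N (measurableSet_foldAt (h.measurable_split N) i)) ?_ measurable_const
  exact (measurable_phi_fit hw (h.measurable_split N) (h.measurable_learnE N ℓ)
    (h.measurable_learnG N ℓ) k).comp ((h.measurable_joint N).prodMk (h.measurable_sample i))

/-- Clusters of other types contribute nothing because `H` and `Ψ ∘ H` vanish there. `Ψ` is the
square for the variance estimator and the identity for the estimator itself. -/
lemma sum_fold_eq_sum_heldOut (h : IsCrossFit μ Z U split fold learnE learnG eT gT P) (N : ℕ)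
    (ℓ : Fin 2) (k : Fin K)
    (H : (∀ k, Trt (M k) → S k → ℝ) → (∀ k, Trt (M k) → S k → Outc (M k)) → ObsCluster M S → ℝ)
    (hH : ∀ e g z, z.1 ≠ k → H e g z = 0) (Ψ : ℝ → ℝ) (hΨ : Ψ 0 = 0) (ω : Ω) :
    ∑ i with fold N ω i = ℓ, Ψ (H (eT N ω ℓ) (gT N ω ℓ) (Z i ω)) =
      ∑ i : Fin N, Ψ (heldOut (heldSet split ℓ k)
        (fun q => H (fitE split ℓ learnE q) (fitG split ℓ learnG q)) i
        (U ω, fun i : Fin N => Z i ω)) := by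
  simp_rw [Finset.sum_filter, h.eT_eq_fitE, h.gT_eq_fitG, h.fold_eq_foldAt]
  refine Finset.sum_congr rfl fun i _ => ?_
  by_cases h1 : foldAt split (U ω, fun i : Fin N => Z i ω) i = ℓ
  · by_cases h2 : (Z i ω).1 = k
    · rw [if_pos h1, heldOut, Set.indicator_of_mem]
      exact ⟨h1, h2⟩
    · rw [if_pos h1, hH _ _ _ h2, heldOut, Set.indicator_of_notMem]
      exact fun hmem => h2 hmem.2
  · rw [if_neg h1, heldOut, Set.indicator_of_notMem, hΨ]
    exact fun hmem => h1 hmem.1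

lemma map_joint [IsProbabilityMeasure μ]
    (h : IsCrossFit μ Z U split fold learnE learnG eT gT P) (N : ℕ) :
    μ.map (fun ω => (U ω, fun i : Fin N => Z i ω)) = (μ.map U).prod (Measure.pi fun _ => P) :=
  map_prodMk_eq_prod_pi h.measurable_sample h.indep_sample h.law_sample h.measurable_ext
    h.indep_ext N

variable [IsProbabilityMeasure P]

lemma measurable_phiDiff_fit (h : IsCrossFit μ Z U split fold learnE learnG eT gT P)
    (hR : IsRegularLaw P w Cw c C V) (N : ℕ) (ℓ : Fin 2) (k : Fin K) :
    Measurable fun p : (𝒰 × (Fin N → ObsCluster M S)) × ObsCluster M S =>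
      phiDiff w P (fitE split ℓ learnE p.1) (fitG split ℓ learnG p.1) k p.2 :=
  (measurable_phi_fit (fun k => (hR.weight k).meas) (h.measurable_split N)
    (h.measurable_learnE N ℓ) (h.measurable_learnG N ℓ) k).sub
      ((hR.measurable_phi k).comp measurable_snd)

lemma memLp_phiDiff_type (hR : IsRegularLaw P w Cw c C V) (hct : 0 < ct) {k : Fin K}
    {e : ∀ k, Trt (M k) → S k → ℝ} {g : ∀ k, Trt (M k) → S k → Outc (M k)}
    (hn : IsNuisance (covLaw P k) (e k) (g k) ct Ct) :
    MemLp (fun d => phiDiff w P e g k ⟨k, d⟩) 2 (typeLaw P k) := by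
  have := hR.isProbabilityMeasure k
  simp_rw [phiDiff_mk_same]
  exact (memLp_phiOf (hR.memLp_outcome k) (hR.weight k) hct hn).sub
    (memLp_phiOf (hR.memLp_outcome k) (hR.weight k) hR.overlap_pos (hR.nuisance k))

variable [IsProbabilityMeasure μ]

/-- A vanishing bound on the conditional second moments of the score differences. -/
lemma exists_bound (hR : IsRegularLaw P w Cw c C V) (hct : 0 < ct)
    (hn : ∀ N ℓ k, ∀ᵐ ω ∂μ, IsNuisance (covLaw P k) (eT N ω ℓ k) (gT N ω ℓ k) ct Ct)
    (hdist : ∀ ℓ k, IsLittleOP μ fun N ω => nuisDist (covLaw P k) (propensity P k) (eT N ω ℓ k)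
      (outcomeReg P k) (gT N ω ℓ k)) (ℓ : Fin 2) (k : Fin K) :
    ∃ B : ℕ → Ω → ℝ≥0∞, (∀ N, ∫⁻ ω, B N ω ∂μ ≠ ∞) ∧
      (∀ ε : ℝ, 0 < ε → ∀ᶠ N in atTop, ∫⁻ ω, B N ω ∂μ ≤ ENNReal.ofReal ε) ∧
      ∀ N, ∀ᵐ ω ∂μ, ∫⁻ d, ‖phiDiff w P (eT N ω ℓ) (gT N ω ℓ) k ⟨k, d⟩‖ₑ ^ 2 ∂(typeLaw P k) ≤
        B N ω := by
  have := hR.isProbabilityMeasure k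
  obtain ⟨B, hB0, hB⟩ := exists_lintegral_phiOf_sub_sq_le (hR.weight k) hR.var_nonneg (hR.var_le k)
    hR.overlap_pos (hR.nuisance k) hct Ct
  set R : ℕ → Ω → ℝ := fun N ω => B * nuisDist (covLaw P k) (propensity P k) (eT N ω ℓ k)
      (outcomeReg P k) (gT N ω ℓ k) with hRdef
  -- A nonrandom bound on `R`. It makes the means finite and permits bounded convergence.
  set B' : ℝ := B * ∑ _a : Trt (M k), ((C + Ct) ^ 2 + 2 ^ 2)
  have : IsProbabilityMeasure (covLaw P k) :=
    inferInstanceAs (IsProbabilityMeasure (covLawOf (typeLaw P k)))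
  have hbd : ∀ N, ∀ᵐ ω ∂μ, R N ω ≤ B' := fun N => (hn N ℓ k).mono fun ω hω =>
    mul_le_mul_of_nonneg_left (nuisDist_le (hR.nuisance k) hω) hB0
  have hR0 : ∀ N ω, 0 ≤ R N ω := fun N ω => mul_nonneg hB0 (nuisDist_nonneg _ _ _ _ _)
  refine ⟨fun N ω => ENNReal.ofReal (R N ω), fun N => ?_, fun ε hε => ?_, fun N => ?_⟩
  · refine ne_top_of_le_ne_top (b := ENNReal.ofReal B') ENNReal.ofReal_ne_top ?_
    calc _ ≤ ∫⁻ _, ENNReal.ofReal B' ∂μ :=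
          lintegral_mono_ae ((hbd N).mono fun ω hω => ENNReal.ofReal_le_ofReal hω)
      _ = _ := by simp
  · refine ((hdist ℓ k).const_mul B).eventually_lintegral_le (B := B') (fun N => ?_) hε
    refine (hbd N).mono fun ω hω => ?_
    rw [abs_of_nonneg (hR0 N ω)]
    exact hω
  · refine (hn N ℓ k).mono fun ω hω => ?_
    simp_rw [phiDiff_mk_same]
    exact hB _ _ hω

/-- Each held-out square has mean at most the expected bound `B N`, so the average does as well;
convergence in mean gives convergence in probability. No centring or orthogonality is needed. -/
lemma isLittleOP_mean_phiDiff_sq (h : IsCrossFit μ Z U split fold learnE learnG eT gT P)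
    (hR : IsRegularLaw P w Cw c C V) (hct : 0 < ct)
    (hn : ∀ N ℓ k, ∀ᵐ ω ∂μ, IsNuisance (covLaw P k) (eT N ω ℓ k) (gT N ω ℓ k) ct Ct)
    (hdist : ∀ ℓ k, IsLittleOP μ fun N ω => nuisDist (covLaw P k) (propensity P k) (eT N ω ℓ k)
      (outcomeReg P k) (gT N ω ℓ k)) (ℓ : Fin 2) (k : Fin K) :
    IsLittleOP μ fun N ω => (N : ℝ)⁻¹ *
      ∑ i with fold N ω i = ℓ, phiDiff w P (eT N ω ℓ) (gT N ω ℓ) k (Z i ω) ^ 2 := by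
  have := Measure.isProbabilityMeasure_map (μ := μ) h.measurable_ext.aemeasurable
  obtain ⟨B, -, hB, hle⟩ := exists_bound hR hct hn hdist ℓ k
  have heq := fun N ω => h.sum_fold_eq_sum_heldOut N ℓ k (fun e g z => phiDiff w P e g k z)
    (fun e g z hz => phiDiff_of_ne w P e g hz) (· ^ 2) (by simp) ω
  simp_rw [heq]
  have hheld := fun N => isHeldOut_fit (H := fun e g z => phiDiff w P e g k z)
    (h.measurable_split N) k (h.measurable_phiDiff_fit hR N ℓ k)
  have hm : ∀ N (i : Fin N), Measurable fun ω => heldOut (heldSet split ℓ k)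
      (fun q => phiDiff w P (fitE split ℓ learnE q) (fitG split ℓ learnG q) k) i
        (U ω, fun i : Fin N => Z i ω) :=
    fun N i => ((hheld N).measurable_heldOut i).comp (h.measurable_joint N)
  refine isLittleOP_of_lintegral (fun N => ?_) fun ε hε => ?_
  · exact ((Finset.measurable_fun_sum _ fun i _ => (hm N i).pow_const 2).const_mul _).aemeasurable
  · filter_upwards [hB ε hε, eventually_gt_atTop 0] with N hN hN0
    refine le_trans ?_ hN
    have hN' : (0 : ℝ) < N := by exact_mod_cast hN0
    have hterm := fun i => (hheld N).lintegral_heldOut_sq_le (h.measurable_joint N) (h.map_joint N)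
      (hR.pos k) i (B := B N) (by
        have := hle N
        simp_rw [h.eT_eq_fitE, h.gT_eq_fitG] at this
        exact this)
    simp_rw [enorm_mul]
    rw [lintegral_const_mul _ (Finset.measurable_fun_sum _ fun i _ => (hm N i).pow_const 2).enorm]
    calc _ ≤ ‖(N : ℝ)⁻¹‖ₑ * ∑ i : Fin N, ∫⁻ ω, ‖heldOut (heldSet split ℓ k)
            (fun q => phiDiff w P (fitE split ℓ learnE q) (fitG split ℓ learnG q) k) i
              (U ω, fun i : Fin N => Z i ω)‖ₑ ^ 2 ∂μ := by
          gcongr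
          rw [← lintegral_finsetSum _ fun i _ => (hm N i).enorm.pow_const 2]
          refine lintegral_mono fun ω => (enorm_sum_le _ _).trans_eq ?_
          simp_rw [enorm_pow]
      _ ≤ ‖(N : ℝ)⁻¹‖ₑ * ∑ _i : Fin N, ∫⁻ ω, B N ω ∂μ :=
          mul_le_mul' le_rfl (Finset.sum_le_sum fun i _ => hterm i)
      _ = ∫⁻ ω, B N ω ∂μ := by
          rw [Finset.sum_const, Finset.card_univ, Fintype.card_fin, nsmul_eq_mul, ← mul_assoc,
            Real.enorm_of_nonneg (by positivity), ENNReal.ofReal_inv_of_pos hN',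
            ENNReal.ofReal_natCast, ENNReal.inv_mul_cancel (by simpa using hN0.ne') (by simp),
            one_mul]

/-- Subtracting the mean given the fit makes the terms orthogonal, so the squared normalized sum has
mean at most that of `B N`, which tends to zero without any rate. -/
lemma isLittleOP_centred_sum (h : IsCrossFit μ Z U split fold learnE learnG eT gT P)
    (hR : IsRegularLaw P w Cw c C V) (hct : 0 < ct)
    (hn : ∀ N ℓ k, ∀ᵐ ω ∂μ, IsNuisance (covLaw P k) (eT N ω ℓ k) (gT N ω ℓ k) ct Ct)
    (hdist : ∀ ℓ k, IsLittleOP μ fun N ω => nuisDist (covLaw P k) (propensity P k) (eT N ω ℓ k)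
      (outcomeReg P k) (gT N ω ℓ k)) (ℓ : Fin 2) (k : Fin K) :
    IsLittleOP μ fun N ω => (√N)⁻¹ * ∑ i with fold N ω i = ℓ,
      (phiDiff w P (eT N ω ℓ) (gT N ω ℓ) k (Z i ω) -
        typeInd k (Z i ω) * biasOf w P (eT N ω ℓ) (gT N ω ℓ) k) := by
  have := Measure.isProbabilityMeasure_map (μ := μ) h.measurable_ext.aemeasurable
  have := hR.isProbabilityMeasure k
  obtain ⟨B, hBfin, hB, hle⟩ := exists_bound hR hct hn hdist ℓ k
  -- The factor `typeInd k` keeps the centred difference zero off type `k`; within type `k` it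
  -- equals one and the subtracted constant is the exact mean.
  set H : (∀ k, Trt (M k) → S k → ℝ) → (∀ k, Trt (M k) → S k → Outc (M k)) →
      ObsCluster M S → ℝ := fun e g z => phiDiff w P e g k z - typeInd k z * biasOf w P e g k
    with hH
  have heq := fun N ω => h.sum_fold_eq_sum_heldOut N ℓ k H
    (fun e g z hz => by simp [hH, phiDiff_of_ne w P e g hz, typeInd, hz]) id rfl ω
  have hHm : ∀ N, Measurable fun p : (𝒰 × (Fin N → ObsCluster M S)) × ObsCluster M S =>
      H (fitE split ℓ learnE p.1) (fitG split ℓ learnG p.1) p.2 := by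
    intro N
    have h1 := h.measurable_phiDiff_fit hR N ℓ k
    have h2 : Measurable fun q : 𝒰 × (Fin N → ObsCluster M S) =>
        biasOf w P (fitE split ℓ learnE q) (fitG split ℓ learnG q) k := by
      have h3 : Measurable fun p : (𝒰 × (Fin N → ObsCluster M S)) × ObsData (M k) (S k) =>
          phiDiff w P (fitE split ℓ learnE p.1) (fitG split ℓ learnG p.1) k ⟨k, p.2⟩ :=
        h1.comp (measurable_fst.prodMk ((measurable_sigmaMk k).comp measurable_snd))
      exact h3.stronglyMeasurable.integral_prod_right.measurable
    exact h1.sub (((measurable_typeInd k).comp measurable_snd).mul (h2.comp measurable_fst))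
  have hheld := fun N => isHeldOut_fit (H := H) (h.measurable_split N) k (hHm N)
  simp only [id] at heq
  change IsLittleOP μ fun N ω => (√N)⁻¹ * ∑ i with fold N ω i = ℓ, H (eT N ω ℓ) (gT N ω ℓ) (Z i ω)
  simp_rw [heq]
  have hHk : ∀ e g d, H e g ⟨k, d⟩ = phiDiff w P e g k ⟨k, d⟩ -
      ∫ d, phiDiff w P e g k ⟨k, d⟩ ∂(typeLaw P k) := by
    intro e g d
    simp [hH, typeInd, biasOf]
  have hm : ∀ N, Measurable fun ω => ∑ i : Fin N, heldOut (heldSet split ℓ k)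
      (fun q => H (fitE split ℓ learnE q) (fitG split ℓ learnG q)) i
        (U ω, fun i : Fin N => Z i ω) := fun N =>
    Finset.measurable_fun_sum _ fun i _ =>
      ((hheld N).measurable_heldOut i).comp (h.measurable_joint N)
  refine IsLittleOP.of_sq (isLittleOP_of_lintegral (fun N => ?_) fun ε hε => ?_)
  · exact (((hm N).const_mul _).pow_const 2).aemeasurable
  · filter_upwards [hB ε hε, eventually_gt_atTop 0] with N hN hN0
    refine le_trans ?_ hN
    have hN' : (0 : ℝ) < N := by exact_mod_cast hN0
    have hsum := (hheld N).lintegral_sum_heldOut_sq_le (h.measurable_joint N) (h.map_joint N)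
      (hR.pos k) (B := B N) (by
        filter_upwards [hle N, hn N ℓ k] with ω h1 h2
        rw [← h.eT_eq_fitE, ← h.gT_eq_fitG]
        simp_rw [hHk]
        exact (lintegral_sub_integral_sq_le (memLp_phiDiff_type hR hct h2)).trans h1) (hBfin N) (by
        filter_upwards [hn N ℓ k] with ω h2
        rw [← h.eT_eq_fitE, ← h.gT_eq_fitG]
        simp_rw [hHk]
        have hi := (memLp_phiDiff_type hR hct h2).integrable one_le_two
        rw [integral_sub hi (integrable_const _)]
        simp)
    simp_rw [mul_pow, enorm_mul, enorm_pow]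
    rw [lintegral_const_mul _ ((hm N).enorm.pow_const 2)]
    calc _ ≤ ‖(√N)⁻¹‖ₑ ^ 2 * (N * ∫⁻ ω, B N ω ∂μ) := by gcongr
      _ = ∫⁻ ω, B N ω ∂μ := by
          rw [← enorm_pow, inv_pow, Real.sq_sqrt hN'.le, ← mul_assoc,
            Real.enorm_of_nonneg (by positivity), ENNReal.ofReal_inv_of_pos hN',
            ENNReal.ofReal_natCast, ENNReal.inv_mul_cancel (by simpa using hN0.ne') (by simp),
            one_mul]

/-- The bias is a product of nuisance errors, hence negligible. -/
lemma isLittleOP_sqrt_mul_bias (hR : IsRegularLaw P w Cw c C V) (hct : 0 < ct)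
    (hn : ∀ N ℓ k, ∀ᵐ ω ∂μ, IsNuisance (covLaw P k) (eT N ω ℓ k) (gT N ω ℓ k) ct Ct)
    {rg re : ℕ → ℝ}
    (hg_rate : ∀ ℓ k a, IsBigOP μ
      (fun N ω => ∫ x, ‖outcomeReg P k a x - gT N ω ℓ k a x‖ ^ 2 ∂(covLaw P k))
        (fun N => rg N ^ 2))
    (he_rate : ∀ ℓ k a, IsBigOP μ
      (fun N ω => ∫ x, |propensity P k a x - eT N ω ℓ k a x| ^ 2 ∂(covLaw P k))
        (fun N => re N ^ 2))
    (hrate : (fun N => rg N * re N) =o[atTop] fun N : ℕ => (N : ℝ) ^ (-(1 / 2) : ℝ))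
    (ℓ : Fin 2) (k : Fin K) :
    IsLittleOP μ fun N ω => √N * biasOf w P (eT N ω ℓ) (gT N ω ℓ) k := by
  have := hR.isProbabilityMeasure k
  have hlim : Tendsto (fun N : ℕ => √N * (rg N * re N)) atTop (𝓝 0) := by
    have h1 := hrate.tendsto_div_nhds_zero
    refine h1.congr fun N => ?_
    rw [Real.rpow_neg (Nat.cast_nonneg N), div_inv_eq_mul, Real.sqrt_eq_rpow, mul_comm]
  have h1 : ∀ a : Trt (M k), IsLittleOP μ fun N ω => Cw / ct * (√N *
      (√(∫ x, ‖outcomeReg P k a x - gT N ω ℓ k a x‖ ^ 2 ∂(covLaw P k)) *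
        √(∫ x, |propensity P k a x - eT N ω ℓ k a x| ^ 2 ∂(covLaw P k)))) := fun a =>
    (((hg_rate ℓ k a).sqrt.mul (he_rate ℓ k a).sqrt).isLittleOP_mul hlim).const_mul _
  refine (IsLittleOP.sum Finset.univ fun a _ => h1 a).of_abs_le (Eventually.of_forall fun N => ?_)
  filter_upwards [hn N ℓ k] with ω hω
  have h2 := abs_integral_phiOf_sub_le ((hR.memLp_outcome k).integrable one_le_two) (hR.weight k)
    hR.overlap_pos (hR.nuisance k) hct hω
  rw [abs_mul, abs_of_nonneg (Real.sqrt_nonneg _)]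
  refine (mul_le_mul_of_nonneg_left (b := |biasOf w P (eT N ω ℓ) (gT N ω ℓ) k|)
    (c := ∑ a, Cw / ct * (√(∫ x, ‖outcomeReg P k a x - gT N ω ℓ k a x‖ ^ 2 ∂(covLaw P k)) *
      √(∫ x, |propensity P k a x - eT N ω ℓ k a x| ^ 2 ∂(covLaw P k)))) ?_
      (Real.sqrt_nonneg _)).trans (le_trans (le_of_eq ?_) (le_abs_self _))
  · unfold biasOf
    simp_rw [phiDiff_mk_same]
    exact h2
  · rw [Finset.mul_sum]
    exact Finset.sum_congr rfl fun a _ => by ring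

/-- The cross-fitted sum of scores is asymptotically equivalent to the sum of true scores. -/
lemma isLittleOP_sum_phiDiff (h : IsCrossFit μ Z U split fold learnE learnG eT gT P)
    (hR : IsRegularLaw P w Cw c C V) (hct : 0 < ct)
    (hn : ∀ N ℓ k, ∀ᵐ ω ∂μ, IsNuisance (covLaw P k) (eT N ω ℓ k) (gT N ω ℓ k) ct Ct)
    {rg re : ℕ → ℝ}
    (hg_rate : ∀ ℓ k a, IsBigOP μ
      (fun N ω => ∫ x, ‖outcomeReg P k a x - gT N ω ℓ k a x‖ ^ 2 ∂(covLaw P k))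
        (fun N => rg N ^ 2))
    (he_rate : ∀ ℓ k a, IsBigOP μ
      (fun N ω => ∫ x, |propensity P k a x - eT N ω ℓ k a x| ^ 2 ∂(covLaw P k))
        (fun N => re N ^ 2))
    (hdist : ∀ ℓ k, IsLittleOP μ fun N ω => nuisDist (covLaw P k) (propensity P k) (eT N ω ℓ k)
      (outcomeReg P k) (gT N ω ℓ k))
    (hrate : (fun N => rg N * re N) =o[atTop] fun N : ℕ => (N : ℝ) ^ (-(1 / 2) : ℝ))
    (k : Fin K) :
    IsLittleOP μ fun N ω => (√N)⁻¹ * ∑ ℓ, ∑ i with fold N ω i = ℓ,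
      phiDiff w P (eT N ω ℓ) (gT N ω ℓ) k (Z i ω) := by
  simp_rw [Finset.mul_sum (Finset.univ : Finset (Fin 2))]
  refine IsLittleOP.sum _ fun ℓ _ => ?_
  have h1 := h.isLittleOP_centred_sum hR hct hn hdist ℓ k
  have h2 := isLittleOP_sqrt_mul_bias hR hct hn hg_rate he_rate hrate ℓ k
  -- Undoing the centring adds the bias once for each held-out cluster of type `k`. There are at
  -- most `N` of them, so after normalization this is at most `√N` times the bias.
  have h3 : IsLittleOP μ fun N ω => (√N)⁻¹ * ((∑ i with fold N ω i = ℓ, typeInd k (Z i ω)) *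
      biasOf w P (eT N ω ℓ) (gT N ω ℓ) k) := by
    refine h2.of_abs_le ?_
    filter_upwards [eventually_gt_atTop 0] with N hN0
    have hN' : (0 : ℝ) < N := by exact_mod_cast hN0
    refine ae_of_all _ fun ω => ?_
    have hs0 : 0 ≤ ∑ i with fold N ω i = ℓ, typeInd k (Z i ω) :=
      Finset.sum_nonneg fun i _ => typeInd_nonneg k _
    have hsN : ∑ i with fold N ω i = ℓ, typeInd k (Z i ω) ≤ N :=
      calc _ ≤ ∑ i : Fin N, typeInd k (Z i ω) :=
            Finset.sum_le_sum_of_subset_of_nonneg (Finset.filter_subset _ _)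
              fun i _ _ => typeInd_nonneg k _
        _ ≤ ∑ _i : Fin N, (1 : ℝ) := Finset.sum_le_sum fun i _ => typeInd_le_one k _
        _ = N := by simp
    rw [abs_mul, abs_mul, abs_mul, ← mul_assoc, abs_of_nonneg hs0,
      abs_of_nonneg (inv_nonneg.2 (Real.sqrt_nonneg _)), abs_of_nonneg (Real.sqrt_nonneg _)]
    refine mul_le_mul_of_nonneg_right ?_ (abs_nonneg _)
    rw [inv_mul_le_iff₀ (Real.sqrt_pos.2 hN'), Real.mul_self_sqrt hN'.le]
    exact hsN
  refine (h1.add h3).congr (Eventually.of_forall fun N => ae_of_all _ fun ω => ?_)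
  rw [Finset.sum_sub_distrib, ← Finset.sum_mul]
  ring

end IsCrossFit

/-! ### Means of independent, identically distributed observations -/

section SampleMean

variable {Ω 𝒵 : Type*} [MeasurableSpace Ω] [MeasurableSpace 𝒵]

/-- The mean of `F` over the first `N` observations. -/
def sampleMean (Z : ℕ → Ω → 𝒵) (F : 𝒵 → ℝ) (N : ℕ) (ω : Ω) : ℝ :=
  (N : ℝ)⁻¹ * ∑ i : Fin N, F (Z i ω)

variable {μ : Measure Ω} {P : Measure 𝒵} {Z : ℕ → Ω → 𝒵} {F : 𝒵 → ℝ}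

lemma identDistrib_comp (hm : ∀ i, Measurable (Z i)) (hl : ∀ i, μ.map (Z i) = P)
    (hF : Measurable F) (i : ℕ) : IdentDistrib (fun ω => F (Z i ω)) (fun ω => F (Z 0 ω)) μ μ :=
  IdentDistrib.comp ⟨(hm i).aemeasurable, (hm 0).aemeasurable, (hl i).trans (hl 0).symm⟩ hF

lemma memLp_comp (hm : ∀ i, Measurable (Z i)) (hl : ∀ i, μ.map (Z i) = P) {p : ℝ≥0∞}
    (hF : MemLp F p P) (i : ℕ) : MemLp (fun ω => F (Z i ω)) p μ := by
  rw [← hl i] at hF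
  exact hF.comp_of_map (hm i).aemeasurable

lemma integral_comp_sample (hm : ∀ i, Measurable (Z i)) (hl : ∀ i, μ.map (Z i) = P)
    (hF : Measurable F) (i : ℕ) : ∫ ω, F (Z i ω) ∂μ = ∫ z, F z ∂P := by
  rw [← hl i, integral_map (hm i).aemeasurable hF.aestronglyMeasurable]

lemma measurable_sampleMean (hm : ∀ i, Measurable (Z i)) (hF : Measurable F) (N : ℕ) :
    Measurable (sampleMean Z F N) :=
  (Finset.measurable_fun_sum _ fun _ _ => hF.comp (hm _)).const_mul _

variable [IsProbabilityMeasure μ]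

lemma isLittleOP_sampleMean_sub (hm : ∀ i, Measurable (Z i)) (hi : iIndepFun Z μ)
    (hl : ∀ i, μ.map (Z i) = P) (hF : Measurable F) (hFi : Integrable F P) :
    IsLittleOP μ fun N ω => sampleMean Z F N ω - ∫ z, F z ∂P := by
  rw [← tendstoInMeasure_iff_isLittleOP]
  refine tendstoInMeasure_of_tendsto_ae
    (fun N => (measurable_sampleMean hm hF N).aestronglyMeasurable) ?_
  have h1 := strong_law_ae_real (μ := μ) (fun i ω => F (Z i ω))
    (memLp_one_iff_integrable.1 (memLp_comp hm hl (memLp_one_iff_integrable.2 hFi) 0))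
    (fun i j hij => (hi.indepFun hij).comp hF hF) (identDistrib_comp hm hl hF)
  filter_upwards [h1] with ω hω
  rw [integral_comp_sample hm hl hF] at hω
  refine hω.congr fun N => ?_
  rw [sampleMean, Fin.sum_univ_eq_sum_range (fun i => F (Z i ω)), div_eq_inv_mul]

/-- Chebyshev: for `N > 0` the normalized mean has second moment equal to the variance of `F`,
independently of `N`. The bound is obtained for the square and carried back by the square root. -/
lemma isBigOP_sqrt_mul_sampleMean (hm : ∀ i, Measurable (Z i)) (hi : iIndepFun Z μ)
    (hl : ∀ i, μ.map (Z i) = P) (hF : Measurable F) (hF2 : MemLp F 2 P) (hF0 : ∫ z, F z ∂P = 0) :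
    IsBigOP μ (fun N ω => √N * sampleMean Z F N ω) fun _ => 1 := by
  have hsq : IsBigOP μ (fun N ω => (√N * sampleMean Z F N ω) ^ 2) fun _ => (1 : ℝ) ^ 2 := by
    rw [show (fun _ : ℕ => (1 : ℝ) ^ 2) = fun _ => 1 by simp]
    refine isBigOP_of_lintegral (c := Var[F; P]) (fun N =>
      (((measurable_sampleMean hm hF N).const_mul _).pow_const 2).aemeasurable) ?_
    filter_upwards [eventually_gt_atTop 0] with N hN0
    have hN' : (0 : ℝ) < N := by exact_mod_cast hN0
    have hL : ∀ i : ℕ, MemLp (fun ω => F (Z i ω)) 2 μ := memLp_comp hm hl hF2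
    have hsum : MemLp (∑ i : Fin N, fun ω => F (Z i ω)) 2 μ := memLp_finsetSum' _ fun i _ => hL i
    have hvar : Var[∑ i : Fin N, fun ω => F (Z i ω); μ] = N * Var[F; P] := by
      rw [IndepFun.variance_sum (X := fun (i : Fin N) ω => F (Z i ω)) (fun i _ => hL i) fun i _ j _ hij =>
        (hi.indepFun (Fin.val_injective.ne hij)).comp hF hF]
      have : ∀ i : Fin N, Var[fun ω => F (Z i ω); μ] = Var[F; P] := by
        intro i
        rw [← hl i, variance_map hF.aemeasurable (hm i).aemeasurable]
        rfl
      simp [this]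
    have hmean : ∫ ω, (∑ i : Fin N, fun ω => F (Z i ω)) ω ∂μ = 0 := by
      simp_rw [Finset.sum_apply]
      rw [integral_finsetSum _ fun (i : Fin N) _ => (hL i).integrable one_le_two]
      simp_rw [integral_comp_sample hm hl hF, hF0]
      simp
    rw [variance_of_integral_eq_zero hsum.aemeasurable hmean] at hvar
    have hpt : ∀ ω, ‖(√N * sampleMean Z F N ω) ^ 2‖ₑ =
        ENNReal.ofReal ((N : ℝ)⁻¹ * (∑ i : Fin N, fun ω => F (Z i ω)) ω ^ 2) := by
      intro ω
      rw [Real.enorm_of_nonneg (sq_nonneg _), sampleMean, mul_pow, mul_pow, Real.sq_sqrt hN'.le,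
        Finset.sum_apply]
      congr 1
      field_simp
    simp_rw [hpt]
    rw [← ofReal_integral_eq_lintegral_ofReal (hsum.integrable_sq.const_mul _)
      (ae_of_all _ fun ω => by positivity), integral_const_mul, hvar]
    refine ENNReal.ofReal_le_ofReal (le_of_eq ?_)
    field_simp
  have h1 := hsq.sqrt
  intro ε hε
  obtain ⟨B, hB⟩ := h1 ε hε
  refine ⟨B, hB.mono fun N hN => (measureReal_mono fun ω hω => ?_).trans hN⟩
  simp only [Set.mem_ofPred_eq] at hω ⊢
  rwa [Real.sqrt_sq_eq_abs, abs_abs]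

lemma tendstoInDistribution_sqrt_mul_sampleMean (hm : ∀ i, Measurable (Z i)) (hi : iIndepFun Z μ)
    (hl : ∀ i, μ.map (Z i) = P) (hF : Measurable F) (hF2 : MemLp F 2 P) (hF0 : ∫ z, F z ∂P = 0) :
    TendstoInDistribution (fun (N : ℕ) ω => √N * sampleMean Z F N ω) atTop (fun y : ℝ => y)
      (fun _ => μ) (gaussianReal 0 Var[F; P].toNNReal) := by
  have hvar : Var[fun ω => F (Z 0 ω); μ] = Var[F; P] := by
    rw [← hl 0, variance_map hF.aemeasurable (hm 0).aemeasurable]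
    rfl
  have h1 := tendstoInDistribution_inv_sqrt_mul_sum_sub (P := μ) (X := fun i ω => F (Z i ω))
    (P' := gaussianReal 0 Var[F; P].toNNReal) (Y := fun y : ℝ => y)
    (by rw [hvar]; exact ⟨aemeasurable_id, Measure.map_id⟩)
    (memLp_comp hm hl hF2 0) (hi.comp _ fun _ => hF) (identDistrib_comp hm hl hF)
  rw [integral_comp_sample hm hl hF, hF0] at h1
  refine cast ?_ h1
  congr 1
  funext N ω
  rw [sampleMean, Fin.sum_univ_eq_sum_range (fun i => F (Z i ω)), mul_zero, sub_zero, ← mul_assoc]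
  congr 1
  rw [← div_eq_mul_inv, Real.sqrt_div_self']
  simp

end SampleMean

/-! ### Asymptotic linearity and the variance estimator -/

section Linearization

lemma sum_fold {N : ℕ} (f : Fin N → Fin 2) (F : Fin 2 → Fin N → ℝ) :
    ∑ ℓ, ∑ i with f i = ℓ, F ℓ i = ∑ i, F (f i) i := by
  rw [← Finset.sum_fiberwise Finset.univ f]
  refine Finset.sum_congr rfl fun ℓ _ => Finset.sum_congr rfl fun i hi => ?_
  rw [(Finset.mem_filter.1 hi).2]

/-- From `a ^ 2 - b ^ 2 = (a - b) ^ 2 + 2 (a - b) b` and Cauchy–Schwarz. It reduces consistency of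
the variance estimator to a vanishing mean square deviation of the influence values. -/
lemma abs_mean_sq_sub_mean_sq_le {N : ℕ} (a b : Fin N → ℝ) :
    |(N : ℝ)⁻¹ * ∑ i, a i ^ 2 - (N : ℝ)⁻¹ * ∑ i, b i ^ 2| ≤
      (N : ℝ)⁻¹ * ∑ i, (a i - b i) ^ 2 +
        2 * √(((N : ℝ)⁻¹ * ∑ i, (a i - b i) ^ 2) * ((N : ℝ)⁻¹ * ∑ i, b i ^ 2)) := by
  have h1 : (N : ℝ)⁻¹ * ∑ i, a i ^ 2 - (N : ℝ)⁻¹ * ∑ i, b i ^ 2 =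
      (N : ℝ)⁻¹ * ∑ i, (a i - b i) ^ 2 + 2 * ((N : ℝ)⁻¹ * ∑ i, (a i - b i) * b i) := by
    rw [← mul_sub, ← Finset.sum_sub_distrib, mul_left_comm, ← mul_add]
    congr 1
    rw [Finset.mul_sum, ← Finset.sum_add_distrib]
    exact Finset.sum_congr rfl fun i _ => by ring
  have h2 : |(N : ℝ)⁻¹ * ∑ i, (a i - b i) * b i| ≤
      √(((N : ℝ)⁻¹ * ∑ i, (a i - b i) ^ 2) * ((N : ℝ)⁻¹ * ∑ i, b i ^ 2)) := by
    refine Real.abs_le_sqrt ?_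
    have := Finset.sum_mul_sq_le_sq_mul_sq Finset.univ (fun i => a i - b i) b
    calc _ = (N : ℝ)⁻¹ ^ 2 * (∑ i, (a i - b i) * b i) ^ 2 := mul_pow _ _ _
      _ ≤ (N : ℝ)⁻¹ ^ 2 * ((∑ i, (a i - b i) ^ 2) * ∑ i, b i ^ 2) := by gcongr
      _ = _ := by ring
  have h3 : 0 ≤ (N : ℝ)⁻¹ * ∑ i, (a i - b i) ^ 2 := by positivity
  rw [h1]
  refine (abs_add_le _ _).trans ?_
  rw [abs_of_nonneg h3, abs_mul, abs_two]
  gcongr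

variable {K : ℕ} {M : Fin K → ℕ} {S : Fin K → Type*} [∀ k, MeasurableSpace (S k)]
  {Ω : Type*} [MeasurableSpace Ω] {μ : Measure Ω}
  {Z : ℕ → Ω → ObsCluster M S} {fold : (N : ℕ) → Ω → Fin N → Fin 2}
  {eT : (N : ℕ) → Ω → Fin 2 → ∀ k, Trt (M k) → S k → ℝ}
  {gT : (N : ℕ) → Ω → Fin 2 → ∀ k, Trt (M k) → S k → Outc (M k)}
  {P : Measure (ObsCluster M S)}
  {w : ∀ k, Trt (M k) → S k → Outc (M k)} {v : Fin K → ℝ → ℝ} {Cw c C V : ℝ}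

lemma pHat_eq_sampleMean (N : ℕ) (ω : Ω) (k : Fin K) :
    pHat (fun i : Fin N => Z i ω) k = sampleMean Z (typeInd k) N ω := by
  rw [pHat, typeCount, sampleMean, Finset.card_filter, div_eq_inv_mul]
  push_cast
  rfl

lemma thetaTilde_eq_div {N : ℕ} (e : Fin 2 → ∀ k, Trt (M k) → S k → ℝ)
    (g : Fin 2 → ∀ k, Trt (M k) → S k → Outc (M k)) (f : Fin N → Fin 2)
    (z : Fin N → ObsCluster M S) (k : Fin K) : thetaTilde w e g f z k =
      ((N : ℝ)⁻¹ * ∑ ℓ, ∑ i with f i = ℓ, phi w (e ℓ) (g ℓ) k (z i)) / pHat z k := by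
  rw [thetaTilde, pHat]
  rcases Nat.eq_zero_or_pos N with rfl | hN
  · simp
  · have : (N : ℝ) ≠ 0 := by positivity
    rw [div_div_eq_mul_div, inv_mul_eq_div, div_mul_cancel₀ _ this]

variable [IsProbabilityMeasure P]

lemma mean_phi_eq (N : ℕ) (ω : Ω) (k : Fin K) :
    (N : ℝ)⁻¹ * ∑ ℓ, ∑ i with fold N ω i = ℓ, phi w (eT N ω ℓ) (gT N ω ℓ) k (Z i ω) =
      sampleMean Z (phi w (propensity P) (outcomeReg P) k) N ω +
        (N : ℝ)⁻¹ * ∑ ℓ, ∑ i with fold N ω i = ℓ,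
          phiDiff w P (eT N ω ℓ) (gT N ω ℓ) k (Z i ω) := by
  rw [sum_fold (fold N ω) fun ℓ i => phi w (eT N ω ℓ) (gT N ω ℓ) k (Z i ω),
    sum_fold (fold N ω) fun ℓ i => phiDiff w P (eT N ω ℓ) (gT N ω ℓ) k (Z i ω), sampleMean,
    ← mul_add, ← Finset.sum_add_distrib]
  congr 1
  refine Finset.sum_congr rfl fun i _ => ?_
  rw [phiDiff]
  ring

lemma sampleMean_inflObs {N : ℕ} (hN : 0 < N) (ω : Ω) :
    sampleMean Z (inflObs w v P) N ω =
      ∑ k, ((v k (typeProb P k) / typeProb P k) *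
          sampleMean Z (phi w (propensity P) (outcomeReg P) k) N ω +
        (deriv (v k) (typeProb P k) * thetaObs w P k -
          v k (typeProb P k) / typeProb P k * thetaObs w P k) *
          pHat (fun i : Fin N => Z i ω) k -
        typeProb P k * deriv (v k) (typeProb P k) * thetaObs w P k) := by
  have hN' : (N : ℝ) ≠ 0 := by positivity
  simp_rw [pHat_eq_sampleMean, sampleMean, inflObs_eq]
  rw [Finset.sum_comm, Finset.mul_sum]
  refine Finset.sum_congr rfl fun k _ => ?_
  rw [Finset.sum_sub_distrib, Finset.sum_add_distrib, ← Finset.mul_sum, ← Finset.mul_sum,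
    Finset.sum_const, Finset.card_univ, Fintype.card_fin, nsmul_eq_mul]
  field_simp

/-- `v(p) θ` as a function of `p` and `p θ`, with value `0` at `p = 0`. -/
lemma hasDerivAt_div_mul {v : ℝ → ℝ} {p : ℝ} (hp : 0 < p) (hv : DifferentiableAt ℝ v p) :
    HasDerivAt (fun x => v x / x * x) (deriv v p) p := by
  refine hv.hasDerivAt.congr_of_eventuallyEq ?_
  filter_upwards [eventually_ne_nhds hp.ne'] with x hx
  exact div_mul_cancel₀ _ hx

/-- An exact delta-method expansion in which each summand has a factor vanishing in probability and
a factor bounded in probability. `dslope` gives the difference quotient its limit at equality, hence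
continuity. The function `v x / x * x` is used in place of `v` so that the identity also holds when
no cluster of type `k` is sampled and the divisions by zero return zero. -/
lemma sqrt_mul_tauTilde_sub_eq (hpos : ∀ k, 0 < typeProb P k) {N : ℕ} (hN : 0 < N) (ω : Ω) :
    √N * (tauTilde w v (eT N ω) (gT N ω) (fold N ω) (fun i : Fin N => Z i ω) -
        ∑ k, v k (typeProb P k) * thetaObs w P k) - √N * sampleMean Z (inflObs w v P) N ω =
      ∑ k, ((v k (sampleMean Z (typeInd k) N ω) / sampleMean Z (typeInd k) N ω) *
          ((√N)⁻¹ * ∑ ℓ, ∑ i with fold N ω i = ℓ,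
            phiDiff w P (eT N ω ℓ) (gT N ω ℓ) k (Z i ω)) +
        (v k (sampleMean Z (typeInd k) N ω) / sampleMean Z (typeInd k) N ω -
            v k (typeProb P k) / typeProb P k) *
          (√N * sampleMean Z (fun z => phi w (propensity P) (outcomeReg P) k z -
            thetaObs w P k * typeInd k z) N ω) +
        thetaObs w P k * ((dslope (fun x => v k x / x * x) (typeProb P k)
            (sampleMean Z (typeInd k) N ω) - deriv (v k) (typeProb P k)) *
          (√N * sampleMean Z (fun z => typeInd k z - typeProb P k) N ω))) := by
  have hN' : (0 : ℝ) < N := by exact_mod_cast hN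
  rw [sampleMean_inflObs hN, tauTilde, ← mul_sub, ← Finset.sum_sub_distrib,
    ← Finset.sum_sub_distrib, Finset.mul_sum]
  refine Finset.sum_congr rfl fun k _ => ?_
  have h1 : sampleMean Z (fun z => typeInd k z - typeProb P k) N ω =
      sampleMean Z (typeInd k) N ω - typeProb P k := by
    simp only [sampleMean, Finset.sum_sub_distrib, mul_sub]
    simp [hN'.ne']
  have h2 : sampleMean Z (fun z => phi w (propensity P) (outcomeReg P) k z -
      thetaObs w P k * typeInd k z) N ω =
      sampleMean Z (phi w (propensity P) (outcomeReg P) k) N ω -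
        thetaObs w P k * sampleMean Z (typeInd k) N ω := by
    simp only [sampleMean, Finset.sum_sub_distrib, mul_sub, ← Finset.mul_sum]
    ring
  rw [thetaTilde_eq_div, mean_phi_eq (P := P), pHat_eq_sampleMean, h1, h2]
  have h3 := sub_smul_dslope (fun x => v k x / x * x) (typeProb P k)
    (sampleMean Z (typeInd k) N ω)
  rw [smul_eq_mul, div_mul_cancel₀ _ (hpos k).ne'] at h3
  have h4 : (√N)⁻¹ = √N * (N : ℝ)⁻¹ := by
    rw [← div_eq_mul_inv, Real.sqrt_div_self', one_div]
  rw [h4]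
  generalize dslope (fun x => v k x / x * x) (typeProb P k) (sampleMean Z (typeInd k) N ω) = sl at *
  generalize sampleMean Z (typeInd k) N ω = p' at *
  generalize sampleMean Z (phi w (propensity P) (outcomeReg P) k) N ω = s at *
  generalize ∑ ℓ, ∑ i with fold N ω i = ℓ, phiDiff w P (eT N ω ℓ) (gT N ω ℓ) k (Z i ω) = d at *
  linear_combination (-√N * thetaObs w P k) * h3

lemma memLp_typeInd (k : Fin K) : MemLp (typeInd (M := M) (S := S) k) 2 P :=
  MemLp.of_bound (measurable_typeInd k).aestronglyMeasurable 1 (ae_of_all _ fun z => by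
    rw [Real.norm_of_nonneg (typeInd_nonneg k z)]; exact typeInd_le_one k z)

variable [IsProbabilityMeasure μ]

lemma isLittleOP_pHat_sub (hm : ∀ i, Measurable (Z i)) (hi : iIndepFun Z μ)
    (hl : ∀ i, μ.map (Z i) = P) (k : Fin K) :
    IsLittleOP μ fun N ω => sampleMean Z (typeInd k) N ω - typeProb P k := by
  rw [← integral_typeInd]
  exact isLittleOP_sampleMean_sub hm hi hl (measurable_typeInd k) (integrable_typeInd k)

/-- The estimator is asymptotically linear with the efficient influence function. -/
lemma isLittleOP_sqrt_mul_tauTilde_sub (hm : ∀ i, Measurable (Z i)) (hi : iIndepFun Z μ)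
    (hl : ∀ i, μ.map (Z i) = P) (hR : IsRegularLaw P w Cw c C V)
    (hv : ∀ k, DifferentiableAt ℝ (v k) (typeProb P k))
    (hdiff : ∀ k, IsLittleOP μ fun N ω => (√N)⁻¹ * ∑ ℓ, ∑ i with fold N ω i = ℓ,
      phiDiff w P (eT N ω ℓ) (gT N ω ℓ) k (Z i ω)) :
    IsLittleOP μ fun N ω =>
      √N * (tauTilde w v (eT N ω) (gT N ω) (fold N ω) (fun i : Fin N => Z i ω) -
        ∑ k, v k (typeProb P k) * thetaObs w P k) - √N * sampleMean Z (inflObs w v P) N ω := by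
  have hp := isLittleOP_pHat_sub (P := P) hm hi hl
  have hu : ∀ k, IsLittleOP μ fun N ω =>
      v k (sampleMean Z (typeInd k) N ω) / sampleMean Z (typeInd k) N ω -
        v k (typeProb P k) / typeProb P k := fun k =>
    (hp k).comp_continuousAt (f := fun x => v k x / x)
      ((hv k).continuousAt.div continuousAt_id (hR.pos k).ne')
  -- In order: the nuisance error times a convergent coefficient; the error of `v(p̂) / p̂` times a
  -- centred normalized mean; the error of the slope times the normalized error of `p̂`.
  have hterm := fun k =>
    (((hdiff k).mul (isBigOP_of_sub _ (hu k))).add ((hu k).mul (isBigOP_sqrt_mul_sampleMean hm hi hl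
      (F := fun z => phi w (propensity P) (outcomeReg P) k z - thetaObs w P k * typeInd k z)
      ((hR.measurable_phi k).sub ((measurable_typeInd k).const_mul _))
      ((hR.memLp_phi k).sub ((memLp_typeInd k).const_mul _)) (by
        rw [integral_sub ((hR.memLp_phi k).integrable one_le_two)
          ((integrable_typeInd k).const_mul _), integral_const_mul, hR.integral_phi_eq,
          integral_typeInd]
        ring)))).add
    (((((hp k).comp_continuousAt
      (continuousAt_dslope_same.2 (hasDerivAt_div_mul (hR.pos k) (hv k)).differentiableAt)).congr
        (X := fun N ω => dslope (fun x => v k x / x * x) (typeProb P k)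
          (sampleMean Z (typeInd k) N ω) - deriv (v k) (typeProb P k)) (by
        refine Eventually.of_forall fun N => ae_of_all _ fun ω => ?_
        rw [dslope_same, (hasDerivAt_div_mul (hR.pos k) (hv k)).deriv])).mul
      (isBigOP_sqrt_mul_sampleMean hm hi hl (F := fun z => typeInd k z - typeProb P k)
        ((measurable_typeInd k).sub_const _)
        ((memLp_typeInd k).sub (memLp_const _)) (by
          rw [integral_sub (integrable_typeInd k) (integrable_const _), integral_typeInd]
          simp))).const_mul (thetaObs w P k))
  refine (IsLittleOP.sum Finset.univ fun k _ => hterm k).congr ?_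
  filter_upwards [eventually_gt_atTop 0] with N hN
  refine ae_of_all _ fun ω => ?_
  rw [sqrt_mul_tauTilde_sub_eq hR.pos hN]
  exact Finset.sum_congr rfl fun k _ => by ring

end Linearization

/-! ### Consistency of the variance estimator -/

section VarianceEstimator

variable {K : ℕ} {M : Fin K → ℕ} {S : Fin K → Type*} [∀ k, MeasurableSpace (S k)]
  {Ω : Type*} [MeasurableSpace Ω] {μ : Measure Ω}
  {Z : ℕ → Ω → ObsCluster M S} {fold : (N : ℕ) → Ω → Fin N → Fin 2}
  {eT : (N : ℕ) → Ω → Fin 2 → ∀ k, Trt (M k) → S k → ℝ}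
  {gT : (N : ℕ) → Ω → Fin 2 → ∀ k, Trt (M k) → S k → Outc (M k)}
  {P : Measure (ObsCluster M S)}
  {w : ∀ k, Trt (M k) → S k → Outc (M k)} {v : Fin K → ℝ → ℝ} {Cw c C V : ℝ}

/-- The estimated influence function, as it enters the variance estimator. -/
def inflHat (w : ∀ k, Trt (M k) → S k → Outc (M k)) (v : Fin K → ℝ → ℝ)
    (e : ∀ k, Trt (M k) → S k → ℝ) (g : ∀ k, Trt (M k) → S k → Outc (M k)) (p θ : Fin K → ℝ)
    (z : ObsCluster M S) : ℝ :=
  ∑ k, (typeInd k z * v k (p k) / p k * (phi w e g k z - θ k) +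
    (typeInd k z - p k) * deriv (v k) (p k) * θ k)

variable [IsProbabilityMeasure P]

/-- The deviation is sorted by source: the fitted nuisance functions, then the coefficients of the
true score, of the type indicator and of the constant. Apart from the first, each source enters
through a scalar that converges to zero. -/
lemma inflHat_sub_inflObs (e : ∀ k, Trt (M k) → S k → ℝ) (g : ∀ k, Trt (M k) → S k → Outc (M k))
    (p θ : Fin K → ℝ) (z : ObsCluster M S) :
    inflHat w v e g p θ z - inflObs w v P z =
      ∑ k, (v k (p k) / p k * phiDiff w P e g k z +
        (v k (p k) / p k - v k (typeProb P k) / typeProb P k) *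
          phi w (propensity P) (outcomeReg P) k z +
        ((deriv (v k) (p k) - v k (p k) / p k) * θ k -
          (deriv (v k) (typeProb P k) - v k (typeProb P k) / typeProb P k) * thetaObs w P k) *
            typeInd k z -
        (p k * deriv (v k) (p k) * θ k -
          typeProb P k * deriv (v k) (typeProb P k) * thetaObs w P k)) := by
  rw [inflHat, inflObs_eq, ← Finset.sum_sub_distrib]
  refine Finset.sum_congr rfl fun k _ => ?_
  have h1 := typeInd_mul_phi w e g k z
  rw [phiDiff]
  linear_combination (v k (p k) / p k) * h1

lemma sq_add_add_sub_le (a b c d : ℝ) :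
    (a + b + c - d) ^ 2 ≤ 4 * (a ^ 2 + b ^ 2 + c ^ 2 + d ^ 2) := by
  nlinarith [sq_nonneg (a - b), sq_nonneg (a - c), sq_nonneg (a + d), sq_nonneg (b - c),
    sq_nonneg (b + d), sq_nonneg (c + d)]

lemma inflHat_sub_inflObs_sq_le (e : ∀ k, Trt (M k) → S k → ℝ)
    (g : ∀ k, Trt (M k) → S k → Outc (M k)) (p θ : Fin K → ℝ) (z : ObsCluster M S) :
    (inflHat w v e g p θ z - inflObs w v P z) ^ 2 ≤
      (4 * K : ℝ) * ∑ k, ((v k (p k) / p k) ^ 2 * phiDiff w P e g k z ^ 2 +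
        (v k (p k) / p k - v k (typeProb P k) / typeProb P k) ^ 2 *
          phi w (propensity P) (outcomeReg P) k z ^ 2 +
        ((deriv (v k) (p k) - v k (p k) / p k) * θ k -
          (deriv (v k) (typeProb P k) - v k (typeProb P k) / typeProb P k) * thetaObs w P k) ^ 2 +
        (p k * deriv (v k) (p k) * θ k -
          typeProb P k * deriv (v k) (typeProb P k) * thetaObs w P k) ^ 2) := by
  rw [inflHat_sub_inflObs]
  refine sq_sum_le_card_mul_sum_sq.trans ?_
  rw [Finset.card_univ, Fintype.card_fin, mul_comm (4 : ℝ), mul_assoc]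
  refine mul_le_mul_of_nonneg_left ?_ (Nat.cast_nonneg K)
  rw [Finset.mul_sum]
  refine Finset.sum_le_sum fun k _ => (sq_add_add_sub_le _ _ _ _).trans ?_
  simp only [mul_pow]
  gcongr
  refine mul_le_of_le_one_right (sq_nonneg _) ?_
  exact pow_le_one₀ (typeInd_nonneg k z) (typeInd_le_one k z)

lemma sigmaTildeSq_eq {N : ℕ} (e : Fin 2 → ∀ k, Trt (M k) → S k → ℝ)
    (g : Fin 2 → ∀ k, Trt (M k) → S k → Outc (M k)) (f : Fin N → Fin 2)
    (z : Fin N → ObsCluster M S) : sigmaTildeSq w v e g f z =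
      (N : ℝ)⁻¹ * ∑ i, inflHat w v (e (f i)) (g (f i)) (pHat z) (thetaTilde w e g f z) (z i) ^ 2 := by
  rw [sigmaTildeSq, one_div]
  congr 1
  exact sum_fold f fun ℓ i => inflHat w v (e ℓ) (g ℓ) (pHat z) (thetaTilde w e g f z) (z i) ^ 2

variable [IsProbabilityMeasure μ]

/-- The normalized sum of fitted scores tends to `p_k θ_k` by the law of large numbers, and it is
divided by the consistent `p̂_k`. -/
lemma isLittleOP_thetaTilde_sub (hm : ∀ i, Measurable (Z i)) (hi : iIndepFun Z μ)
    (hl : ∀ i, μ.map (Z i) = P) (hR : IsRegularLaw P w Cw c C V)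
    (hdiff : ∀ k, IsLittleOP μ fun N ω => (√N)⁻¹ * ∑ ℓ, ∑ i with fold N ω i = ℓ,
      phiDiff w P (eT N ω ℓ) (gT N ω ℓ) k (Z i ω)) (k : Fin K) :
    IsLittleOP μ fun N ω =>
      thetaTilde w (eT N ω) (gT N ω) (fold N ω) (fun i : Fin N => Z i ω) k - thetaObs w P k := by
  have hp := (hR.pos k).ne'
  have h1 : IsLittleOP μ fun N ω => (N : ℝ)⁻¹ * ∑ ℓ, ∑ i with fold N ω i = ℓ,
      phiDiff w P (eT N ω ℓ) (gT N ω ℓ) k (Z i ω) := by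
    refine (hdiff k).of_abs_le ?_
    filter_upwards [eventually_gt_atTop 0] with N hN
    refine ae_of_all _ fun ω => ?_
    have hN1 : (1 : ℝ) ≤ N := by exact_mod_cast hN
    rw [abs_mul, abs_mul]
    refine mul_le_mul_of_nonneg_right ?_ (abs_nonneg _)
    rw [abs_of_nonneg (by positivity), abs_of_nonneg (by positivity)]
    refine inv_anti₀ (Real.sqrt_pos.2 (by linarith)) ?_
    rw [Real.sqrt_le_left (by linarith)]
    nlinarith
  have h2 := isLittleOP_sampleMean_sub hm hi hl (hR.measurable_phi k)
    ((hR.memLp_phi k).integrable one_le_two)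
  rw [hR.integral_phi_eq] at h2
  have h3 : IsLittleOP μ fun N ω => (N : ℝ)⁻¹ * ∑ ℓ, ∑ i with fold N ω i = ℓ,
      phi w (eT N ω ℓ) (gT N ω ℓ) k (Z i ω) - typeProb P k * thetaObs w P k := by
    refine (h2.add h1).congr (Eventually.of_forall fun N => ae_of_all _ fun ω => ?_)
    rw [mean_phi_eq (P := P)]
    ring
  have h4 := (isLittleOP_pHat_sub (P := P) hm hi hl k).comp_continuousAt
    (f := fun x => x⁻¹) (continuousAt_inv₀ hp)
  refine (h3.sub_mul_sub h4).congr (Eventually.of_forall fun N => ae_of_all _ fun ω => ?_)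
  rw [thetaTilde_eq_div, pHat_eq_sampleMean, ← div_eq_mul_inv, ← div_eq_mul_inv,
    mul_div_cancel_left₀ _ hp]

/-- The variance estimator is consistent. -/
lemma isLittleOP_sigmaTildeSq_sub (hm : ∀ i, Measurable (Z i)) (hi : iIndepFun Z μ)
    (hl : ∀ i, μ.map (Z i) = P) (hR : IsRegularLaw P w Cw c C V)
    (hv : ∀ k, ContinuousAt (v k) (typeProb P k))
    (hv' : ∀ k, ContinuousAt (deriv (v k)) (typeProb P k))
    (hdiff : ∀ k, IsLittleOP μ fun N ω => (√N)⁻¹ * ∑ ℓ, ∑ i with fold N ω i = ℓ,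
      phiDiff w P (eT N ω ℓ) (gT N ω ℓ) k (Z i ω))
    (hsq : ∀ ℓ k, IsLittleOP μ fun N ω => (N : ℝ)⁻¹ *
      ∑ i with fold N ω i = ℓ, phiDiff w P (eT N ω ℓ) (gT N ω ℓ) k (Z i ω) ^ 2) :
    IsLittleOP μ fun N ω =>
      sigmaTildeSq w v (eT N ω) (gT N ω) (fold N ω) (fun i : Fin N => Z i ω) -
        Var[inflObs w v P; P] := by
  set ph : Fin K → ℕ → Ω → ℝ := fun k N ω => sampleMean Z (typeInd k) N ω
  set th : Fin K → ℕ → Ω → ℝ := fun k N ω =>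
    thetaTilde w (eT N ω) (gT N ω) (fold N ω) (fun i : Fin N => Z i ω) k
  have hp := fun k => isLittleOP_pHat_sub (P := P) hm hi hl k
  have hθ : ∀ k, IsLittleOP μ fun N ω => th k N ω - thetaObs w P k :=
    isLittleOP_thetaTilde_sub hm hi hl hR hdiff
  have hu : ∀ k, IsLittleOP μ fun N ω =>
      v k (ph k N ω) / ph k N ω - v k (typeProb P k) / typeProb P k := fun k =>
    (hp k).comp_continuousAt (f := fun x => v k x / x)
      ((hv k).div continuousAt_id (hR.pos k).ne')
  have hd : ∀ k, IsLittleOP μ fun N ω =>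
      (deriv (v k) (ph k N ω) - v k (ph k N ω) / ph k N ω) -
        (deriv (v k) (typeProb P k) - v k (typeProb P k) / typeProb P k) := fun k =>
    (hp k).comp_continuousAt (f := fun x => deriv (v k) x - v k x / x)
      ((hv' k).sub ((hv k).div continuousAt_id (hR.pos k).ne'))
  have hpd : ∀ k, IsLittleOP μ fun N ω =>
      ph k N ω * deriv (v k) (ph k N ω) - typeProb P k * deriv (v k) (typeProb P k) := fun k =>
    (hp k).comp_continuousAt (f := fun x => x * deriv (v k) x) (continuousAt_id.mul (hv' k))
  have hsqo : ∀ {X : ℕ → Ω → ℝ}, IsLittleOP μ X → IsLittleOP μ fun N ω => X N ω ^ 2 :=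
    fun h => by simpa only [sq] using h.mul h.isBigOP
  have hφ : ∀ k, IsBigOP μ
      (sampleMean Z fun z => phi w (propensity P) (outcomeReg P) k z ^ 2) fun _ => 1 := fun k =>
    isBigOP_of_sub _ (isLittleOP_sampleMean_sub hm hi hl ((hR.measurable_phi k).pow_const 2)
      (hR.memLp_phi k).integrable_sq)
  have hu2 : ∀ k, IsBigOP μ (fun N ω => (v k (ph k N ω) / ph k N ω) ^ 2) fun _ => 1 := fun k => by
    simpa [sq] using (isBigOP_of_sub _ (hu k)).mul (isBigOP_of_sub _ (hu k))
  -- These are the four terms of `inflHat_sub_inflObs_sq_le` averaged over the sample; the two with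
  -- scalar coefficients do not depend on the observation.
  have hterm := fun k => ((((IsLittleOP.sum Finset.univ fun ℓ _ => hsq ℓ k).mul (hu2 k)).add
      ((hsqo (hu k)).mul (hφ k))).add
      (hsqo ((hd k).sub_mul_sub (hθ k)))).add (hsqo ((hpd k).sub_mul_sub (hθ k)))
  set a : ∀ N, Ω → Fin N → ℝ := fun N ω i => inflHat w v (eT N ω (fold N ω i)) (gT N ω (fold N ω i))
    (fun k => ph k N ω) (fun k => th k N ω) (Z i ω) with ha
  have hdev : IsLittleOP μ fun N ω => (N : ℝ)⁻¹ * ∑ i, (a N ω i - inflObs w v P (Z i ω)) ^ 2 := by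
    refine ((IsLittleOP.sum Finset.univ fun k _ => hterm k).const_mul (4 * K)).of_abs_le ?_
    filter_upwards [eventually_gt_atTop 0] with N hN
    refine ae_of_all _ fun ω => ?_
    have hN' : (0 : ℝ) < N := by exact_mod_cast hN
    rw [abs_of_nonneg (by positivity)]
    refine le_trans ?_ (le_abs_self _)
    refine (mul_le_mul_of_nonneg_left (Finset.sum_le_sum fun i _ => inflHat_sub_inflObs_sq_le _ _ _ _
      _) (inv_nonneg.2 hN'.le)).trans (le_of_eq ?_)
    rw [← Finset.mul_sum, mul_left_comm, Finset.sum_comm, Finset.mul_sum (Finset.univ : Finset (Fin K))]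
    congr 1
    refine Finset.sum_congr rfl fun k _ => ?_
    rw [Finset.sum_add_distrib, Finset.sum_add_distrib, Finset.sum_add_distrib, ← Finset.mul_sum,
      ← Finset.mul_sum, Finset.sum_const, Finset.sum_const, Finset.card_univ, Fintype.card_fin,
      nsmul_eq_mul, nsmul_eq_mul, ← Finset.mul_sum,
      sum_fold (fold N ω) fun ℓ i => phiDiff w P (eT N ω ℓ) (gT N ω ℓ) k (Z i ω) ^ 2, sampleMean]
    field_simp
  have hmean := isLittleOP_sampleMean_sub hm hi hl ((hR.measurable_inflObs (v := v)).pow_const 2)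
    (hR.memLp_inflObs (v := v)).integrable_sq
  rw [← variance_of_integral_eq_zero hR.measurable_inflObs.aemeasurable hR.integral_inflObs] at hmean
  -- The cross term of the quadratic comparison: a vanishing deviation times a bounded second
  -- moment, carried through the square root by continuity at zero.
  have hsqrt := (show IsLittleOP μ fun N ω =>
      ((N : ℝ)⁻¹ * ∑ i, (a N ω i - inflObs w v P (Z i ω)) ^ 2) *
        sampleMean Z (fun z => inflObs w v P z ^ 2) N ω - 0 by
      simpa using hdev.mul (isBigOP_of_sub _ hmean)).comp_continuousAt (f := Real.sqrt)
    Real.continuous_sqrt.continuousAt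
  rw [Real.sqrt_zero] at hsqrt
  simp only [sub_zero] at hsqrt
  have hbound : IsLittleOP μ fun N ω => (N : ℝ)⁻¹ * ∑ i, a N ω i ^ 2 -
      sampleMean Z (fun z => inflObs w v P z ^ 2) N ω := by
    refine (hdev.add (hsqrt.const_mul 2)).of_abs_le (Eventually.of_forall fun N =>
      ae_of_all _ fun ω => ?_)
    exact (abs_mean_sq_sub_mean_sq_le (a N ω) fun i => inflObs w v P (Z i ω)).trans (le_abs_self _)
  refine (hbound.add hmean).congr (Eventually.of_forall fun N => ae_of_all _ fun ω => ?_)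
  rw [sigmaTildeSq_eq, sub_add_sub_cancel, ha]
  have : pHat (fun i : Fin N => Z i ω) = fun k => ph k N ω := funext fun k => pHat_eq_sampleMean N ω k
  rw [this]

end VarianceEstimator

/-! ### Asymptotic normality and variance estimation under cross-fitting -/

section Normality

variable {K : ℕ} {M : Fin K → ℕ} {S : Fin K → Type*} [∀ k, MeasurableSpace (S k)]
  {𝒰 : Type*} [MeasurableSpace 𝒰] {Ω : Type*} [MeasurableSpace Ω] {μ : Measure Ω}
  {Z : ℕ → Ω → ObsCluster M S} {U : Ω → 𝒰}
  {split : (N : ℕ) → 𝒰 → (Fin N → Fin K) → Fin N → Fin 2} {fold : (N : ℕ) → Ω → Fin N → Fin 2}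
  {learnE : (N : ℕ) → Fin 2 → 𝒰 → (Fin N → Unit ⊕ ObsCluster M S) →
      ∀ k, Trt (M k) → S k → ℝ}
  {learnG : (N : ℕ) → Fin 2 → 𝒰 → (Fin N → Unit ⊕ ObsCluster M S) →
      ∀ k, Trt (M k) → S k → Outc (M k)}
  {eT : (N : ℕ) → Ω → Fin 2 → ∀ k, Trt (M k) → S k → ℝ}
  {gT : (N : ℕ) → Ω → Fin 2 → ∀ k, Trt (M k) → S k → Outc (M k)}
  {P : Measure (ObsCluster M S)}
  {w : ∀ k, Trt (M k) → S k → Outc (M k)} {v : Fin K → ℝ → ℝ} {Cw c C V ct Ct : ℝ}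

lemma IsCrossFit.measurable_tauTilde (h : IsCrossFit μ Z U split fold learnE learnG eT gT P)
    (hw : ∀ k a, Measurable (w k a)) (N : ℕ) :
    Measurable fun ω => tauTilde w v (eT N ω) (gT N ω) (fold N ω) (fun i : Fin N => Z i ω) := by
  have hcount : ∀ k, Measurable fun ω => typeCount (fun i : Fin N => Z i ω) k := by
    intro k
    simp_rw [typeCount, Finset.card_filter]
    exact Finset.measurable_fun_sum _ fun i _ => Measurable.ite
      ((measurable_sigmaFst.comp (h.measurable_sample i)) (measurableSet_singleton k))
      measurable_const measurable_const
  refine Finset.measurable_fun_sum _ fun k _ => Measurable.mul ?_ (Measurable.div ?_ ?_)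
  -- `v k` is not assumed measurable. It is evaluated only through the integer count, on which every
  -- function is measurable.
  · exact (Measurable.of_discrete (f := fun n : ℕ => v k ((n : ℝ) / N))).comp (hcount k)
  · exact Finset.measurable_fun_sum _ fun ℓ _ => h.measurable_sum_phi hw N ℓ k
  · exact (Measurable.of_discrete (f := fun n : ℕ => (n : ℝ))).comp (hcount k)

lemma IsCrossFit.ae_isNuisance (h : IsCrossFit μ Z U split fold learnE learnG eT gT P)
    (hct : 0 < ct)
    (hgT_bdd : ∀ N ℓ k a, ∀ᵐ ω ∂μ, ∀ᵐ x ∂(covLaw P k), ‖gT N ω ℓ k a x‖ ≤ Ct)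
    (heT_bdd : ∀ N ℓ k a, ∀ᵐ ω ∂μ, ∀ᵐ x ∂(covLaw P k), eT N ω ℓ k a x ∈ Set.Icc ct (1 - ct))
    (N : ℕ) (ℓ : Fin 2) (k : Fin K) :
    ∀ᵐ ω ∂μ, IsNuisance (covLaw P k) (eT N ω ℓ k) (gT N ω ℓ k) ct Ct := by
  filter_upwards [ae_all_iff.2 fun a => hgT_bdd N ℓ k a, ae_all_iff.2 fun a => heT_bdd N ℓ k a]
    with ω hg he
  refine ⟨fun a => ?_, fun a => ?_, fun a => (he a).mono fun x hx => hx.1,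
    fun a => (he a).mono fun x hx => ?_, hg⟩
  · rw [h.eT_eq]
    exact (h.measurable_learnE N ℓ k a).comp
      (measurable_const.prodMk (measurable_const.prodMk measurable_id))
  · rw [h.gT_eq]
    exact (h.measurable_learnG N ℓ k a).comp
      (measurable_const.prodMk (measurable_const.prodMk measurable_id))
  · rw [Real.norm_eq_abs, abs_le]
    constructor <;> linarith [hx.1, hx.2]

/-- Asymptotic normality of the estimator, and consistency of the variance estimator, in terms of
the observed-data law. -/
lemma IsCrossFit.tendsto [IsProbabilityMeasure μ] [IsProbabilityMeasure P]
    (h : IsCrossFit μ Z U split fold learnE learnG eT gT P) (hR : IsRegularLaw P w Cw c C V)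
    (hv : ∀ k, DifferentiableAt ℝ (v k) (typeProb P k))
    (hv' : ∀ k, ContinuousAt (deriv (v k)) (typeProb P k)) (hct : 0 < ct)
    (hgT_bdd : ∀ N ℓ k a, ∀ᵐ ω ∂μ, ∀ᵐ x ∂(covLaw P k), ‖gT N ω ℓ k a x‖ ≤ Ct)
    (heT_bdd : ∀ N ℓ k a, ∀ᵐ ω ∂μ, ∀ᵐ x ∂(covLaw P k), eT N ω ℓ k a x ∈ Set.Icc ct (1 - ct))
    {rg re : ℕ → ℝ}
    (hg_rate : ∀ ℓ k a, IsBigOP μ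
      (fun N ω => ∫ x, ‖outcomeReg P k a x - gT N ω ℓ k a x‖ ^ 2 ∂(covLaw P k))
        (fun N => rg N ^ 2))
    (he_rate : ∀ ℓ k a, IsBigOP μ
      (fun N ω => ∫ x, |propensity P k a x - eT N ω ℓ k a x| ^ 2 ∂(covLaw P k))
        (fun N => re N ^ 2))
    (hrg : Tendsto rg atTop (𝓝 0)) (hre : Tendsto re atTop (𝓝 0))
    (hrate : (fun N => rg N * re N) =o[atTop] fun N : ℕ => (N : ℝ) ^ (-(1 / 2) : ℝ)) :
    TendstoInDistribution
      (fun (N : ℕ) ω => √N *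
        (tauTilde w v (eT N ω) (gT N ω) (fold N ω) (fun i : Fin N => Z i ω) -
          ∑ k, v k (typeProb P k) * thetaObs w P k))
      atTop (fun y : ℝ => y) (fun _ => μ) (gaussianReal 0 Var[inflObs w v P; P].toNNReal) ∧
    TendstoInMeasure μ
      (fun N ω => sigmaTildeSq w v (eT N ω) (gT N ω) (fold N ω) (fun i : Fin N => Z i ω))
      atTop (fun _ => Var[inflObs w v P; P]) := by
  have hn := h.ae_isNuisance hct hgT_bdd heT_bdd
  have hdist : ∀ ℓ k, IsLittleOP μ fun N ω => nuisDist (covLaw P k) (propensity P k) (eT N ω ℓ k)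
      (outcomeReg P k) (gT N ω ℓ k) := fun ℓ k =>
    IsLittleOP.sum Finset.univ fun a _ =>
      ((hg_rate ℓ k a).isLittleOP (by simpa using hrg.pow 2)).add
        ((he_rate ℓ k a).isLittleOP (by simpa using hre.pow 2))
  have hdiff := h.isLittleOP_sum_phiDiff hR hct hn hg_rate he_rate hdist hrate
  have hsq := h.isLittleOP_mean_phiDiff_sq hR hct hn hdist
  constructor
  -- Slutsky: the central limit theorem applies to the mean of the influence function, and the
  -- linearization error vanishes in probability.
  · refine tendstoInDistribution_of_tendstoInMeasure_sub _ _
      (tendstoInDistribution_sqrt_mul_sampleMean h.measurable_sample h.indep_sample h.law_sample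
        (hR.measurable_inflObs (v := v)) hR.memLp_inflObs hR.integral_inflObs) ?_
      fun N => (((h.measurable_tauTilde (fun k => (hR.weight k).meas) N).sub_const
        _).const_mul _).aemeasurable
    refine (tendstoInMeasure_iff_isLittleOP (c := 0)).2 ?_
    simp only [sub_zero]
    exact isLittleOP_sqrt_mul_tauTilde_sub h.measurable_sample h.indep_sample h.law_sample hR
      hv hdiff
  · exact tendstoInMeasure_iff_isLittleOP.2 (isLittleOP_sigmaTildeSq_sub h.measurable_sample
      h.indep_sample h.law_sample hR (fun k => (hv k).continuousAt) hv' hdiff hsq)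

end Normality

end PartialInterference

end

open PartialInterference in
theorem corollary3
    -- cluster types, cluster sizes, covariate spaces
    {K : ℕ} {M : Fin K → ℕ} {S : Fin K → Type*}
    [∀ k, MeasurableSpace (S k)] [∀ k, StandardBorelSpace (S k)]
    -- law of the full data of one cluster
    (F : Measure (FullCluster M S)) [IsProbabilityMeasure F]
    (hp : ∀ k, 0 < typeProb F k)
    (hF : IdentifyingAssumptions F)
    -- the estimand: bounded weights `w_k` and continuously differentiable `v_k`
    (w : ∀ k, Trt (M k) → S k → Outc (M k))
    (hw_meas : ∀ k a, Measurable (w k a))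
    (hw_bdd : ∃ Cw : ℝ, ∀ k a x, ‖w k a x‖ ≤ Cw)
    (v : Fin K → ℝ → ℝ) (hv : ∀ k, ContDiffOn ℝ 1 (v k) (Set.Ioi 0))
    -- the observed clusters: independent, identically distributed
    {Ω : Type*} [MeasurableSpace Ω] (μ : Measure Ω) [IsProbabilityMeasure μ]
    (Z : ℕ → Ω → ObsCluster M S) (hZ_meas : ∀ i, Measurable (Z i))
    (hZ_indep : iIndepFun Z μ) (hZ_law : ∀ i, μ.map (Z i) = obsLaw F)
    -- external randomness of the split and of the learners, independent of the data
    {𝒰 : Type*} [MeasurableSpace 𝒰] (U : Ω → 𝒰) (hU_meas : Measurable U)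
    (hU_indep : IndepFun U (fun ω i => Z i ω) μ)
    -- the random split, stratified by the cluster types
    (split : (N : ℕ) → 𝒰 → (Fin N → Fin K) → Fin N → Fin 2)
    (hsplit_meas : ∀ N t, Measurable fun u => split N u t)
    (fold : (N : ℕ) → Ω → Fin N → Fin 2)
    (hfold : ∀ N ω, fold N ω = split N (U ω) (fun i => (Z i ω).1))
    (hbalance : ∀ k, TendstoInMeasure μ
      (fun N ω => foldProp (fold N ω) (fun i => Z i ω) 0 k
        - foldProp (fold N ω) (fun i => Z i ω) 1 k) atTop (fun _ => 0))
    -- the learners, and the nuisance functions fitted with fold `ℓ` held out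
    (learnE : (N : ℕ) → Fin 2 → 𝒰 → (Fin N → Unit ⊕ ObsCluster M S) →
      ∀ k, Trt (M k) → S k → ℝ)
    (learnG : (N : ℕ) → Fin 2 → 𝒰 → (Fin N → Unit ⊕ ObsCluster M S) →
      ∀ k, Trt (M k) → S k → Outc (M k))
    (hlearnE_meas : ∀ N ℓ k a, Measurable
      fun q : 𝒰 × (Fin N → Unit ⊕ ObsCluster M S) × S k => learnE N ℓ q.1 q.2.1 k a q.2.2)
    (hlearnG_meas : ∀ N ℓ k a, Measurable
      fun q : 𝒰 × (Fin N → Unit ⊕ ObsCluster M S) × S k => learnG N ℓ q.1 q.2.1 k a q.2.2)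
    (eT : (N : ℕ) → Ω → Fin 2 → ∀ k, Trt (M k) → S k → ℝ)
    (gT : (N : ℕ) → Ω → Fin 2 → ∀ k, Trt (M k) → S k → Outc (M k))
    (heT : ∀ N ω ℓ, eT N ω ℓ =
      learnE N ℓ (U ω) (trainData (fold N ω) (fun i => Z i ω) ℓ))
    (hgT : ∀ N ω ℓ, gT N ω ℓ =
      learnG N ℓ (U ω) (trainData (fold N ω) (fun i => Z i ω) ℓ))
    -- (a) bounded nuisance functions, overlap of the estimated propensity score
    (Ct ct : ℝ) (hCt : 0 < Ct) (hct : 0 < ct ∧ ct < 1)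
    (hg_bdd : ∀ k a, ∀ᵐ x ∂(covLaw (obsLaw F) k), ‖outcomeReg (obsLaw F) k a x‖ ≤ Ct)
    (hCov_bdd : ∀ k a, ∀ᵐ x ∂(covLaw (obsLaw F) k),
      ‖Matrix.toEuclideanCLM (n := Fin (M k)) (𝕜 := ℝ) (outcomeCov (obsLaw F) k a x)‖ ≤ Ct)
    (hgT_bdd : ∀ N ℓ k a, ∀ᵐ ω ∂μ, ∀ᵐ x ∂(covLaw (obsLaw F) k), ‖gT N ω ℓ k a x‖ ≤ Ct)
    (heT_bdd : ∀ N ℓ k a, ∀ᵐ ω ∂μ, ∀ᵐ x ∂(covLaw (obsLaw F) k),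
      eT N ω ℓ k a x ∈ Set.Icc ct (1 - ct))
    -- (b) convergence rates
    (rg re : ℕ → ℝ)
    (hg_rate : ∀ ℓ k a, IsBigOP μ
      (fun N ω => ∫ x, ‖outcomeReg (obsLaw F) k a x - gT N ω ℓ k a x‖ ^ 2
        ∂(covLaw (obsLaw F) k)) (fun N => rg N ^ 2))
    (he_rate : ∀ ℓ k a, IsBigOP μ
      (fun N ω => ∫ x, |propensity (obsLaw F) k a x - eT N ω ℓ k a x| ^ 2
        ∂(covLaw (obsLaw F) k)) (fun N => re N ^ 2))
    (hrg : Tendsto rg atTop (𝓝 0)) (hre : Tendsto re atTop (𝓝 0))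
    (hrate : (fun N => rg N * re N) =o[atTop] fun N : ℕ => (N : ℝ) ^ (-(1 / 2) : ℝ)) :
    -- the variance is finite and equals the semiparametric efficiency bound
    MemLp (influence w v F) 2 (obsLaw F) ∧
    IsEfficiencyBound ⟨obsLaw F, inferInstance⟩ (tauObs w v) Var[influence w v F; obsLaw F] ∧
    tauObs w v ⟨obsLaw F, inferInstance⟩ = tau w v F ∧
    -- asymptotic normality
    TendstoInDistribution
      (fun (N : ℕ) ω => Real.sqrt N *
        (tauTilde w v (eT N ω) (gT N ω) (fold N ω) (fun i : Fin N => Z i ω) - tau w v F))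
      atTop (fun y : ℝ => y) (fun _ => μ)
      (gaussianReal 0 (Var[influence w v F; obsLaw F]).toNNReal) ∧
    -- consistency of the variance estimator
    TendstoInMeasure μ
      (fun N ω => sigmaTildeSq w v (eT N ω) (gT N ω) (fold N ω) (fun i : Fin N => Z i ω))
      atTop (fun _ => Var[influence w v F; obsLaw F]) := by
  obtain ⟨Cw, hCw⟩ := hw_bdd
  obtain ⟨c, hc, hover⟩ := hF.overlap
  have hR : IsRegularLaw (obsLaw F) w Cw c Ct (∑ k, M k * Ct) :=
    isRegularLaw_obsLaw hp hF hw_meas hCw hc (fun k a => (hover k a).mono fun x hx => hx.1) hCt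
      hg_bdd hCov_bdd
  have hcross : IsCrossFit μ Z U split fold learnE learnG eT gT (obsLaw F) :=
    ⟨hZ_meas, hZ_indep, hZ_law, hU_meas, hU_indep, hsplit_meas, hfold, hlearnE_meas, hlearnG_meas,
      heT, hgT⟩
  have hv_diff : ∀ k, DifferentiableAt ℝ (v k) (typeProb (obsLaw F) k) := fun k =>
    ((hv k).differentiableOn one_ne_zero).differentiableAt (Ioi_mem_nhds (hR.pos k))
  have hv_cont : ∀ k, ContinuousAt (deriv (v k)) (typeProb (obsLaw F) k) := fun k =>
    ((hv k).continuousOn_deriv_of_isOpen isOpen_Ioi le_rfl).continuousAt (Ioi_mem_nhds (hR.pos k))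
  have htau : ∑ k, v k (typeProb (obsLaw F) k) * thetaObs w (obsLaw F) k = tau w v F :=
    tauObs_obsLaw hF hR
  -- Identification removes the full-data law from the goal; in this form the equality with `tauObs`
  -- holds by definition.
  rw [influence_eq_inflObs hF hR, ← htau]
  exact ⟨hR.memLp_inflObs,
    hR.isEfficiencyBound hv_diff fun k a => (hover k a).mono fun x hx => hx.2, rfl,
    hcross.tendsto hR hv_diff hv_cont hct.1 hgT_bdd heT_bdd hg_rate he_rate hrg hre hrate⟩
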